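/- Let $\zeta\in\mathbb C\setminus\{0,-1\}$ and let $\mathfrak g=D(2|1;\zeta)$ be the Lie superalgebra with Cartan matrix $\begin{pmatrix}0&1&\zeta\\-1&2&0\\-1&0&2\end{pmatrix}$, Chevalley generators $e_i,f_i$ ($i=0,1,2$), Cartan subalgebra $\mathfrak h$ with basis $h_{2\delta},h_{2\epsilon_1},h_{2\epsilon_2}$ and dual basis $\delta,\epsilon_1,\epsilon_2$ of $\mathfrak h^*$, simple roots $\delta-\epsilon_1-\epsilon_2$ (odd), $2\epsilon_1$, $2\epsilon_2$, positive even roots $\Phi^+_{\bar 0}=\{2\delta,2\epsilon_1,2\epsilon_2\}$ and positive odd roots $\delta\pm\epsilon_1\pm\epsilon_2$. Let $\mathfrak n_+$ be the sum of the positive root spaces, and let $\rho=-\delta+\epsilon_1+\epsilon_2$ be half the sum of the positive even roots minus half the sum of the positive odd roots. Equip $\mathfrak h^*$ with the bilinear form for which $\delta,\epsilon_1,\epsilon_2$ are orthogonal with $(\delta,\delta)=-(1+\zeta)$, $(\epsilon_1,\epsilon_1)=1$, $(\epsilon_2,\epsilon_2)=\zeta$. For $\lambda\in\mathfrak h^*$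 let $M_\lambda=U(\mathfrak g)\otimes_{U(\mathfrak h+\mathfrak n_+)}\mathbb C_{\lambda-\rho}$ be the Verma module of highest weight $\lambda-\rho$, with highest weight vector $v_\lambda^+$ and irreducible quotient $L_\lambda$. A singular vector is a nonzero weight vector annihilated by $\mathfrak n_+$. For $\gamma\in\Phi^+_{\bar 0}$ put $s_\gamma\lambda=\lambda-\langle\lambda,h_\gamma\rangle\gamma$. Let $\lambda\in\mathfrak h^*$ and $\gamma\in\Phi_{\bar 0}^+$ be such that $\langle\lambda,h_\gamma\rangle=n\in\mathbb N=\{0,1,2,\dots\}$. Then $M_\lambda$ contains a singular vector of weight $\lambda-\rho-n\gamma$, hence $\mathrm{Hom}_{\mathfrak g}(M_{s_\gamma\lambda},M_\lambda)\ne0$, and in particular the composition multiplicity satisfies $[M_\lambda:L_{s_\gamma\lambda}]>0$. Moreover, let $\gamma=2\delta$, and put $e_{\delta-\epsilon_1-\epsilon_2}=e_0$, $e_{\delta+\epsilon_1-\epsilon_2}=[e_0,e_1]$, $e_{\delta-\epsilon_1+\epsilon_2}=[e_2,e_0]$, $e_{\delta+\epsilon_1+\epsilon_2}=[[e_0,e_1],e_2]$,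 $f_{2\delta}=[[f_0,f_1],[f_0,f_2]]$. Then the vector $$u=e_{\delta-\epsilon_1-\epsilon_2}\,e_{\delta+\epsilon_1-\epsilon_2}\,e_{\delta+\epsilon_1+\epsilon_2}\,e_{\delta-\epsilon_1+\epsilon_2}\,f_{2\delta}^{\,n+2}\,v_\lambda^+\in M_\lambda$$ has weight $\lambda-\rho-2n\delta$ (that is, $\mathfrak h$ acts on $u$ by this weight) and is annihilated by $\mathfrak n_+$; and $u\neq0$ whenever $n\ge1$ or $(\lambda,\alpha)\ne0$ for all odd roots $\alpha$. In these cases $u$ is therefore a singular vector as above. -/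

import Mathlib

/-! ### Lie superalgebras over `ℂ` and their enveloping algebras -/

/-- The Koszul sign `(-1)^{ab}` of two parities. -/
def koszulSign (a b : ZMod 2) : ℂ := if a = 1 ∧ b = 1 then -1 else 1

/-- The structure of a complex Lie superalgebra on a vector space `L`. -/
structure LieSuperalgebra (L : Type) [AddCommGroup L] [Module ℂ L] where
  /-- the homogeneous parts -/
  grade : ZMod 2 → Submodule ℂ L
  isCompl : IsCompl (grade 0) (grade 1)
  /-- the superbracket -/
  br : L →ₗ[ℂ] L →ₗ[ℂ] L
  br_mem : ∀ {a b : ZMod 2} {x y : L}, x ∈ grade a → y ∈ grade b → br x y ∈ grade (a + b)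
  skew : ∀ {a b : ZMod 2} {x y : L}, x ∈ grade a → y ∈ grade b →
    br x y = -(koszulSign a b • br y x)
  jacobi : ∀ {a b : ZMod 2} {x y : L} (z : L), x ∈ grade a → y ∈ grade b →
    br x (br y z) = br (br x y) z + koszulSign a b • br y (br x z)

namespace LieSuperalgebra

variable {L : Type} [AddCommGroup L] [Module ℂ L]

/-- The defining relations `x y = (-1)^{|x||y|} y x + [x, y]` of the enveloping algebra. -/
inductive Rel (S : LieSuperalgebra L) : TensorAlgebra ℂ L → TensorAlgebra ℂ L → Prop
  | mk {a b : ZMod 2} {x y : L} (hx : x ∈ S.grade a) (hy : y ∈ S.grade b) :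
      Rel S (TensorAlgebra.ι ℂ x * TensorAlgebra.ι ℂ y)
        (koszulSign a b • (TensorAlgebra.ι ℂ y * TensorAlgebra.ι ℂ x) +
          TensorAlgebra.ι ℂ (S.br x y))

/-- The universal enveloping algebra `U(S)`, as an associative algebra. -/
abbrev U (S : LieSuperalgebra L) : Type := RingQuot S.Rel

/-- The canonical map from the Lie superalgebra to its enveloping algebra. -/
noncomputable def ι (S : LieSuperalgebra L) : L →ₗ[ℂ] S.U :=
  (RingQuot.mkAlgHom ℂ S.Rel).toLinearMap ∘ₗ TensorAlgebra.ι ℂ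

end LieSuperalgebra

/-! ### Composition multiplicities -/

/-- The multiplicity `[M : N]` of a simple module `N` as a composition factor of `M`: the largest
number of steps with quotient isomorphic to `N` in a finite chain of submodules of `M`. -/
noncomputable def compMult (R M N : Type) [Ring R] [AddCommGroup M] [Module R M]
    [AddCommGroup N] [Module R N] : ℕ∞ :=
  ⨆ (k : ℕ) (F : Fin (k + 1) →o Submodule R M),
    Set.encard {i : Fin k |
      Nonempty ((F i.succ ⧸ (F i.castSucc).comap (F i.succ).subtype) ≃ₗ[R] N)}

/-! ### The Lie superalgebra `D(2|1;ζ)` -/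

namespace D21

/-- The Lie algebra `sl₂(ℂ)`. -/
abbrev sl2 : Type := LieAlgebra.SpecialLinear.sl (Fin 2) ℂ

/-- The odd part `ℂ² ⊗ ℂ² ⊗ ℂ²`: a tensor is given by its coordinates. -/
abbrev Odd : Type := Fin 2 → Fin 2 → Fin 2 → ℂ

/-- The underlying space `(sl₂ ⊕ sl₂ ⊕ sl₂) ⊕ (ℂ² ⊗ ℂ² ⊗ ℂ²)`. The three copies of `sl₂` have the
roots `±2δ`, `±2ε₁`, `±2ε₂`, in this order. -/
abbrev Carrier : Type := (Fin 3 → sl2) × Odd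

/-- The matrix of the invariant symplectic form `ψ` on `ℂ²`. -/
def psi : Matrix (Fin 2) (Fin 2) ℂ := !![0, 1; -1, 0]

/-- The `sl₂`-equivariant symmetric map `p : ℂ² × ℂ² → sl₂`, `p(x,y)z = ψ(y,z)x + ψ(x,z)y`. -/
def pMat (x y : Fin 2 → ℂ) : Matrix (Fin 2) (Fin 2) ℂ :=
  Matrix.of fun a c => (∑ b, y b * psi b c) * x a + (∑ b, x b * psi b c) * y a

theorem pMat_mem (x y : Fin 2 → ℂ) : pMat x y ∈ LieAlgebra.SpecialLinear.sl (Fin 2) ℂ := by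
  refine LinearMap.mem_ker.2 ?_
  simp [pMat, psi, Matrix.trace, Fin.sum_univ_two]
  ring

/-- `pMat` with values in `sl₂`. -/
def p (x y : Fin 2 → ℂ) : sl2 := ⟨pMat x y, pMat_mem x y⟩

/-- The action of `sl₂ ⊕ sl₂ ⊕ sl₂` on `ℂ² ⊗ ℂ² ⊗ ℂ²`, one copy on each tensor factor. -/
def act (A : Fin 3 → sl2) (v : Odd) : Odd := fun a b c =>
  (∑ i, (A 0).1 a i * v i b c) + (∑ i, (A 1).1 b i * v a i c) + (∑ i, (A 2).1 c i * v a b i)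

/-- The scalars `σ = ½(-(1+ζ), 1, ζ)`, of sum zero. -/
noncomputable def sigma (ζ : ℂ) : Fin 3 → ℂ := ![-(1 + ζ) / 2, 1 / 2, ζ / 2]

/-- The bracket of two odd elements: on pure tensors,
`[x₀⊗x₁⊗x₂, y₀⊗y₁⊗y₂]` has the `i`-th component `σᵢ ψ(xⱼ,yⱼ) ψ(xₖ,yₖ) p(xᵢ,yᵢ)`,
where `{i,j,k} = {0,1,2}`. -/
noncomputable def oddBr (ζ : ℂ) (v w : Odd) : Fin 3 → sl2 :=
  ![sigma ζ 0 • ∑ j, ∑ k, ∑ j', ∑ k', (psi j j' * psi k k') •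
      p (fun a => v a j k) (fun a => w a j' k'),
    sigma ζ 1 • ∑ j, ∑ k, ∑ j', ∑ k', (psi j j' * psi k k') •
      p (fun a => v j a k) (fun a => w j' a k'),
    sigma ζ 2 • ∑ j, ∑ k, ∑ j', ∑ k', (psi j j' * psi k k') •
      p (fun a => v j k a) (fun a => w j' k' a)]

/-- The superbracket of `D(2|1;ζ)`. -/
noncomputable def brFun (ζ : ℂ) (x y : Carrier) : Carrier :=
  (fun i => ⁅x.1 i, y.1 i⁆ + oddBr ζ x.2 y.2 i, act x.1 y.2 - act y.1 x.2)

theorem sl2_one_one (A : sl2) : A.1 1 1 = -A.1 0 0 := by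
  have h : Matrix.traceLinearMap (Fin 2) ℂ ℂ A.1 = 0 := LinearMap.mem_ker.1 A.2
  simp [Matrix.trace, Fin.sum_univ_two] at h
  linear_combination h

theorem sl2_ext {A B : sl2} (h0 : A.1 0 0 = B.1 0 0) (h1 : A.1 0 1 = B.1 0 1)
    (h2 : A.1 1 0 = B.1 1 0) : A = B := by
  apply Subtype.ext
  ext i j
  fin_cases i <;> fin_cases j
  · exact h0
  · exact h1
  · exact h2
  · change A.1 1 1 = B.1 1 1
    rw [sl2_one_one, sl2_one_one, h0]

theorem carrier_ext {x y : Carrier} (h : ∀ i, x.1 i = y.1 i)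
    (h' : ∀ a b c, x.2 a b c = y.2 a b c) : x = y :=
  Prod.ext (funext h) (funext fun a => funext fun b => funext fun c => h' a b c)

theorem coe_p (x y : Fin 2 → ℂ) : (p x y).1 = pMat x y := rfl

theorem lie_mat (A B : sl2) : ⁅A, B⁆.1 = A.1 * B.1 - B.1 * A.1 :=
  LieAlgebra.SpecialLinear.sl_bracket (Fin 2) ℂ A B

theorem sl2_add (A B : sl2) : (A + B).1 = A.1 + B.1 := rfl

theorem sl2_sub (A B : sl2) : (A - B).1 = A.1 - B.1 := rfl

theorem sl2_smul (c : ℂ) (A : sl2) : (c • A).1 = c • A.1 := rfl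

theorem oddBr_0_0_0 (ζ : ℂ) (v w : Odd) : (oddBr ζ v w 0).1 0 0 =
    -sigma ζ 0 * ((v 0 0 0 * w 1 1 1 - v 0 0 1 * w 1 1 0 - v 0 1 0 * w 1 0 1 + v 0 1 1 * w 1 0 0) +
      (v 1 0 0 * w 0 1 1 - v 1 0 1 * w 0 1 0 - v 1 1 0 * w 0 0 1 + v 1 1 1 * w 0 0 0)) := by
  simp [oddBr, coe_p, pMat, psi, Fin.sum_univ_two]
  ring

theorem oddBr_0_0_1 (ζ : ℂ) (v w : Odd) : (oddBr ζ v w 0).1 0 1 =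
    2 * sigma ζ 0 *
      (v 0 0 0 * w 0 1 1 - v 0 0 1 * w 0 1 0 - v 0 1 0 * w 0 0 1 + v 0 1 1 * w 0 0 0) := by
  simp [oddBr, coe_p, pMat, psi, Fin.sum_univ_two]
  ring

theorem oddBr_0_1_0 (ζ : ℂ) (v w : Odd) : (oddBr ζ v w 0).1 1 0 =
    -2 * sigma ζ 0 *
      (v 1 0 0 * w 1 1 1 - v 1 0 1 * w 1 1 0 - v 1 1 0 * w 1 0 1 + v 1 1 1 * w 1 0 0) := by
  simp [oddBr, coe_p, pMat, psi, Fin.sum_univ_two]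
  ring

theorem oddBr_1_0_0 (ζ : ℂ) (v w : Odd) : (oddBr ζ v w 1).1 0 0 =
    -sigma ζ 1 * ((v 0 0 0 * w 1 1 1 - v 0 0 1 * w 1 1 0 - v 1 0 0 * w 0 1 1 + v 1 0 1 * w 0 1 0) +
      (v 0 1 0 * w 1 0 1 - v 0 1 1 * w 1 0 0 - v 1 1 0 * w 0 0 1 + v 1 1 1 * w 0 0 0)) := by
  simp [oddBr, coe_p, pMat, psi, Fin.sum_univ_two]
  ring

theorem oddBr_1_0_1 (ζ : ℂ) (v w : Odd) : (oddBr ζ v w 1).1 0 1 =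
    2 * sigma ζ 1 *
      (v 0 0 0 * w 1 0 1 - v 0 0 1 * w 1 0 0 - v 1 0 0 * w 0 0 1 + v 1 0 1 * w 0 0 0) := by
  simp [oddBr, coe_p, pMat, psi, Fin.sum_univ_two]
  ring

theorem oddBr_1_1_0 (ζ : ℂ) (v w : Odd) : (oddBr ζ v w 1).1 1 0 =
    -2 * sigma ζ 1 *
      (v 0 1 0 * w 1 1 1 - v 0 1 1 * w 1 1 0 - v 1 1 0 * w 0 1 1 + v 1 1 1 * w 0 1 0) := by
  simp [oddBr, coe_p, pMat, psi, Fin.sum_univ_two]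
  ring

theorem oddBr_2_0_0 (ζ : ℂ) (v w : Odd) : (oddBr ζ v w 2).1 0 0 =
    -sigma ζ 2 * ((v 0 0 0 * w 1 1 1 - v 0 1 0 * w 1 0 1 - v 1 0 0 * w 0 1 1 + v 1 1 0 * w 0 0 1) +
      (v 0 0 1 * w 1 1 0 - v 0 1 1 * w 1 0 0 - v 1 0 1 * w 0 1 0 + v 1 1 1 * w 0 0 0)) := by
  simp [oddBr, coe_p, pMat, psi, Fin.sum_univ_two]
  ring

theorem oddBr_2_0_1 (ζ : ℂ) (v w : Odd) : (oddBr ζ v w 2).1 0 1 =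
    2 * sigma ζ 2 *
      (v 0 0 0 * w 1 1 0 - v 0 1 0 * w 1 0 0 - v 1 0 0 * w 0 1 0 + v 1 1 0 * w 0 0 0) := by
  simp [oddBr, coe_p, pMat, psi, Fin.sum_univ_two]
  ring

theorem oddBr_2_1_0 (ζ : ℂ) (v w : Odd) : (oddBr ζ v w 2).1 1 0 =
    -2 * sigma ζ 2 *
      (v 0 0 1 * w 1 1 1 - v 0 1 1 * w 1 0 1 - v 1 0 1 * w 0 1 1 + v 1 1 1 * w 0 0 1) := by
  simp [oddBr, coe_p, pMat, psi, Fin.sum_univ_two]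
  ring

theorem slot_cases {P : Fin 3 → Prop} (h0 : P 0) (h1 : P 1) (h2 : P 2) (i : Fin 3) : P i := by
  fin_cases i
  exacts [h0, h1, h2]

theorem bit_cases {P : Fin 2 → Prop} (h0 : P 0) (h1 : P 1) (i : Fin 2) : P i := by
  fin_cases i
  exacts [h0, h1]

theorem oddBr_add_left (ζ : ℂ) (v v' w : Odd) (i : Fin 3) :
    oddBr ζ (v + v') w i = oddBr ζ v w i + oddBr ζ v' w i := by
  revert i
  refine slot_cases ?_ ?_ ?_ <;> refine sl2_ext ?_ ?_ ?_ <;>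
    simp only [sl2_add, Matrix.add_apply, Pi.add_apply, oddBr_0_0_0, oddBr_0_0_1, oddBr_0_1_0,
      oddBr_1_0_0, oddBr_1_0_1, oddBr_1_1_0, oddBr_2_0_0, oddBr_2_0_1, oddBr_2_1_0] <;>
    ring

theorem oddBr_smul_left (ζ c : ℂ) (v w : Odd) (i : Fin 3) :
    oddBr ζ (c • v) w i = c • oddBr ζ v w i := by
  revert i
  refine slot_cases ?_ ?_ ?_ <;> refine sl2_ext ?_ ?_ ?_ <;>
    simp only [sl2_smul, Matrix.smul_apply, Pi.smul_apply, smul_eq_mul, oddBr_0_0_0, oddBr_0_0_1, oddBr_0_1_0,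
      oddBr_1_0_0, oddBr_1_0_1, oddBr_1_1_0, oddBr_2_0_0, oddBr_2_0_1, oddBr_2_1_0] <;>
    ring

theorem oddBr_comm (ζ : ℂ) (v w : Odd) (i : Fin 3) : oddBr ζ v w i = oddBr ζ w v i := by
  revert i
  refine slot_cases ?_ ?_ ?_ <;> refine sl2_ext ?_ ?_ ?_ <;>
    simp only [oddBr_0_0_0, oddBr_0_0_1, oddBr_0_1_0,
      oddBr_1_0_0, oddBr_1_0_1, oddBr_1_1_0, oddBr_2_0_0, oddBr_2_0_1, oddBr_2_1_0] <;> ring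

theorem act_oddBr (ζ : ℂ) (A : Fin 3 → sl2) (v w : Odd) (i : Fin 3) :
    ⁅A i, oddBr ζ v w i⁆ = oddBr ζ (act A v) w i + oddBr ζ v (act A w) i := by
  revert i
  refine slot_cases ?_ ?_ ?_ <;> refine sl2_ext ?_ ?_ ?_ <;>
    simp only [sl2_add, Matrix.add_apply, Matrix.sub_apply, lie_mat,
      Matrix.mul_apply, Fin.sum_univ_two, sl2_one_one, act, oddBr_0_0_0, oddBr_0_0_1, oddBr_0_1_0,
      oddBr_1_0_0, oddBr_1_0_1, oddBr_1_1_0, oddBr_2_0_0, oddBr_2_0_1, oddBr_2_1_0] <;>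
    ring

theorem act_lie (A B : Fin 3 → sl2) (v : Odd) :
    act (fun i => ⁅A i, B i⁆) v = act A (act B v) - act B (act A v) := by
  funext a b c
  revert a b c
  refine bit_cases ?_ ?_ <;> refine bit_cases ?_ ?_ <;> refine bit_cases ?_ ?_ <;>
    simp only [act, Fin.sum_univ_two, sl2_one_one, Pi.sub_apply, Matrix.sub_apply, lie_mat,
      Matrix.mul_apply] <;> ring

theorem odd_jacobi (ζ : ℂ) (u v w : Odd) :
    act (oddBr ζ u v) w + act (oddBr ζ v w) u + act (oddBr ζ w u) v = 0 := by
  have h0 : sigma ζ 0 = -(1 + ζ) / 2 := rfl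
  have h1 : sigma ζ 1 = 1 / 2 := rfl
  have h2 : sigma ζ 2 = ζ / 2 := rfl
  funext a b c
  revert a b c
  refine bit_cases ?_ ?_ <;> refine bit_cases ?_ ?_ <;> refine bit_cases ?_ ?_ <;>
    simp only [act, Fin.sum_univ_two, sl2_one_one, Pi.add_apply, Pi.zero_apply, h0, h1, h2, oddBr_0_0_0, oddBr_0_0_1, oddBr_0_1_0,
      oddBr_1_0_0, oddBr_1_0_1, oddBr_1_1_0, oddBr_2_0_0, oddBr_2_0_1, oddBr_2_1_0] <;>
    ring

theorem oddBr_add_right (ζ : ℂ) (v w w' : Odd) (i : Fin 3) :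
    oddBr ζ v (w + w') i = oddBr ζ v w i + oddBr ζ v w' i := by
  rw [oddBr_comm, oddBr_add_left, oddBr_comm ζ w, oddBr_comm ζ w']

theorem oddBr_smul_right (ζ c : ℂ) (v w : Odd) (i : Fin 3) :
    oddBr ζ v (c • w) i = c • oddBr ζ v w i := by
  rw [oddBr_comm, oddBr_smul_left, oddBr_comm ζ w]

theorem act_add_left (A B : Fin 3 → sl2) (v : Odd) : act (A + B) v = act A v + act B v := by
  funext a b c
  simp only [act, Pi.add_apply, sl2_add, Matrix.add_apply, Fin.sum_univ_two]
  ring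

theorem act_smul_left (r : ℂ) (A : Fin 3 → sl2) (v : Odd) : act (r • A) v = r • act A v := by
  funext a b c
  simp only [act, Pi.smul_apply, sl2_smul, Matrix.smul_apply, Fin.sum_univ_two, smul_eq_mul]
  ring

theorem act_add_right (A : Fin 3 → sl2) (v w : Odd) : act A (v + w) = act A v + act A w := by
  funext a b c
  simp only [act, Pi.add_apply, Fin.sum_univ_two]
  ring

theorem act_smul_right (r : ℂ) (A : Fin 3 → sl2) (v : Odd) : act A (r • v) = r • act A v := by
  funext a b c
  simp only [act, Pi.smul_apply, Fin.sum_univ_two, smul_eq_mul]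
  ring

/-- The superbracket of `D(2|1;ζ)` as a bilinear map. -/
noncomputable def brLin (ζ : ℂ) : Carrier →ₗ[ℂ] Carrier →ₗ[ℂ] Carrier :=
  LinearMap.mk₂ ℂ (brFun ζ)
    (fun x x' y => by
      refine Prod.ext (funext fun i => ?_) ?_
      · simp only [brFun, Prod.fst_add, Prod.snd_add, Pi.add_apply, add_lie, oddBr_add_left]
        abel
      · simp only [brFun, Prod.fst_add, Prod.snd_add, act_add_left, act_add_right]
        abel)
    (fun c x y => by
      refine Prod.ext (funext fun i => ?_) ?_
      · simp only [brFun, Prod.smul_fst, Prod.smul_snd, Pi.smul_apply, smul_lie, oddBr_smul_left,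
          smul_add]
      · simp only [brFun, Prod.smul_fst, Prod.smul_snd, act_smul_left, act_smul_right, smul_sub])
    (fun x y y' => by
      refine Prod.ext (funext fun i => ?_) ?_
      · simp only [brFun, Prod.fst_add, Prod.snd_add, Pi.add_apply, lie_add, oddBr_add_right]
        abel
      · simp only [brFun, Prod.fst_add, Prod.snd_add, act_add_left, act_add_right]
        abel)
    (fun c x y => by
      refine Prod.ext (funext fun i => ?_) ?_
      · simp only [brFun, Prod.smul_fst, Prod.smul_snd, Pi.smul_apply, lie_smul, oddBr_smul_right,
          smul_add]
      · simp only [brFun, Prod.smul_fst, Prod.smul_snd, act_smul_left, act_smul_right, smul_sub])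

/-- The even part `(sl₂)³ ⊕ 0` and the odd part `0 ⊕ (ℂ²)^{⊗3}`. -/
def gradePart (a : ZMod 2) : Submodule ℂ Carrier :=
  if a = 0 then LinearMap.ker (LinearMap.snd ℂ (Fin 3 → sl2) Odd)
  else LinearMap.ker (LinearMap.fst ℂ (Fin 3 → sl2) Odd)

theorem mem_gradePart_zero {x : Carrier} : x ∈ gradePart 0 ↔ x.2 = 0 := by
  simp [gradePart]

theorem mem_gradePart_one {x : Carrier} : x ∈ gradePart 1 ↔ x.1 = 0 := by
  simp [gradePart]

theorem brLin_apply (ζ : ℂ) (x y : Carrier) : brLin ζ x y = brFun ζ x y := rfl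

theorem oddBr_zero_left (ζ : ℂ) (w : Odd) (i : Fin 3) : oddBr ζ 0 w i = 0 := by
  simpa using oddBr_smul_left ζ 0 0 w i

theorem oddBr_zero_right (ζ : ℂ) (w : Odd) (i : Fin 3) : oddBr ζ w 0 i = 0 := by
  rw [oddBr_comm, oddBr_zero_left]

theorem act_zero_left (w : Odd) : act 0 w = 0 := by
  simpa using act_smul_left 0 0 w

theorem act_zero_right (A : Fin 3 → sl2) : act A 0 = 0 := by
  simpa using act_smul_right 0 A 0

theorem act_fun_zero (w : Odd) : act (fun _ => 0) w = 0 := act_zero_left w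

theorem act_neg_right (A : Fin 3 → sl2) (v : Odd) : act A (-v) = -act A v := by
  simpa using act_smul_right (-1) A v

theorem oddBr_neg_left (ζ : ℂ) (v w : Odd) (i : Fin 3) : oddBr ζ (-v) w i = -oddBr ζ v w i := by
  simpa using oddBr_smul_left ζ (-1) v w i

theorem oddBr_neg_right (ζ : ℂ) (v w : Odd) (i : Fin 3) : oddBr ζ v (-w) i = -oddBr ζ v w i := by
  simpa using oddBr_smul_right ζ (-1) v w i

theorem oddBr_comm' (ζ : ℂ) (v w : Odd) : oddBr ζ v w = oddBr ζ w v :=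
  funext (oddBr_comm ζ v w)

theorem parity_cases (a : ZMod 2) : a = 0 ∨ a = 1 := by
  fin_cases a
  exacts [Or.inl rfl, Or.inr rfl]

end D21

/-- The Lie superalgebra `D(2|1;ζ)`. -/
noncomputable def D21 (ζ : ℂ) : LieSuperalgebra D21.Carrier where
  grade := D21.gradePart
  isCompl := by
    refine IsCompl.of_eq ?_ ?_
    · refine (Submodule.eq_bot_iff _).2 fun x hx => ?_
      exact Prod.ext (D21.mem_gradePart_one.1 hx.2) (D21.mem_gradePart_zero.1 hx.1)
    · refine eq_top_iff.2 fun x _ => Submodule.mem_sup.2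
        ⟨(x.1, 0), D21.mem_gradePart_zero.2 rfl, (0, x.2), D21.mem_gradePart_one.2 rfl, ?_⟩
      simp
  br := D21.brLin ζ
  br_mem := by
    intro a b x y
    rcases D21.parity_cases a with rfl | rfl <;> rcases D21.parity_cases b with rfl | rfl <;>
      simp +decide only [D21.mem_gradePart_zero, D21.mem_gradePart_one, add_zero, zero_add,
        show (1 + 1 : ZMod 2) = 0 from rfl] <;> intro hx hy
    · simp [D21.brLin_apply, D21.brFun, hx, hy, D21.act_zero_right]
    · funext i
      simp [D21.brLin_apply, D21.brFun, hx, hy, D21.oddBr_zero_left]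
    · funext i
      simp [D21.brLin_apply, D21.brFun, hx, hy, D21.oddBr_zero_right]
    · simp [D21.brLin_apply, D21.brFun, hx, hy, D21.act_zero_left]
  skew := by
    intro a b x y
    rcases D21.parity_cases a with rfl | rfl <;> rcases D21.parity_cases b with rfl | rfl <;>
      simp only [D21.mem_gradePart_zero, D21.mem_gradePart_one] <;> intro hx hy <;>
      refine Prod.ext (funext fun i => ?_) ?_ <;>
      simp [koszulSign, D21.brLin_apply, D21.brFun, hx, hy, D21.act_zero_left, D21.act_zero_right,
        D21.oddBr_zero_left, D21.oddBr_zero_right, D21.oddBr_comm ζ x.2 y.2]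
  jacobi := by
    intro a b x y z
    rcases D21.parity_cases a with rfl | rfl <;> rcases D21.parity_cases b with rfl | rfl <;>
      simp only [D21.mem_gradePart_zero, D21.mem_gradePart_one] <;> intro hx hy <;>
      refine Prod.ext (funext fun i => ?_) ?_ <;>
      simp [koszulSign, D21.brLin_apply, D21.brFun, hx, hy, D21.oddBr_zero_left,
        D21.oddBr_zero_right, D21.oddBr_neg_left, D21.oddBr_neg_right, D21.act_zero_right,
        D21.act_zero_left, D21.act_fun_zero, D21.act_neg_right]
    · rw [D21.act_lie x.1 y.1 z.2]
      abel
    · rw [D21.act_oddBr ζ x.1 y.2 z.2 i]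
    · rw [D21.act_lie x.1 z.1 y.2]
      abel
    · rw [D21.act_oddBr ζ y.1 x.2 z.2 i]
      abel
    · rw [D21.act_lie y.1 z.1 x.2]
      abel
    · have h := D21.act_oddBr ζ z.1 x.2 y.2 i
      rw [← lie_skew, neg_eq_iff_eq_neg] at h
      rw [h, D21.oddBr_comm ζ y.2]
      abel
    · have h := D21.odd_jacobi ζ x.2 y.2 z.2
      rw [D21.oddBr_comm' ζ z.2 x.2] at h
      linear_combination -h

namespace D21

/-- The superbracket of `D(2|1;ζ)`. -/
noncomputable abbrev br (ζ : ℂ) (x y : Carrier) : Carrier := (D21 ζ).br x y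

/-! ### Cartan subalgebra, weights, roots -/

/-- The standard basis vector `e` of `sl₂`. -/
def slE : sl2 := ⟨!![0, 1; 0, 0], LinearMap.mem_ker.2 (by simp [Matrix.trace])⟩

/-- The standard basis vector `f` of `sl₂`. -/
def slF : sl2 := ⟨!![0, 0; 1, 0], LinearMap.mem_ker.2 (by simp [Matrix.trace])⟩

/-- The standard basis vector `h` of `sl₂`. -/
def slH : sl2 := ⟨!![1, 0; 0, -1], LinearMap.mem_ker.2 (by simp [Matrix.trace, Fin.sum_univ_two])⟩

/-- The element `t₀ h_{2δ} + t₁ h_{2ε₁} + t₂ h_{2ε₂}` of the Cartan subalgebra `𝔥`. -/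
def cartan (t : Fin 3 → ℂ) : Carrier := (fun i => t i • slH, 0)

/-- Weights, i.e. elements of `𝔥*`: `λ` stands for `λ₀ δ + λ₁ ε₁ + λ₂ ε₂`, where `δ, ε₁, ε₂` is the
basis dual to `h_{2δ}, h_{2ε₁}, h_{2ε₂}`. -/
abbrev Weight : Type := Fin 3 → ℂ

/-- The value `⟨λ, h⟩` of a weight at the Cartan element `h = cartan t`. -/
def pair (lam : Weight) (t : Fin 3 → ℂ) : ℂ := ∑ i, lam i * t i

/-- The bilinear form on `𝔥*` with `δ, ε₁, ε₂` orthogonal and `(δ,δ) = -(1+ζ)`, `(ε₁,ε₁) = 1`,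
`(ε₂,ε₂) = ζ`. -/
def form (ζ : ℂ) (lam mu : Weight) : ℂ :=
  -(1 + ζ) * (lam 0 * mu 0) + lam 1 * mu 1 + ζ * (lam 2 * mu 2)

/-- The positive even roots `2δ, 2ε₁, 2ε₂` (numbered `0, 1, 2`). -/
def evenRoot (i : Fin 3) : Weight := Pi.single i 2

/-- The coroots `h_{2δ}, h_{2ε₁}, h_{2ε₂}`, as coordinates of elements of `𝔥`. -/
def coroot (i : Fin 3) : Fin 3 → ℂ := Pi.single i 1

/-- The positive odd roots `δ ± ε₁ ± ε₂`. -/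
def oddRoot (s : ℤˣ × ℤˣ) : Weight := ![1, ((s.1 : ℤ) : ℂ), ((s.2 : ℤ) : ℂ)]

/-- The set `Φ⁺` of positive roots. -/
def posRoots : Set Weight := Set.range evenRoot ∪ Set.range oddRoot

/-- `ρ = ρ₀ - ρ₁`, half the sum of the positive even roots minus half the sum of the positive odd
roots. -/
noncomputable def rho : Weight :=
  (1 / 2 : ℂ) • ∑ i, evenRoot i - (1 / 2 : ℂ) • ∑ s, oddRoot s

/-- The reflection `s_γ ν = ν - ⟨ν, h_γ⟩ γ` in the even root `γ`. -/
def reflection (i : Fin 3) (nu : Weight) : Weight := nu - pair nu (coroot i) • evenRoot i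

/-- The root space `𝔤_α`. -/
def rootSpace (ζ : ℂ) (α : Weight) : Set Carrier :=
  {x | ∀ t, br ζ (cartan t) x = pair α t • x}

/-- `λ` (as a `ρ`-shifted weight) is typical: `(λ, α) ≠ 0` for every odd root `α`. -/
def Typical (ζ : ℂ) (lam : Weight) : Prop := ∀ s, form ζ lam (oddRoot s) ≠ 0

/-! ### Verma modules -/

/-- The left ideal of `U(𝔤)` generated by `h - (λ-ρ)(h)`, `h ∈ 𝔥`, and by `𝔫₊ = ⨁_{α ∈ Φ⁺} 𝔤_α`. -/
noncomputable def vermaIdeal (ζ : ℂ) (lam : Weight) : Submodule (D21 ζ).U (D21 ζ).U :=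
  Submodule.span (D21 ζ).U
    ({u | ∃ t, u = (D21 ζ).ι (cartan t) - algebraMap ℂ (D21 ζ).U (pair (lam - rho) t)} ∪
      {u | ∃ α ∈ posRoots, ∃ x ∈ rootSpace ζ α, u = (D21 ζ).ι x})

/-- The Verma module `M_λ = U(𝔤) ⊗_{U(𝔥+𝔫₊)} ℂ_{λ-ρ}` of highest weight `λ - ρ`, presented as the
quotient of `U(𝔤)` by the left ideal `vermaIdeal`. -/
abbrev Verma (ζ : ℂ) (lam : Weight) : Type := (D21 ζ).U ⧸ vermaIdeal ζ lam

/-- The highest weight vector `v_λ⁺`, the class of `1`. -/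
noncomputable def vermaVec (ζ : ℂ) (lam : Weight) : Verma ζ lam := (vermaIdeal ζ lam).mkQ 1

/-- The irreducible quotient `L_λ` of `M_λ`, by the sum of all proper submodules. -/
abbrev Irr (ζ : ℂ) (lam : Weight) : Type :=
  Verma ζ lam ⧸ sSup {N : Submodule (D21 ζ).U (Verma ζ lam) | N ≠ ⊤}

/-- `u` lies in the weight space of weight `mu` and is annihilated by `𝔫₊`; a singular vector of
weight `mu` is a nonzero such `u`. -/
def IsSingular (ζ : ℂ) {lam : Weight} (mu : Weight) (u : Verma ζ lam) : Prop :=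
  (∀ t, (D21 ζ).ι (cartan t) • u = pair mu t • u) ∧
    ∀ α ∈ posRoots, ∀ x ∈ rootSpace ζ α, (D21 ζ).ι x • u = 0

/-! ### Chevalley generators and root vectors -/

/-- The tensor product of standard basis vectors of `ℂ²`; index `0` has weight `1` and index `1`
has weight `-1`. -/
def oddVec (a b c : Fin 2) : Carrier :=
  (0, fun i j k => if i = a ∧ j = b ∧ k = c then 1 else 0)

/-- The Chevalley generators `e₀, e₁, e₂`, of weights `δ - ε₁ - ε₂`, `2ε₁`, `2ε₂`. -/
def chevE : Fin 3 → Carrier :=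
  ![oddVec 0 1 1, (Pi.single 1 slE, 0), (Pi.single 2 slE, 0)]

/-- The Chevalley generators `f₀, f₁, f₂`, of weights `-(δ - ε₁ - ε₂)`, `-2ε₁`, `-2ε₂`. -/
def chevF : Fin 3 → Carrier :=
  ![oddVec 1 0 0, (Pi.single 1 slF, 0), (Pi.single 2 slF, 0)]

/-- The simple coroots `½((1+ζ)h_{2δ} + h_{2ε₁} + ζ h_{2ε₂})`, `h_{2ε₁}`, `h_{2ε₂}`. -/
noncomputable def simpleCoroot (ζ : ℂ) : Fin 3 → Fin 3 → ℂ :=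
  ![![(1 + ζ) / 2, 1 / 2, ζ / 2], coroot 1, coroot 2]

/-- The simple roots `δ - ε₁ - ε₂`, `2ε₁`, `2ε₂`. -/
def simpleRoot : Fin 3 → Weight := ![![1, -1, -1], evenRoot 1, evenRoot 2]

/-- The root vector `e_{δ+ε₁-ε₂} = [e₀, e₁]`. -/
noncomputable def ePM (ζ : ℂ) : Carrier := br ζ (chevE 0) (chevE 1)

/-- The root vector `e_{δ-ε₁+ε₂} = [e₂, e₀]`. -/
noncomputable def eMP (ζ : ℂ) : Carrier := br ζ (chevE 2) (chevE 0)

/-- The root vector `e_{δ+ε₁+ε₂} = [[e₀, e₁], e₂]`. -/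
noncomputable def ePP (ζ : ℂ) : Carrier := br ζ (br ζ (chevE 0) (chevE 1)) (chevE 2)

/-- The root vector `f_{2δ} = [[f₀, f₁], [f₀, f₂]]`. -/
noncomputable def fTwoDelta (ζ : ℂ) : Carrier :=
  br ζ (br ζ (chevF 0) (chevF 1)) (br ζ (chevF 0) (chevF 2))

/-- The vector `e_{δ-ε₁-ε₂} e_{δ+ε₁-ε₂} e_{δ+ε₁+ε₂} e_{δ-ε₁+ε₂} f_{2δ}^{n+2} v_λ⁺` of `M_λ`. -/
noncomputable def singVec (ζ : ℂ) (lam : Weight) (n : ℕ) : Verma ζ lam :=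
  ((D21 ζ).ι (chevE 0) * (D21 ζ).ι (ePM ζ) * (D21 ζ).ι (ePP ζ) * (D21 ζ).ι (eMP ζ) *
    (D21 ζ).ι (fTwoDelta ζ) ^ (n + 2)) • vermaVec ζ lam

theorem br_def (ζ : ℂ) (x y : Carrier) : br ζ x y = brFun ζ x y := rfl

theorem pair_apply (lam : Weight) (t : Fin 3 → ℂ) :
    pair lam t = lam 0 * t 0 + lam 1 * t 1 + lam 2 * t 2 := Fin.sum_univ_three _

/-- The simple roots and coroots realize the Cartan matrix of `D(2|1;ζ)`. -/
theorem cartan_matrix (ζ : ℂ) :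
    (Matrix.of fun i j => pair (simpleRoot j) (simpleCoroot ζ i)) =
      !![0, 1, ζ; -1, 2, 0; -1, 0, 2] := by
  ext i j
  revert i j
  refine slot_cases (slot_cases ?_ ?_ ?_) (slot_cases ?_ ?_ ?_) (slot_cases ?_ ?_ ?_) <;>
    simp [pair_apply, simpleRoot, simpleCoroot, coroot, evenRoot] <;> ring

theorem lie_slH_slE : ⁅slH, slE⁆ = (2 : ℂ) • slE := by
  refine sl2_ext ?_ ?_ ?_ <;> simp only [lie_mat] <;> simp [slH, slE] <;> norm_num

theorem lie_slH_slF : ⁅slH, slF⁆ = (-2 : ℂ) • slF := by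
  refine sl2_ext ?_ ?_ ?_ <;> simp only [lie_mat] <;> simp [slH, slF] <;> norm_num

theorem lie_slE_slF : ⁅slE, slF⁆ = slH := by
  refine sl2_ext ?_ ?_ ?_ <;> simp only [lie_mat] <;> simp [slH, slE, slF]

theorem br_even (ζ : ℂ) (A B : Fin 3 → sl2) :
    br ζ (A, 0) (B, 0) = (fun i => ⁅A i, B i⁆, 0) := by
  simp [br_def, brFun, oddBr_zero_left, act_zero_right]

theorem br_even_odd (ζ : ℂ) (A : Fin 3 → sl2) (v : Odd) :
    br ζ (A, 0) (0, v) = (0, act A v) := by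
  refine Prod.ext (funext fun i => ?_) ?_ <;>
    simp [br_def, brFun, oddBr_zero_left, act_zero_right]

theorem br_odd_even (ζ : ℂ) (A : Fin 3 → sl2) (v : Odd) :
    br ζ (0, v) (A, 0) = (0, -act A v) := by
  refine Prod.ext (funext fun i => ?_) ?_ <;>
    simp [br_def, brFun, oddBr_zero_right, act_zero_left]

theorem br_odd (ζ : ℂ) (v w : Odd) : br ζ (0, v) (0, w) = (oddBr ζ v w, 0) := by
  refine Prod.ext (funext fun i => ?_) ?_ <;>
    simp [br_def, brFun, act_zero_left]

/-- The Cartan subalgebra acts on the Chevalley generators through the simple roots. -/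
theorem br_cartan_chevE (ζ : ℂ) (t : Fin 3 → ℂ) (i : Fin 3) :
    br ζ (cartan t) (chevE i) = pair (simpleRoot i) t • chevE i := by
  revert i
  refine slot_cases ?_ ?_ ?_
  · refine (br_even_odd ζ _ _).trans (Prod.ext (by simp [chevE, oddVec]) ?_)
    funext a b c
    revert a b c
    refine bit_cases (bit_cases (bit_cases ?_ ?_) (bit_cases ?_ ?_))
      (bit_cases (bit_cases ?_ ?_) (bit_cases ?_ ?_)) <;>
      simp [act, chevE, oddVec, slH, pair_apply, simpleRoot]
  · refine (br_even ζ _ _).trans (Prod.ext (funext (slot_cases ?_ ?_ ?_)) (by simp [chevE])) <;>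
      simp [chevE, pair_apply, simpleRoot, evenRoot, lie_slH_slE, smul_smul, mul_comm]
  · refine (br_even ζ _ _).trans (Prod.ext (funext (slot_cases ?_ ?_ ?_)) (by simp [chevE])) <;>
      simp [chevE, pair_apply, simpleRoot, evenRoot, lie_slH_slE, smul_smul, mul_comm]

/-- The Cartan subalgebra acts on the Chevalley generators through the simple roots. -/
theorem br_cartan_chevF (ζ : ℂ) (t : Fin 3 → ℂ) (i : Fin 3) :
    br ζ (cartan t) (chevF i) = -pair (simpleRoot i) t • chevF i := by
  revert i
  refine slot_cases ?_ ?_ ?_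
  · refine (br_even_odd ζ _ _).trans (Prod.ext (by simp [chevF, oddVec]) ?_)
    funext a b c
    revert a b c
    refine bit_cases (bit_cases (bit_cases ?_ ?_) (bit_cases ?_ ?_))
      (bit_cases (bit_cases ?_ ?_) (bit_cases ?_ ?_)) <;>
      simp [act, chevF, oddVec, slH, pair_apply, simpleRoot] <;> ring
  · refine (br_even ζ _ _).trans (Prod.ext (funext (slot_cases ?_ ?_ ?_)) (by simp [chevF])) <;>
      simp [chevF, pair_apply, simpleRoot, evenRoot, lie_slH_slF, smul_smul, mul_comm]
  · refine (br_even ζ _ _).trans (Prod.ext (funext (slot_cases ?_ ?_ ?_)) (by simp [chevF])) <;>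
      simp [chevF, pair_apply, simpleRoot, evenRoot, lie_slH_slF, smul_smul, mul_comm]

/-- The Chevalley relations `[eᵢ, fⱼ] = δᵢⱼ αᵢ^∨`. -/
theorem br_chevE_chevF (ζ : ℂ) (i j : Fin 3) :
    br ζ (chevE i) (chevF j) = if i = j then cartan (simpleCoroot ζ i) else 0 := by
  revert i j
  refine slot_cases (slot_cases ?_ ?_ ?_) (slot_cases ?_ ?_ ?_) (slot_cases ?_ ?_ ?_)
  · refine (br_odd ζ _ _).trans (Prod.ext (funext (slot_cases ?_ ?_ ?_)) rfl) <;>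
      refine sl2_ext ?_ ?_ ?_ <;>
      simp [oddBr_0_0_0, oddBr_0_0_1, oddBr_0_1_0, oddBr_1_0_0, oddBr_1_0_1, oddBr_1_1_0,
        oddBr_2_0_0, oddBr_2_0_1, oddBr_2_1_0, cartan, slH, simpleCoroot, sigma]
    ring
  · refine (br_odd_even ζ _ _).trans (Prod.ext rfl ?_)
    funext a b c
    revert b c
    refine bit_cases (bit_cases ?_ ?_) (bit_cases ?_ ?_) <;> simp [act, slF, Fin.sum_univ_two]
  · refine (br_odd_even ζ _ _).trans (Prod.ext rfl ?_)
    funext a b c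
    revert b c
    refine bit_cases (bit_cases ?_ ?_) (bit_cases ?_ ?_) <;> simp [act, slF, Fin.sum_univ_two]
  · refine (br_even_odd ζ _ _).trans (Prod.ext rfl ?_)
    funext a b c
    revert b c
    refine bit_cases (bit_cases ?_ ?_) (bit_cases ?_ ?_) <;> simp [act, slE, Fin.sum_univ_two]
  · refine (br_even ζ _ _).trans (Prod.ext (funext (slot_cases ?_ ?_ ?_)) rfl) <;>
      simp [lie_slE_slF, cartan, simpleCoroot, coroot]
  · refine (br_even ζ _ _).trans (Prod.ext (funext (slot_cases ?_ ?_ ?_)) rfl) <;> simp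
  · refine (br_even_odd ζ _ _).trans (Prod.ext rfl ?_)
    funext a b c
    revert b c
    refine bit_cases (bit_cases ?_ ?_) (bit_cases ?_ ?_) <;> simp [act, slE, Fin.sum_univ_two]
  · refine (br_even ζ _ _).trans (Prod.ext (funext (slot_cases ?_ ?_ ?_)) rfl) <;> simp
  · refine (br_even ζ _ _).trans (Prod.ext (funext (slot_cases ?_ ?_ ?_)) rfl) <;>
      simp [lie_slE_slF, cartan, simpleCoroot, coroot]

/-- `ρ = -δ + ε₁ + ε₂`. -/
theorem rho_eq : rho = ![-1, 1, 1] := by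
  have h : (Finset.univ : Finset ℤˣ) = {1, -1} := rfl
  funext i
  revert i
  refine slot_cases ?_ ?_ ?_ <;>
    simp [rho, evenRoot, oddRoot, Fintype.sum_prod_type, h, Fin.sum_univ_three] <;> norm_num

end D21

/-! The scalars `sigma ζ i` have sum zero and are all nonzero exactly because ζ ≠ 0, -1. Write q_k,
k ∈ {0,1}³, for the odd basis vectors; the four with k 0 = 0 are the positive ones.

Singularity is a local computation. Let μ = λ - ρ, so μ 0 = n + 1 when γ = 2δ. By the sl₂ formula
`Gens.e_smul_f_pow`, m = f₀^(n+2) v is killed by e₀, and also by e₁ and e₂. The four positive q_k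
supercommute up to multiples of e₀, which commutes with all of them, so they act on m like
generators of an exterior algebra. Their full product `Gens.raise` therefore yields a vector killed
by q₀₁₁, e₁ and e₂, and these generate 𝔫₊ (`Gens.HighestWeight.of_simple`). For γ = 2ε₁ or 2ε₂ the
vector f_i^n v works as for sl₂ (`Gens.HighestWeight.f_pow`).

The real issue is that these vectors do not vanish in the Verma module. No PBW basis is used.
Instead, any module with a highest weight vector w of weight λ - ρ receives a map from M_λ, so it is
enough that X w ≠ 0 there (`Gens.HighestWeight.smul_vermaVec_ne_zero`). Such modules are built
explicitly. On ℂ[x,y] ⊗ Λ[ξ₀,ξ₁] there is a one-parameter family of representations in which f₀, f₁,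
q₁₁₀, q₁₁₁ act as multiplication by x, y, ξ₀, ξ₁: these are the modules induced from characters of a
parabolic subalgebra with abelian nilradical. Three versions, differing by a permutation of the sl₂
copies, are tensored together with the adjoint representation. The three parameters reach every
highest weight (`exists_testVec_highestWeight`), and reading off single coefficients of polynomials,
one tensor factor at a time, reduces the vector to a nonzero element of the adjoint representation
(`testRep_raise_ne_zero`).

For n = 0 and γ = 2δ the vector is a multiple of v itself, and the multiple is a product of values
of the form on odd roots (`Gens.HighestWeight.raise_f_f`); this is where typicality enters. The
statement on multiplicities follows from any nonzero homomorphism M' → M: its image has the head of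
M' as a quotient (`compMult_pos_of_hom`). -/

namespace D21

/-! ### Generators and relations -/

/-- The sign `±1` of a basis index of `ℂ²`. -/
def sgn : Fin 2 → ℂ := ![1, -1]

/-- The symmetric `2 × 2` table of the values `p(e_a, e_b)` in terms of an `sl₂`-triple. -/
def pTable {A : Type} [AddCommGroup A] [Module ℂ A] (e f h : A) : Fin 2 → Fin 2 → A :=
  ![![(2 : ℂ) • e, -h], ![-h, -(2 : ℂ) • f]]

/-- Elements of an associative algebra that satisfy the bracket relations of the standard basis of
the Lie superalgebra `(sl₂)³ ⊕ (ℂ²)^{⊗3}` with structure constants `σ`. -/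
structure Gens (σ : Fin 3 → ℂ) (A : Type) [Ring A] [Algebra ℂ A] where
  e : Fin 3 → A
  f : Fin 3 → A
  h : Fin 3 → A
  q : (Fin 3 → Fin 2) → A
  h_h : ∀ i j, h i * h j - h j * h i = 0
  e_e : ∀ i j, e i * e j - e j * e i = 0
  f_f : ∀ i j, f i * f j - f j * f i = 0
  h_e : ∀ i j, h i * e j - e j * h i = if i = j then (2 : ℂ) • e j else 0
  h_f : ∀ i j, h i * f j - f j * h i = if i = j then (-2 : ℂ) • f j else 0
  e_f : ∀ i j, e i * f j - f j * e i = if i = j then h j else 0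
  h_q : ∀ i k, h i * q k - q k * h i = sgn (k i) • q k
  e_q : ∀ i k, e i * q k - q k * e i = if k i = 1 then q (Function.update k i 0) else 0
  f_q : ∀ i k, f i * q k - q k * f i = if k i = 0 then q (Function.update k i 1) else 0
  q_q : ∀ k l, q k * q l + q l * q k =
    ∑ i, (σ i * ∏ j ∈ Finset.univ.erase i, psi (k j) (l j)) • pTable (e i) (f i) (h i) (k i) (l i)

/-! ### Brackets of basis vectors, computed on pure tensors -/

/-- The pure tensor `x₀ ⊗ x₁ ⊗ x₂`. -/
def pureOdd (x : Fin 3 → Fin 2 → ℂ) : Odd := fun a b c => x 0 a * x 1 b * x 2 c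

/-- The bilinear form with matrix `psi`. -/
def psiForm (x y : Fin 2 → ℂ) : ℂ := x 0 * y 1 - x 1 * y 0

theorem prod_erase_zero (g : Fin 3 → ℂ) : ∏ j ∈ Finset.univ.erase 0, g j = g 1 * g 2 := by
  rw [show (Finset.univ.erase 0 : Finset (Fin 3)) = {1, 2} from rfl]; simp

theorem prod_erase_one (g : Fin 3 → ℂ) : ∏ j ∈ Finset.univ.erase 1, g j = g 0 * g 2 := by
  rw [show (Finset.univ.erase 1 : Finset (Fin 3)) = {0, 2} from rfl]; simp

theorem prod_erase_two (g : Fin 3 → ℂ) : ∏ j ∈ Finset.univ.erase 2, g j = g 0 * g 1 := by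
  rw [show (Finset.univ.erase 2 : Finset (Fin 3)) = {0, 1} from rfl]; simp

/-- On pure tensors the three slots play the same role, so one formula, uniform in `i`, replaces the
three separate coordinate formulas. This uniformity later allows the copies of sl₂ to be permuted.
-/
theorem oddBr_pureOdd (ζ : ℂ) (x y : Fin 3 → Fin 2 → ℂ) (i : Fin 3) :
    oddBr ζ (pureOdd x) (pureOdd y) i =
      (sigma ζ i * ∏ j ∈ Finset.univ.erase i, psiForm (x j) (y j)) • p (x i) (y i) := by
  revert i
  refine slot_cases ?_ ?_ ?_ <;> refine sl2_ext ?_ ?_ ?_ <;>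
    simp only [oddBr_0_0_0, oddBr_0_0_1, oddBr_0_1_0, oddBr_1_0_0, oddBr_1_0_1, oddBr_1_1_0,
      oddBr_2_0_0, oddBr_2_0_1, oddBr_2_1_0, prod_erase_zero, prod_erase_one, prod_erase_two,
      sl2_smul, Matrix.smul_apply, smul_eq_mul, coe_p, pMat, psi, pureOdd, psiForm,
      Matrix.of_apply, Fin.sum_univ_two, Matrix.cons_val', Matrix.cons_val_zero,
      Matrix.cons_val_one, Matrix.cons_val_fin_one] <;>
    ring

theorem oddVec_eq_pureOdd (k : Fin 3 → Fin 2) :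
    oddVec (k 0) (k 1) (k 2) = (0, pureOdd fun i => Pi.single (k i) 1) := by
  refine Prod.ext rfl ?_
  funext a b c
  simp only [oddVec, pureOdd, Pi.single_apply]
  split_ifs <;> simp_all

theorem psiForm_single (a b : Fin 2) : psiForm (Pi.single a 1) (Pi.single b 1) = psi a b := by
  revert a b
  refine bit_cases (bit_cases ?_ ?_) (bit_cases ?_ ?_) <;> simp [psiForm, psi]

theorem p_single (a b : Fin 2) : p (Pi.single a 1) (Pi.single b 1) = pTable slE slF slH a b := by
  revert a b
  refine bit_cases (bit_cases ?_ ?_) (bit_cases ?_ ?_) <;> refine sl2_ext ?_ ?_ ?_ <;>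
    simp [coe_p, pMat, psi, pTable, slE, slF, slH] <;> norm_num

theorem act_single_pureOdd (i : Fin 3) (X : sl2) (x : Fin 3 → Fin 2 → ℂ) :
    act (Pi.single i X) (pureOdd x) =
      pureOdd (Function.update x i fun a => ∑ b, X.1 a b * x i b) := by
  funext a b c
  revert i
  refine slot_cases ?_ ?_ ?_ <;>
    simp [act, pureOdd, Fin.sum_univ_two, Function.update] <;> ring

theorem pureOdd_update_smul (x : Fin 3 → Fin 2 → ℂ) (i : Fin 3) (c : ℂ) (y : Fin 2 → ℂ) :
    pureOdd (Function.update x i (c • y)) = c • pureOdd (Function.update x i y) := by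
  funext a b c
  revert i
  refine slot_cases ?_ ?_ ?_ <;>
    simp [pureOdd, Function.update] <;> ring

theorem pureOdd_update_zero (x : Fin 3 → Fin 2 → ℂ) (i : Fin 3) :
    pureOdd (Function.update x i 0) = 0 := by
  simpa using pureOdd_update_smul x i 0 0

theorem update_single (k : Fin 3 → Fin 2) (i : Fin 3) (c : Fin 2) :
    Function.update (fun j => (Pi.single (k j) 1 : Fin 2 → ℂ)) i (Pi.single c 1) =
      fun j => Pi.single (Function.update k i c j) 1 := by
  funext j
  by_cases h : j = i
  · subst h; simp
  · simp [h]

theorem pi_lie_single (i j : Fin 3) (X Y : sl2) :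
    (fun l => ⁅(Pi.single i X : Fin 3 → sl2) l, (Pi.single j Y : Fin 3 → sl2) l⁆) =
      if i = j then Pi.single j ⁅X, Y⁆ else 0 := by
  funext l
  split_ifs with h
  · subst h
    by_cases hl : l = i
    · subst hl; simp
    · simp [hl]
  · by_cases hl : l = i
    · subst hl; simp [h]
    · simp [hl]

/-- The odd basis vector with index `k`. -/
def oddBasis (k : Fin 3 → Fin 2) : Carrier := oddVec (k 0) (k 1) (k 2)

/-- The vector `X` in the `i`-th copy of `sl₂`. -/
def evenVec (i : Fin 3) (X : sl2) : Carrier := (Pi.single i X, 0)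

theorem evenVec_smul (i : Fin 3) (c : ℂ) (X : sl2) : evenVec i (c • X) = c • evenVec i X := by
  simp [evenVec, Pi.single_smul]

theorem evenVec_zero (i : Fin 3) : evenVec i 0 = 0 := by simp [evenVec]

theorem evenVec_neg (i : Fin 3) (X : sl2) : evenVec i (-X) = -evenVec i X := by
  simp [evenVec, Pi.single_neg]

theorem br_evenVec (ζ : ℂ) (i j : Fin 3) (X Y : sl2) :
    br ζ (evenVec i X) (evenVec j Y) = if i = j then evenVec j ⁅X, Y⁆ else 0 := by
  rw [evenVec, evenVec, br_even, pi_lie_single]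
  split_ifs <;> rfl

theorem br_evenVec_oddBasis (ζ : ℂ) (i : Fin 3) (X : sl2) (k : Fin 3 → Fin 2) :
    br ζ (evenVec i X) (oddBasis k) =
      (0, pureOdd (Function.update (fun j => Pi.single (k j) 1) i fun a => X.1 a (k i))) := by
  rw [evenVec, oddBasis, oddVec_eq_pureOdd, br_even_odd, act_single_pureOdd]
  simp [Pi.single_apply]

theorem br_slH_oddBasis (ζ : ℂ) (i : Fin 3) (k : Fin 3 → Fin 2) :
    br ζ (evenVec i slH) (oddBasis k) = sgn (k i) • oddBasis k := by
  have h : (fun a => slH.1 a (k i)) = sgn (k i) • (Pi.single (k i) 1 : Fin 2 → ℂ) := by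
    generalize k i = a
    funext b
    revert a b
    refine bit_cases (bit_cases ?_ ?_) (bit_cases ?_ ?_) <;> simp [slH, sgn]
  rw [br_evenVec_oddBasis, h, pureOdd_update_smul, update_single, Function.update_eq_self,
    oddBasis, oddVec_eq_pureOdd]
  ext <;> simp

theorem br_slE_oddBasis (ζ : ℂ) (i : Fin 3) (k : Fin 3 → Fin 2) :
    br ζ (evenVec i slE) (oddBasis k) =
      if k i = 1 then oddBasis (Function.update k i 0) else 0 := by
  have h : (fun a => slE.1 a (k i)) =
      if k i = 1 then (Pi.single 0 1 : Fin 2 → ℂ) else 0 := by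
    generalize k i = a
    funext b
    revert a b
    refine bit_cases (bit_cases ?_ ?_) (bit_cases ?_ ?_) <;> simp [slE]
  rw [br_evenVec_oddBasis, h]
  split_ifs
  · rw [update_single, oddBasis, oddVec_eq_pureOdd]
  · rw [pureOdd_update_zero]; rfl

theorem br_slF_oddBasis (ζ : ℂ) (i : Fin 3) (k : Fin 3 → Fin 2) :
    br ζ (evenVec i slF) (oddBasis k) =
      if k i = 0 then oddBasis (Function.update k i 1) else 0 := by
  have h : (fun a => slF.1 a (k i)) =
      if k i = 0 then (Pi.single 1 1 : Fin 2 → ℂ) else 0 := by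
    generalize k i = a
    funext b
    revert a b
    refine bit_cases (bit_cases ?_ ?_) (bit_cases ?_ ?_) <;> simp [slF]
  rw [br_evenVec_oddBasis, h]
  split_ifs
  · rw [update_single, oddBasis, oddVec_eq_pureOdd]
  · rw [pureOdd_update_zero]; rfl

theorem evenPart_eq_sum (A : Fin 3 → sl2) : ((A, 0) : Carrier) = ∑ i, evenVec i (A i) := by
  refine Prod.ext (funext fun i => ?_) ?_
  · rw [Prod.fst_sum, Finset.sum_apply]
    simp only [evenVec, Pi.single_apply]
    simp
  · rw [Prod.snd_sum]
    simp [evenVec]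

theorem evenVec_pTable (i : Fin 3) (a b : Fin 2) :
    evenVec i (pTable slE slF slH a b) =
      pTable (evenVec i slE) (evenVec i slF) (evenVec i slH) a b := by
  revert a b
  refine bit_cases (bit_cases ?_ ?_) (bit_cases ?_ ?_) <;>
    simp [pTable, evenVec_smul, evenVec_neg]

theorem br_oddBasis (ζ : ℂ) (k l : Fin 3 → Fin 2) :
    br ζ (oddBasis k) (oddBasis l) =
      ∑ i, (sigma ζ i * ∏ j ∈ Finset.univ.erase i, psi (k j) (l j)) •
        pTable (evenVec i slE) (evenVec i slF) (evenVec i slH) (k i) (l i) := by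
  rw [oddBasis, oddBasis, oddVec_eq_pureOdd, oddVec_eq_pureOdd, br_odd, evenPart_eq_sum]
  refine Finset.sum_congr rfl fun i _ => ?_
  rw [oddBr_pureOdd, evenVec_smul, p_single, evenVec_pTable]
  simp only [psiForm_single]

/-! ### Generators obtained from bracket-preserving linear maps -/

theorem map_pTable {A B : Type} [AddCommGroup A] [Module ℂ A] [AddCommGroup B] [Module ℂ B]
    (r : A →ₗ[ℂ] B) (e f h : A) (a b : Fin 2) :
    r (pTable e f h a b) = pTable (r e) (r f) (r h) a b := by
  revert a b
  refine bit_cases (bit_cases ?_ ?_) (bit_cases ?_ ?_) <;> simp [pTable]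

/-- A linear map that sends superbrackets to supercommutators yields elements satisfying the
relations. -/
noncomputable def Gens.ofLinear {ζ : ℂ} {A : Type} [Ring A] [Algebra ℂ A] (r : Carrier →ₗ[ℂ] A)
    (hr : ∀ {a b : ZMod 2} {x y : Carrier}, x ∈ gradePart a → y ∈ gradePart b →
      r x * r y = koszulSign a b • (r y * r x) + r (br ζ x y)) : Gens (sigma ζ) A where
  e i := r (evenVec i slE)
  f i := r (evenVec i slF)
  h i := r (evenVec i slH)
  q k := r (oddBasis k)
  h_h i j := by
    rw [hr (mem_gradePart_zero.2 rfl) (mem_gradePart_zero.2 rfl), br_evenVec]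
    simp [koszulSign, evenVec_zero]
  e_e i j := by
    rw [hr (mem_gradePart_zero.2 rfl) (mem_gradePart_zero.2 rfl), br_evenVec]
    simp [koszulSign, evenVec_zero]
  f_f i j := by
    rw [hr (mem_gradePart_zero.2 rfl) (mem_gradePart_zero.2 rfl), br_evenVec]
    simp [koszulSign, evenVec_zero]
  h_e i j := by
    rw [hr (mem_gradePart_zero.2 rfl) (mem_gradePart_zero.2 rfl), br_evenVec, lie_slH_slE, evenVec_smul]
    split_ifs <;> simp [koszulSign]
  h_f i j := by
    rw [hr (mem_gradePart_zero.2 rfl) (mem_gradePart_zero.2 rfl), br_evenVec, lie_slH_slF, evenVec_smul]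
    split_ifs <;> simp [koszulSign]
  e_f i j := by
    rw [hr (mem_gradePart_zero.2 rfl) (mem_gradePart_zero.2 rfl), br_evenVec, lie_slE_slF]
    split_ifs <;> simp [koszulSign]
  h_q i k := by
    rw [hr (mem_gradePart_zero.2 rfl) (mem_gradePart_one.2 rfl), br_slH_oddBasis]
    simp [koszulSign]
  e_q i k := by
    rw [hr (mem_gradePart_zero.2 rfl) (mem_gradePart_one.2 rfl), br_slE_oddBasis]
    split_ifs <;> simp [koszulSign]
  f_q i k := by
    rw [hr (mem_gradePart_zero.2 rfl) (mem_gradePart_one.2 rfl), br_slF_oddBasis]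
    split_ifs <;> simp [koszulSign]
  q_q k l := by
    rw [hr (mem_gradePart_one.2 rfl) (mem_gradePart_one.2 rfl), br_oddBasis]
    simp [koszulSign, map_sum, map_pTable]

theorem ι_mul_ι (ζ : ℂ) {a b : ZMod 2} {x y : Carrier} (hx : x ∈ gradePart a)
    (hy : y ∈ gradePart b) :
    (D21 ζ).ι x * (D21 ζ).ι y =
      koszulSign a b • ((D21 ζ).ι y * (D21 ζ).ι x) + (D21 ζ).ι (br ζ x y) := by
  have h := RingQuot.mkAlgHom_rel ℂ (LieSuperalgebra.Rel.mk (S := D21 ζ) hx hy)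
  simpa [LieSuperalgebra.ι] using h

/-- The standard generators of the enveloping algebra. -/
noncomputable def uGens (ζ : ℂ) : Gens (sigma ζ) (D21 ζ).U :=
  Gens.ofLinear (D21 ζ).ι (ι_mul_ι ζ)

/-- The standard generators in the adjoint representation. -/
noncomputable def adGens (ζ : ℂ) : Gens (sigma ζ) (Module.End ℂ Carrier) :=
  -- The super Jacobi identity says precisely that ad turns superbrackets into supercommutators.
  Gens.ofLinear (D21 ζ).br fun hx hy =>
    LinearMap.ext fun z => ((D21 ζ).jacobi z hx hy).trans (add_comm _ _)

theorem br_even_left (ζ : ℂ) (X A : Fin 3 → sl2) (v : Odd) :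
    br ζ (X, 0) (A, v) = (fun i => ⁅X i, A i⁆, act X v) := by
  refine Prod.ext (funext fun i => ?_) ?_ <;>
    simp [br_def, brFun, oddBr_zero_left, act_zero_right]

/-! ### From generators to representations of the enveloping algebra -/

namespace Gens

variable {σ : Fin 3 → ℂ} {A : Type} [Ring A] [Algebra ℂ A] (G : Gens σ A)

/-- The image of the `i`-th copy of `sl₂`. -/
def even (i : Fin 3) (X : sl2) : A := X.1 0 0 • G.h i + X.1 0 1 • G.e i + X.1 1 0 • G.f i

/-- The image of the odd part. -/
def odd (v : Odd) : A := ∑ k : Fin 3 → Fin 2, v (k 0) (k 1) (k 2) • G.q k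

theorem even_comm {i j : Fin 3} (hij : i ≠ j) (X Y : sl2) :
    G.even i X * G.even j Y - G.even j Y * G.even i X = 0 := by
  have hh := G.h_h i j
  have ee := G.e_e i j
  have ff := G.f_f i j
  have he := G.h_e i j
  have he' := G.h_e j i
  have hf := G.h_f i j
  have hf' := G.h_f j i
  have ef := G.e_f i j
  have ef' := G.e_f j i
  simp only [hij, hij.symm, if_false, sub_eq_zero] at hh ee ff he he' hf hf' ef ef'
  simp only [even, add_mul, mul_add, smul_mul_smul, hh, ee, ff, he, ← he', hf, ← hf', ef, ← ef']
  module

theorem even_lie (i : Fin 3) (X Y : sl2) :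
    G.even i X * G.even i Y - G.even i Y * G.even i X = G.even i ⁅X, Y⁆ := by
  have he := G.h_e i i
  have hf := G.h_f i i
  have ef := G.e_f i i
  simp only [if_true, sub_eq_iff_eq_add] at he hf ef
  simp only [even, add_mul, mul_add, smul_mul_smul, he, hf, ef, lie_mat, Matrix.sub_apply,
    Matrix.mul_apply, Fin.sum_univ_two, sl2_one_one]
  module

theorem update_index (a b c x : Fin 2) :
    Function.update ![a, b, c] 0 x = ![x, b, c] ∧ Function.update ![a, b, c] 1 x = ![a, x, c] ∧
      Function.update ![a, b, c] 2 x = ![a, b, x] := by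
  refine ⟨?_, ?_, ?_⟩ <;> funext i <;> revert i <;> exact slot_cases rfl rfl rfl

theorem sum_index {M : Type} [AddCommMonoid M] (g : (Fin 3 → Fin 2) → M) :
    ∑ k, g k = ∑ a, ∑ b, ∑ c, g ![a, b, c] := by
  rw [← (Fin.consEquiv fun _ => Fin 2).sum_comp, Fintype.sum_prod_type]
  refine Finset.sum_congr rfl fun a _ => ?_
  rw [← (Fin.consEquiv fun _ => Fin 2).sum_comp, Fintype.sum_prod_type]
  refine Finset.sum_congr rfl fun b _ => ?_
  rw [← (Fin.consEquiv fun _ => Fin 2).sum_comp, Fintype.sum_prod_type]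
  refine Finset.sum_congr rfl fun c _ => ?_
  simp only [Fintype.sum_unique]
  rfl

theorem even_odd (i : Fin 3) (X : sl2) (v : Odd) :
    G.even i X * G.odd v - G.odd v * G.even i X = G.odd (act (Pi.single i X) v) := by
  have key : ∀ k, G.even i X * G.q k - G.q k * G.even i X =
      (X.1 0 0 * sgn (k i)) • G.q k +
        X.1 0 1 • (if k i = 1 then G.q (Function.update k i 0) else 0) +
        X.1 1 0 • (if k i = 0 then G.q (Function.update k i 1) else 0) := by
    intro k
    rw [← G.e_q, ← G.f_q, mul_smul, ← G.h_q]
    simp only [even, add_mul, mul_add, smul_mul_assoc, mul_smul_comm, smul_sub]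
    abel
  simp only [odd, Finset.mul_sum, Finset.sum_mul, ← Finset.sum_sub_distrib, mul_smul_comm,
    smul_mul_assoc, ← smul_sub, key]
  rw [sum_index, sum_index]
  clear key
  revert i
  refine slot_cases ?_ ?_ ?_ <;>
    simp only [Fin.sum_univ_two, act, (update_index _ _ _ _).1, (update_index _ _ _ _).2.1,
      (update_index _ _ _ _).2.2, sgn, sl2_one_one, Matrix.cons_val_zero, Matrix.cons_val_one,
      Matrix.cons_val_two, if_true, Pi.single_apply] <;>
    simp [sl2_one_one] <;>
    module

theorem odd_odd (v w : Odd) : G.odd v * G.odd w + G.odd w * G.odd v =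
    ∑ i, ∑ k : Fin 3 → Fin 2, ∑ l : Fin 3 → Fin 2,
      (v (k 0) (k 1) (k 2) * w (l 0) (l 1) (l 2) * (σ i *
        ∏ j ∈ Finset.univ.erase i, psi (k j) (l j))) • pTable (G.e i) (G.f i) (G.h i) (k i) (l i)
    := by
  have h1 : G.odd w * G.odd v = ∑ k : Fin 3 → Fin 2, ∑ l : Fin 3 → Fin 2,
      (v (k 0) (k 1) (k 2) * w (l 0) (l 1) (l 2)) • (G.q l * G.q k) := by
    rw [odd, odd, Finset.sum_mul_sum, Finset.sum_comm]
    simp only [smul_mul_smul, mul_comm]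
  rw [h1, odd, odd, Finset.sum_mul_sum]
  simp only [smul_mul_smul, ← Finset.sum_add_distrib, ← smul_add, G.q_q, Finset.smul_sum, smul_smul]
  symm
  rw [Finset.sum_comm]
  exact Finset.sum_congr rfl fun k _ => Finset.sum_comm

end Gens

-- The bilinear extension of the relation `q_q`: collecting the coefficients of e, f and h in slot
-- `i` gives the three matrix entries of `oddBr`.
set_option maxHeartbeats 1000000 in
theorem odd_odd_slot {A : Type} [Ring A] [Algebra ℂ A] {ζ : ℂ} (G : Gens (sigma ζ) A) (v w : Odd)
    (i : Fin 3) : ∑ k : Fin 3 → Fin 2, ∑ l : Fin 3 → Fin 2,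
      (v (k 0) (k 1) (k 2) * w (l 0) (l 1) (l 2) * (sigma ζ i *
        ∏ j ∈ Finset.univ.erase i, psi (k j) (l j))) • pTable (G.e i) (G.f i) (G.h i) (k i) (l i) =
      G.even i (oddBr ζ v w i) := by
  simp only [Gens.sum_index]
  revert i
  refine slot_cases ?_ ?_ ?_ <;>
    simp [Fin.sum_univ_two, prod_erase_zero, prod_erase_one, prod_erase_two, psi, pTable,
      Gens.even, oddBr_0_0_0, oddBr_0_0_1, oddBr_0_1_0, oddBr_1_0_0, oddBr_1_0_1, oddBr_1_1_0,
      oddBr_2_0_0, oddBr_2_0_1, oddBr_2_1_0] <;>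
    module

namespace Gens

variable {ζ : ℂ} {A : Type} [Ring A] [Algebra ℂ A] (G : Gens (sigma ζ) A)

/-- The linear map on the Lie superalgebra that is given by `G` on the standard basis. -/
noncomputable def toLinear : Carrier →ₗ[ℂ] A where
  toFun x := ∑ i, G.even i (x.1 i) + G.odd x.2
  map_add' x y := by
    simp only [even, odd, Prod.fst_add, Prod.snd_add, Pi.add_apply, sl2_add, Matrix.add_apply,
      add_smul, Finset.sum_add_distrib]
    abel
  map_smul' c x := by
    simp only [even, odd, Prod.smul_fst, Prod.smul_snd, Pi.smul_apply, sl2_smul, Matrix.smul_apply,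
      smul_assoc, smul_add, Finset.smul_sum, RingHom.id_apply]

theorem odd_zero : G.odd 0 = 0 := by simp [odd]

theorem even_zero (i : Fin 3) : G.even i 0 = 0 := by simp [even]

theorem toLinear_apply (x : Carrier) : G.toLinear x = ∑ i, G.even i (x.1 i) + G.odd x.2 := rfl

theorem toLinear_even (X : Fin 3 → sl2) : G.toLinear (X, 0) = ∑ i, G.even i (X i) := by
  simp [toLinear_apply, odd_zero]

theorem toLinear_odd (v : Odd) : G.toLinear (0, v) = G.odd v := by
  simp [toLinear_apply, even_zero]

theorem toLinear_evenVec (i : Fin 3) (X : sl2) : G.toLinear (evenVec i X) = G.even i X := by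
  rw [evenVec, toLinear_even, Finset.sum_eq_single i]
  · simp
  · intro j _ hj
    simp [hj, even_zero]
  · simp

theorem toLinear_slE (i : Fin 3) : G.toLinear (evenVec i slE) = G.e i := by
  simp [toLinear_evenVec, even, slE]

theorem toLinear_slF (i : Fin 3) : G.toLinear (evenVec i slF) = G.f i := by
  simp [toLinear_evenVec, even, slF]

theorem toLinear_slH (i : Fin 3) : G.toLinear (evenVec i slH) = G.h i := by
  simp [toLinear_evenVec, even, slH]

theorem toLinear_oddBasis (k : Fin 3 → Fin 2) : G.toLinear (oddBasis k) = G.q k := by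
  rw [oddBasis, oddVec, toLinear_odd, odd, Finset.sum_eq_single k]
  · simp
  · intro l _ hl
    rw [if_neg, zero_smul]
    rintro ⟨h0, h1, h2⟩
    exact hl (funext (slot_cases h0 h1 h2))
  · simp

theorem toLinear_even_even (X Y : Fin 3 → sl2) :
    G.toLinear (X, 0) * G.toLinear (Y, 0) - G.toLinear (Y, 0) * G.toLinear (X, 0) =
      G.toLinear (fun i => ⁅X i, Y i⁆, 0) := by
  rw [toLinear_even, toLinear_even, toLinear_even, Finset.sum_mul_sum, Finset.sum_mul_sum]
  rw [Finset.sum_comm (f := fun i j => G.even i (Y i) * G.even j (X j))]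
  simp only [← Finset.sum_sub_distrib]
  refine Finset.sum_congr rfl fun i _ => ?_
  rw [Finset.sum_eq_single i, even_lie]
  · intro j _ hj
    exact G.even_comm hj.symm _ _
  · simp

theorem toLinear_even_odd (X : Fin 3 → sl2) (v : Odd) :
    G.toLinear (X, 0) * G.toLinear (0, v) - G.toLinear (0, v) * G.toLinear (X, 0) =
      G.toLinear (0, act X v) := by
  have h : ((0, act X v) : Carrier) = ∑ i, (0, act (Pi.single i (X i)) v) := by
    have h1 : ∀ i, ((0, act (Pi.single i (X i)) v) : Carrier) = br ζ (evenVec i (X i)) (0, v) :=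
      fun i => (br_even_odd ζ _ v).symm
    simp only [h1, br]
    rw [← br_even_odd ζ X v, evenPart_eq_sum, br, map_sum, LinearMap.sum_apply]
  rw [h, map_sum]
  simp only [toLinear_odd, ← even_odd]
  rw [toLinear_even, Finset.sum_mul, Finset.mul_sum, ← Finset.sum_sub_distrib]

theorem toLinear_odd_odd (v w : Odd) :
    G.toLinear (0, v) * G.toLinear (0, w) + G.toLinear (0, w) * G.toLinear (0, v) =
      G.toLinear (oddBr ζ v w, 0) := by
  rw [toLinear_odd, toLinear_odd, odd_odd, toLinear_even]
  exact Finset.sum_congr rfl fun i _ => odd_odd_slot G v w i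

/-- By bilinearity the relations on basis elements give those on all homogeneous elements; this is
the condition under which `lift` descends to the enveloping algebra. -/
theorem toLinear_rel {a b : ZMod 2} {x y : Carrier} (hx : x ∈ gradePart a)
    (hy : y ∈ gradePart b) : G.toLinear x * G.toLinear y =
      koszulSign a b • (G.toLinear y * G.toLinear x) + G.toLinear (br ζ x y) := by
  obtain ⟨X, v⟩ := x
  obtain ⟨Y, w⟩ := y
  rcases parity_cases a with rfl | rfl <;> rcases parity_cases b with rfl | rfl <;>
    simp only [mem_gradePart_zero, mem_gradePart_one] at hx hy <;> subst hx hy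
  · rw [br_even, ← toLinear_even_even]
    simp [koszulSign]
  · rw [br_even_odd, ← toLinear_even_odd]
    simp [koszulSign]
  · rw [br_odd_even, show ((0, -act Y v) : Carrier) = -(0, act Y v) by simp, map_neg,
      ← toLinear_even_odd]
    simp [koszulSign]
  · rw [br_odd, ← toLinear_odd_odd]
    simp [koszulSign]

/-- The representation of the enveloping algebra that is given by `G`. -/
noncomputable def lift : (D21 ζ).U →ₐ[ℂ] A :=
  RingQuot.liftAlgHom ℂ ⟨TensorAlgebra.lift ℂ G.toLinear, fun x y h => by
    obtain ⟨hx, hy⟩ := h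
    simpa using G.toLinear_rel hx hy⟩

theorem lift_ι (x : Carrier) : G.lift ((D21 ζ).ι x) = G.toLinear x := by
  simp [lift, LieSuperalgebra.ι]

theorem lift_f (i : Fin 3) : G.lift ((uGens ζ).f i) = G.f i :=
  (G.lift_ι _).trans (G.toLinear_slF i)

theorem lift_q (k : Fin 3 → Fin 2) : G.lift ((uGens ζ).q k) = G.q k :=
  (G.lift_ι _).trans (G.toLinear_oddBasis k)

end Gens

/-! ### Representations with parity: permutations and tensor products -/

/-- A representation of the standard generators on a vector space with a parity operator. -/
structure Rep (σ : Fin 3 → ℂ) (V : Type) [AddCommGroup V] [Module ℂ V] extends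
    Gens σ (Module.End ℂ V) where
  par : Module.End ℂ V
  par_par : par * par = 1
  par_e : ∀ i, par * e i = e i * par
  par_f : ∀ i, par * f i = f i * par
  par_h : ∀ i, par * h i = h i * par
  par_q : ∀ k, par * q k = -(q k * par)

namespace Rep

variable {σ : Fin 3 → ℂ} {V W : Type} [AddCommGroup V] [Module ℂ V] [AddCommGroup W] [Module ℂ W]

/-- Permuting the three copies of `sl₂`. -/
def perm (π : Equiv.Perm (Fin 3)) (R : Rep (σ ∘ π) V) : Rep σ V where
  e i := R.e (π.symm i)
  f i := R.f (π.symm i)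
  h i := R.h (π.symm i)
  q k := R.q (k ∘ π)
  par := R.par
  h_h i j := R.h_h _ _
  e_e i j := R.e_e _ _
  f_f i j := R.f_f _ _
  h_e i j := by simpa using R.h_e (π.symm i) (π.symm j)
  h_f i j := by simpa using R.h_f (π.symm i) (π.symm j)
  e_f i j := by simpa using R.e_f (π.symm i) (π.symm j)
  h_q i k := by simpa using R.h_q (π.symm i) (k ∘ π)
  e_q i k := by
    have h := R.e_q (π.symm i) (k ∘ π)
    rwa [Function.comp_apply, Equiv.apply_symm_apply, ← Function.update_comp_equiv] at h
  f_q i k := by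
    have h := R.f_q (π.symm i) (k ∘ π)
    rwa [Function.comp_apply, Equiv.apply_symm_apply, ← Function.update_comp_equiv] at h
  q_q k l := by
    rw [R.q_q, ← π.symm.sum_comp]
    refine Finset.sum_congr rfl fun i _ => ?_
    have h : ∏ j ∈ Finset.univ.erase (π.symm i), psi ((k ∘ π) j) ((l ∘ π) j) =
        ∏ j ∈ Finset.univ.erase i, psi (k j) (l j) := by
      refine Finset.prod_equiv π ?_ ?_ <;> simp [Equiv.eq_symm_apply]
    rw [h]
    simp
  par_par := R.par_par
  par_e i := R.par_e _
  par_f i := R.par_f _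
  par_h i := R.par_h _
  par_q k := R.par_q _

open TensorProduct

/-- Operators on different tensor factors commute, so the cross terms cancel. -/
theorem tensor_comm_even (x y : Module.End ℂ V) (x' y' : Module.End ℂ W) :
    (LinearMap.rTensor W x + LinearMap.lTensor V x') *
        (LinearMap.rTensor W y + LinearMap.lTensor V y') -
      (LinearMap.rTensor W y + LinearMap.lTensor V y') *
        (LinearMap.rTensor W x + LinearMap.lTensor V x') =
      LinearMap.rTensor W (x * y - y * x) + LinearMap.lTensor V (x' * y' - y' * x') := by
  refine TensorProduct.ext' fun v w => ?_
  simp only [LinearMap.sub_apply, LinearMap.add_apply, Module.End.mul_apply,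
    LinearMap.rTensor_tmul, LinearMap.lTensor_tmul, map_add, TensorProduct.sub_tmul,
    TensorProduct.tmul_sub]
  abel

theorem tensor_comm_odd (x y p : Module.End ℂ V) (x' y' : Module.End ℂ W) (hp : p * x = x * p) :
    (LinearMap.rTensor W x + LinearMap.lTensor V x') *
        (LinearMap.rTensor W y + TensorProduct.map p y') -
      (LinearMap.rTensor W y + TensorProduct.map p y') *
        (LinearMap.rTensor W x + LinearMap.lTensor V x') =
      LinearMap.rTensor W (x * y - y * x) + TensorProduct.map p (x' * y' - y' * x') := by
  refine TensorProduct.ext' fun v w => ?_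
  have h := LinearMap.congr_fun hp v
  simp only [Module.End.mul_apply] at h
  simp only [LinearMap.sub_apply, LinearMap.add_apply, Module.End.mul_apply,
    LinearMap.rTensor_tmul, LinearMap.lTensor_tmul, TensorProduct.map_tmul, map_add,
    TensorProduct.sub_tmul, TensorProduct.tmul_sub, h]
  abel

/-- The Koszul sign is carried by `p`: the cross terms cancel because `p` anticommutes with the odd
operators `x` and `y`, and in the remaining term `p * p = 1` removes `p` altogether. -/
theorem tensor_anticomm (x y p : Module.End ℂ V) (x' y' : Module.End ℂ W) (hp : p * p = 1)
    (hx : p * x = -(x * p)) (hy : p * y = -(y * p)) :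
    (LinearMap.rTensor W x + TensorProduct.map p x') *
        (LinearMap.rTensor W y + TensorProduct.map p y') +
      (LinearMap.rTensor W y + TensorProduct.map p y') *
        (LinearMap.rTensor W x + TensorProduct.map p x') =
      LinearMap.rTensor W (x * y + y * x) + LinearMap.lTensor V (x' * y' + y' * x') := by
  refine TensorProduct.ext' fun v w => ?_
  have h := LinearMap.congr_fun hx v
  have h' := LinearMap.congr_fun hy v
  have h'' := LinearMap.congr_fun hp v
  simp only [Module.End.mul_apply, LinearMap.neg_apply, Module.End.one_apply] at h h' h''
  simp only [LinearMap.add_apply, Module.End.mul_apply, LinearMap.rTensor_tmul,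
    LinearMap.lTensor_tmul, TensorProduct.map_tmul, map_add, TensorProduct.add_tmul,
    TensorProduct.tmul_add, h, h', h'', TensorProduct.neg_tmul]
  abel

/-- The tensor product of two representations. -/
noncomputable def tensor (R : Rep σ V) (S : Rep σ W) : Rep σ (V ⊗[ℂ] W) where
  e i := LinearMap.rTensor W (R.e i) + LinearMap.lTensor V (S.e i)
  f i := LinearMap.rTensor W (R.f i) + LinearMap.lTensor V (S.f i)
  h i := LinearMap.rTensor W (R.h i) + LinearMap.lTensor V (S.h i)
  q k := LinearMap.rTensor W (R.q k) + TensorProduct.map R.par (S.q k)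
  par := TensorProduct.map R.par S.par
  h_h i j := by rw [tensor_comm_even, R.h_h, S.h_h]; simp
  e_e i j := by rw [tensor_comm_even, R.e_e, S.e_e]; simp
  f_f i j := by rw [tensor_comm_even, R.f_f, S.f_f]; simp
  h_e i j := by
    rw [tensor_comm_even, R.h_e, S.h_e]
    split_ifs <;> simp [LinearMap.rTensor_smul, LinearMap.lTensor_smul]
  h_f i j := by
    rw [tensor_comm_even, R.h_f, S.h_f]
    split_ifs <;> simp [LinearMap.rTensor_smul, LinearMap.lTensor_smul]
  e_f i j := by
    rw [tensor_comm_even, R.e_f, S.e_f]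
    split_ifs <;> simp
  h_q i k := by
    rw [tensor_comm_odd _ _ _ _ _ (R.par_h i), R.h_q, S.h_q]
    simp [LinearMap.rTensor_smul, TensorProduct.map_smul_right]
  e_q i k := by
    rw [tensor_comm_odd _ _ _ _ _ (R.par_e i), R.e_q, S.e_q]
    split_ifs <;> simp
  f_q i k := by
    rw [tensor_comm_odd _ _ _ _ _ (R.par_f i), R.f_q, S.f_q]
    split_ifs <;> simp
  q_q k l := by
    rw [tensor_anticomm _ _ _ _ _ R.par_par (R.par_q k) (R.par_q l), R.q_q, S.q_q,
      ← LinearMap.coe_rTensorHom, ← LinearMap.coe_lTensorHom, map_sum, map_sum,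
      ← Finset.sum_add_distrib]
    refine Finset.sum_congr rfl fun i _ => ?_
    rw [map_smul, map_smul, ← smul_add, map_pTable, map_pTable]
    congr 1
    generalize k i = a
    generalize l i = b
    revert a b
    refine bit_cases (bit_cases ?_ ?_) (bit_cases ?_ ?_) <;> simp [pTable] <;> abel
  par_par := by
    rw [← TensorProduct.map_mul, R.par_par, S.par_par, TensorProduct.map_one]
  par_e i := by
    refine TensorProduct.ext' fun v w => ?_
    have h := LinearMap.congr_fun (R.par_e i) v
    have h' := LinearMap.congr_fun (S.par_e i) w
    simp only [Module.End.mul_apply] at h h'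
    simp [h, h']
  par_f i := by
    refine TensorProduct.ext' fun v w => ?_
    have h := LinearMap.congr_fun (R.par_f i) v
    have h' := LinearMap.congr_fun (S.par_f i) w
    simp only [Module.End.mul_apply] at h h'
    simp [h, h']
  par_h i := by
    refine TensorProduct.ext' fun v w => ?_
    have h := LinearMap.congr_fun (R.par_h i) v
    have h' := LinearMap.congr_fun (S.par_h i) w
    simp only [Module.End.mul_apply] at h h'
    simp [h, h']
  par_q k := by
    refine TensorProduct.ext' fun v w => ?_
    have h := LinearMap.congr_fun (R.par_q k) v
    have h' := LinearMap.congr_fun (S.par_q k) w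
    simp only [Module.End.mul_apply, LinearMap.neg_apply] at h h'
    simp [h, h', TensorProduct.neg_tmul, TensorProduct.tmul_neg]
    abel

end Rep

/-! ### The adjoint representation -/

theorem br_odd_left (ζ : ℂ) (w : Odd) (A : Fin 3 → sl2) (v : Odd) :
    br ζ (0, w) (A, v) = (oddBr ζ w v, -act A w) := by
  refine Prod.ext (funext fun i => ?_) ?_ <;>
    simp [br_def, brFun, act_zero_left]

/-- The parity operator of the Lie superalgebra. -/
def carrierPar : Module.End ℂ Carrier := LinearMap.prodMap LinearMap.id (-LinearMap.id)

theorem carrierPar_mk (A : Fin 3 → sl2) (v : Odd) : carrierPar (A, v) = (A, -v) := by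
  simp [carrierPar]

theorem carrierPar_comm_even (ζ : ℂ) (i : Fin 3) (X : sl2) :
    carrierPar * (D21 ζ).br (evenVec i X) = (D21 ζ).br (evenVec i X) * carrierPar := by
  refine LinearMap.ext fun ⟨A, v⟩ => ?_
  simp only [Module.End.mul_apply, evenVec]
  rw [← br, ← br, carrierPar_mk A v, br_even_left, br_even_left, carrierPar_mk, act_neg_right]

/-- The adjoint representation. -/
noncomputable def adRep (ζ : ℂ) : Rep (sigma ζ) Carrier where
  toGens := adGens ζ
  par := carrierPar
  par_par := by
    refine LinearMap.ext fun ⟨A, v⟩ => ?_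
    rw [Module.End.mul_apply, carrierPar_mk, carrierPar_mk, neg_neg, Module.End.one_apply]
  par_e i := carrierPar_comm_even ζ i slE
  par_f i := carrierPar_comm_even ζ i slF
  par_h i := carrierPar_comm_even ζ i slH
  par_q k := by
    refine LinearMap.ext fun ⟨A, v⟩ => ?_
    change carrierPar (br ζ (oddBasis k) (A, v)) = -br ζ (oddBasis k) (carrierPar (A, v))
    rw [carrierPar_mk A v, oddBasis, oddVec, br_odd_left, br_odd_left, carrierPar_mk]
    refine Prod.ext (funext fun i => ?_) ?_
    · simp [oddBr_neg_right]
    · simp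

/-! ### A one-parameter family of representations on superpolynomials -/

open MvPolynomial

/-- Polynomials in two variables. -/
abbrev Poly : Type := MvPolynomial (Fin 2) ℂ

/-- Polynomials in two even variables `x, y` and two odd variables `ξ₀, ξ₁`; the components are the
coefficients of `1, ξ₀, ξ₁, ξ₀ξ₁`. -/
abbrev SuperPoly : Type := Poly × Poly × Poly × Poly

namespace SuperPoly

/-- The commutator of two derivations is a derivation, and this one vanishes on the variables. -/
theorem pderiv_comm (g : Poly) : pderiv 1 (pderiv 0 g) = pderiv 0 (pderiv 1 g) := by
  have h : ⁅(pderiv 1 : Derivation ℂ Poly Poly), (pderiv 0 : Derivation ℂ Poly Poly)⁆ = 0 := by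
    refine MvPolynomial.derivation_ext (R := ℂ) fun i => ?_
    rw [Derivation.commutator_apply]
    simp [pderiv_X, Pi.single_apply, apply_ite]
  have h' := DFunLike.congr_fun h g
  rwa [Derivation.commutator_apply, Derivation.zero_apply, sub_eq_zero] at h'

/-- Multiplication by an even variable. -/
noncomputable def mulX (i : Fin 2) : Module.End ℂ SuperPoly where
  toFun φ := (X i * φ.1, X i * φ.2.1, X i * φ.2.2.1, X i * φ.2.2.2)
  map_add' u v := by simp [mul_add]
  map_smul' a u := by simp

/-- The derivative in an even variable. -/
noncomputable def dX (i : Fin 2) : Module.End ℂ SuperPoly where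
  toFun φ := (pderiv i φ.1, pderiv i φ.2.1, pderiv i φ.2.2.1, pderiv i φ.2.2.2)
  map_add' u v := by simp
  map_smul' a u := by simp

/-- Multiplication by an odd variable. -/
noncomputable def mulXi : Fin 2 → Module.End ℂ SuperPoly :=
  ![{ toFun := fun φ => (0, φ.1, 0, φ.2.2.1)
      map_add' := fun u v => by simp
      map_smul' := fun a u => by simp },
    { toFun := fun φ => (0, 0, φ.1, -φ.2.1)
      map_add' := fun u v => by simp [add_comm]
      map_smul' := fun a u => by simp }]

/-- The derivative in an odd variable. -/
noncomputable def dXi : Fin 2 → Module.End ℂ SuperPoly :=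
  ![{ toFun := fun φ => (φ.2.1, 0, φ.2.2.2, 0)
      map_add' := fun u v => by simp
      map_smul' := fun a u => by simp },
    { toFun := fun φ => (φ.2.2.1, -φ.2.2.2, 0, 0)
      map_add' := fun u v => by simp [add_comm]
      map_smul' := fun a u => by simp }]

/-- The parity operator. -/
noncomputable def parity : Module.End ℂ SuperPoly where
  toFun φ := (φ.1, -φ.2.1, -φ.2.2.1, φ.2.2.2)
  map_add' u v := by simp [add_comm]
  map_smul' a u := by simp

section apply

variable (i : Fin 2) (φ φ₀ φ₁ φ₂ : Poly)

theorem mulX_apply : mulX i (φ, φ₀, φ₁, φ₂) = (X i * φ, X i * φ₀, X i * φ₁, X i * φ₂) := rfl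

theorem dX_apply :
    dX i (φ, φ₀, φ₁, φ₂) = (pderiv i φ, pderiv i φ₀, pderiv i φ₁, pderiv i φ₂) := rfl

theorem mulXi_zero_apply : mulXi 0 (φ, φ₀, φ₁, φ₂) = (0, φ, 0, φ₁) := rfl

theorem mulXi_one_apply : mulXi 1 (φ, φ₀, φ₁, φ₂) = (0, 0, φ, -φ₀) := rfl

theorem dXi_zero_apply : dXi 0 (φ, φ₀, φ₁, φ₂) = (φ₀, 0, φ₂, 0) := rfl

theorem dXi_one_apply : dXi 1 (φ, φ₀, φ₁, φ₂) = (φ₁, -φ₂, 0, 0) := rfl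

theorem parity_apply : parity (φ, φ₀, φ₁, φ₂) = (φ, -φ₀, -φ₁, φ₂) := rfl

end apply

/-- The Euler operator of the odd variables. -/
noncomputable def degXi : Module.End ℂ SuperPoly := mulXi 0 * dXi 0 + mulXi 1 * dXi 1

/-- The odd derivatives, contracted with the symplectic form. -/
noncomputable def dXiDual : Fin 2 → Module.End ℂ SuperPoly := ![dXi 1, -dXi 0]

variable (s₀ s₁ t : ℂ)

/-- The raising operators of the three copies of `sl₂`. -/
noncomputable def opE : Fin 3 → Module.End ℂ SuperPoly :=
  ![(s₁ * t) • dX 0 - mulX 0 * dX 0 * dX 0 - degXi * dX 0 + (2 * s₁) • (mulX 1 * dXi 0 * dXi 1),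
    (s₀ * t) • dX 1 - mulX 1 * dX 1 * dX 1 - degXi * dX 1 + (2 * s₀) • (mulX 0 * dXi 0 * dXi 1),
    mulXi 0 * dXi 1]

/-- The lowering operators of the three copies of `sl₂`. -/
noncomputable def opF : Fin 3 → Module.End ℂ SuperPoly := ![mulX 0, mulX 1, mulXi 1 * dXi 0]

/-- The Cartan elements of the three copies of `sl₂`. -/
noncomputable def opH : Fin 3 → Module.End ℂ SuperPoly :=
  ![(s₁ * t) • 1 - (2 : ℂ) • (mulX 0 * dX 0) - degXi,
    (s₀ * t) • 1 - (2 : ℂ) • (mulX 1 * dX 1) - degXi,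
    mulXi 0 * dXi 0 - mulXi 1 * dXi 1]

/-- The odd operators. -/
noncomputable def opQ (k : Fin 3 → Fin 2) : Module.End ℂ SuperPoly :=
  ![![(-(2 * (s₀ * s₁ * t))) • dXiDual (k 2) + (2 * s₀) • (mulX 0 * dX 0 * dXiDual (k 2)) +
        (2 * s₁) • (mulX 1 * dX 1 * dXiDual (k 2)) + mulXi (k 2) * dX 0 * dX 1 +
        (2 * (s₀ + s₁)) • (mulXi (k 2) * dXi 0 * dXi 1),
      -(mulXi (k 2) * dX 0) - (2 * s₁) • (mulX 1 * dXiDual (k 2))],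
    ![-(mulXi (k 2) * dX 1) - (2 * s₀) • (mulX 0 * dXiDual (k 2)), mulXi (k 2)]] (k 0) (k 1)

theorem forall_index {p : (Fin 3 → Fin 2) → Prop} (h : ∀ a b c, p ![a, b, c]) (k) : p k := by
  have hk : k = ![k 0, k 1, k 2] := funext (slot_cases rfl rfl rfl)
  rw [hk]
  exact h _ _ _

theorem pderiv_two (i : Fin 2) : pderiv i (2 : Poly) = 0 := by
  rw [← map_ofNat (C : ℂ →+* Poly) 2, pderiv_C]

theorem C_two : (C 2 : Poly) = 2 := map_ofNat C 2

theorem update_index (a b c x : Fin 2) :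
    Function.update ![a, b, c] 0 x = ![x, b, c] ∧ Function.update ![a, b, c] 1 x = ![a, x, c] ∧
      Function.update ![a, b, c] 2 x = ![a, b, x] := Gens.update_index a b c x

set_option linter.unusedSimpArgs false

/-- This and the next relations are checked on the coefficients of 1, ξ₀, ξ₁, ξ₀ξ₁ separately. After
the Leibniz rule and the commutation of partial derivatives, each component is an identity in a
commutative ring. -/
theorem op_h_h (i j) :
    opH s₀ s₁ t i * opH s₀ s₁ t j - opH s₀ s₁ t j * opH s₀ s₁ t i = 0 := by
  refine LinearMap.ext fun ⟨φ, φ₀, φ₁, φ₂⟩ => ?_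
  revert i j
  refine slot_cases (slot_cases ?_ ?_ ?_) (slot_cases ?_ ?_ ?_) (slot_cases ?_ ?_ ?_) <;>
    simp [opH, opE, opF, opQ, dXiDual, degXi, parity_apply, mulX_apply, dX_apply, mulXi_zero_apply,
      mulXi_one_apply, dXi_zero_apply, dXi_one_apply, Derivation.leibniz, pderiv_X, smul_eq_C_mul,
      pderiv_comm, C_two, pderiv_two, sgn, psi, pTable, update_index] <;>
    (repeat' apply And.intro) <;> ring

theorem op_e_e (i j) :
    opE s₀ s₁ t i * opE s₀ s₁ t j - opE s₀ s₁ t j * opE s₀ s₁ t i = 0 := by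
  refine LinearMap.ext fun ⟨φ, φ₀, φ₁, φ₂⟩ => ?_
  revert i j
  refine slot_cases (slot_cases ?_ ?_ ?_) (slot_cases ?_ ?_ ?_) (slot_cases ?_ ?_ ?_) <;>
    simp [opH, opE, opF, opQ, dXiDual, degXi, parity_apply, mulX_apply, dX_apply, mulXi_zero_apply,
      mulXi_one_apply, dXi_zero_apply, dXi_one_apply, Derivation.leibniz, pderiv_X, smul_eq_C_mul,
      pderiv_comm, C_two, pderiv_two, sgn, psi, pTable, update_index] <;>
    (repeat' apply And.intro) <;> ring

theorem op_f_f (i j) :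
    opF i * opF j - opF j * opF i = 0 := by
  refine LinearMap.ext fun ⟨φ, φ₀, φ₁, φ₂⟩ => ?_
  revert i j
  refine slot_cases (slot_cases ?_ ?_ ?_) (slot_cases ?_ ?_ ?_) (slot_cases ?_ ?_ ?_) <;>
    simp [opH, opE, opF, opQ, dXiDual, degXi, parity_apply, mulX_apply, dX_apply, mulXi_zero_apply,
      mulXi_one_apply, dXi_zero_apply, dXi_one_apply, Derivation.leibniz, pderiv_X, smul_eq_C_mul,
      pderiv_comm, C_two, pderiv_two, sgn, psi, pTable, update_index] <;>
    (repeat' apply And.intro) <;> ring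

theorem op_h_e (i j) :
    opH s₀ s₁ t i * opE s₀ s₁ t j - opE s₀ s₁ t j * opH s₀ s₁ t i = if i = j then (2 : ℂ) • opE s₀ s₁ t j else 0 := by
  refine LinearMap.ext fun ⟨φ, φ₀, φ₁, φ₂⟩ => ?_
  revert i j
  refine slot_cases (slot_cases ?_ ?_ ?_) (slot_cases ?_ ?_ ?_) (slot_cases ?_ ?_ ?_) <;>
    simp [opH, opE, opF, opQ, dXiDual, degXi, parity_apply, mulX_apply, dX_apply, mulXi_zero_apply,
      mulXi_one_apply, dXi_zero_apply, dXi_one_apply, Derivation.leibniz, pderiv_X, smul_eq_C_mul,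
      pderiv_comm, C_two, pderiv_two, sgn, psi, pTable, update_index] <;>
    (repeat' apply And.intro) <;> ring

theorem op_h_f (i j) :
    opH s₀ s₁ t i * opF j - opF j * opH s₀ s₁ t i = if i = j then (-2 : ℂ) • opF j else 0 := by
  refine LinearMap.ext fun ⟨φ, φ₀, φ₁, φ₂⟩ => ?_
  revert i j
  refine slot_cases (slot_cases ?_ ?_ ?_) (slot_cases ?_ ?_ ?_) (slot_cases ?_ ?_ ?_) <;>
    simp [opH, opE, opF, opQ, dXiDual, degXi, parity_apply, mulX_apply, dX_apply, mulXi_zero_apply,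
      mulXi_one_apply, dXi_zero_apply, dXi_one_apply, Derivation.leibniz, pderiv_X, smul_eq_C_mul,
      pderiv_comm, C_two, pderiv_two, sgn, psi, pTable, update_index] <;>
    (repeat' apply And.intro) <;> ring

theorem op_e_f (i j) :
    opE s₀ s₁ t i * opF j - opF j * opE s₀ s₁ t i = if i = j then opH s₀ s₁ t j else 0 := by
  refine LinearMap.ext fun ⟨φ, φ₀, φ₁, φ₂⟩ => ?_
  revert i j
  refine slot_cases (slot_cases ?_ ?_ ?_) (slot_cases ?_ ?_ ?_) (slot_cases ?_ ?_ ?_) <;>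
    simp [opH, opE, opF, opQ, dXiDual, degXi, parity_apply, mulX_apply, dX_apply, mulXi_zero_apply,
      mulXi_one_apply, dXi_zero_apply, dXi_one_apply, Derivation.leibniz, pderiv_X, smul_eq_C_mul,
      pderiv_comm, C_two, pderiv_two, sgn, psi, pTable, update_index] <;>
    (repeat' apply And.intro) <;> ring

set_option maxHeartbeats 4000000 in
theorem op_h_q (i k) :
    opH s₀ s₁ t i * opQ s₀ s₁ t k - opQ s₀ s₁ t k * opH s₀ s₁ t i = sgn (k i) • opQ s₀ s₁ t k := by
  refine LinearMap.ext fun ⟨φ, φ₀, φ₁, φ₂⟩ => ?_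
  revert i k
  refine slot_cases ?_ ?_ ?_ <;>
    refine forall_index (bit_cases (bit_cases (bit_cases ?_ ?_) (bit_cases ?_ ?_))
      (bit_cases (bit_cases ?_ ?_) (bit_cases ?_ ?_))) <;>
    simp [opH, opE, opF, opQ, dXiDual, degXi, parity_apply, mulX_apply, dX_apply, mulXi_zero_apply,
      mulXi_one_apply, dXi_zero_apply, dXi_one_apply, Derivation.leibniz, pderiv_X, smul_eq_C_mul,
      pderiv_comm, C_two, pderiv_two, sgn, psi, pTable, update_index] <;>
    (repeat' apply And.intro) <;> ring

set_option maxHeartbeats 4000000 in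
theorem op_e_q (i k) :
    opE s₀ s₁ t i * opQ s₀ s₁ t k - opQ s₀ s₁ t k * opE s₀ s₁ t i =
      if k i = 1 then opQ s₀ s₁ t (Function.update k i 0) else 0 := by
  refine LinearMap.ext fun ⟨φ, φ₀, φ₁, φ₂⟩ => ?_
  revert i k
  refine slot_cases ?_ ?_ ?_ <;>
    refine forall_index (bit_cases (bit_cases (bit_cases ?_ ?_) (bit_cases ?_ ?_))
      (bit_cases (bit_cases ?_ ?_) (bit_cases ?_ ?_))) <;>
    simp [opH, opE, opF, opQ, dXiDual, degXi, parity_apply, mulX_apply, dX_apply, mulXi_zero_apply,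
      mulXi_one_apply, dXi_zero_apply, dXi_one_apply, Derivation.leibniz, pderiv_X, smul_eq_C_mul,
      pderiv_comm, C_two, pderiv_two, sgn, psi, pTable, update_index] <;>
    (repeat' apply And.intro) <;> ring

set_option maxHeartbeats 4000000 in
theorem op_f_q (i k) :
    opF i * opQ s₀ s₁ t k - opQ s₀ s₁ t k * opF i =
      if k i = 0 then opQ s₀ s₁ t (Function.update k i 1) else 0 := by
  refine LinearMap.ext fun ⟨φ, φ₀, φ₁, φ₂⟩ => ?_
  revert i k
  refine slot_cases ?_ ?_ ?_ <;>
    refine forall_index (bit_cases (bit_cases (bit_cases ?_ ?_) (bit_cases ?_ ?_))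
      (bit_cases (bit_cases ?_ ?_) (bit_cases ?_ ?_))) <;>
    simp [opH, opE, opF, opQ, dXiDual, degXi, parity_apply, mulX_apply, dX_apply, mulXi_zero_apply,
      mulXi_one_apply, dXi_zero_apply, dXi_one_apply, Derivation.leibniz, pderiv_X, smul_eq_C_mul,
      pderiv_comm, C_two, pderiv_two, sgn, psi, pTable, update_index] <;>
    (repeat' apply And.intro) <;> ring

theorem pTable_comm {A : Type} [AddCommGroup A] [Module ℂ A] (e f h : A) (a b : Fin 2) :
    pTable e f h a b = pTable e f h b a := by
  revert a b
  exact bit_cases (bit_cases rfl rfl) (bit_cases rfl rfl)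

theorem psi_comm (a b : Fin 2) : psi a b = -psi b a := by
  revert a b
  refine bit_cases (bit_cases ?_ ?_) (bit_cases ?_ ?_) <;> simp [psi]

-- The third structure constant is forced to be -(s₀ + s₁); the sum-zero condition on σ enters the
-- construction only here.
set_option maxHeartbeats 4000000 in
theorem op_q_q (k l) : opQ s₀ s₁ t k * opQ s₀ s₁ t l + opQ s₀ s₁ t l * opQ s₀ s₁ t k =
    ∑ i, ((![s₀, s₁, -(s₀ + s₁)] : Fin 3 → ℂ) i *
      ∏ j ∈ Finset.univ.erase i, psi (k j) (l j)) •
        pTable (opE s₀ s₁ t i) (opF i) (opH s₀ s₁ t i) (k i) (l i) := by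
  simp only [Fin.sum_univ_three, prod_erase_zero, prod_erase_one, prod_erase_two]
  -- Both sides are symmetric in `k` and `l`, as the signs of the two `psi` factors cancel; hence
  -- only pairs in increasing binary order need checking.
  wlog h : 4 * (k 0).1 + 2 * (k 1).1 + (k 2).1 ≤ 4 * (l 0).1 + 2 * (l 1).1 + (l 2).1
      generalizing k l
  · rw [add_comm, this l k (le_of_not_ge h)]
    simp only [psi_comm (l _), neg_mul_neg, pTable_comm _ _ _ (l _)]
  refine LinearMap.ext fun ⟨φ, φ₀, φ₁, φ₂⟩ => ?_
  revert l
  revert k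
  refine forall_index (bit_cases (bit_cases (bit_cases ?_ ?_) (bit_cases ?_ ?_))
    (bit_cases (bit_cases ?_ ?_) (bit_cases ?_ ?_))) <;>
  refine forall_index (bit_cases (bit_cases (bit_cases ?_ ?_) (bit_cases ?_ ?_))
    (bit_cases (bit_cases ?_ ?_) (bit_cases ?_ ?_))) <;> intro h <;>
    first
    | exact absurd h (by decide)
    | (clear h
       simp [opH, opE, opF, opQ, dXiDual, degXi, mulX_apply, dX_apply, mulXi_zero_apply,
         mulXi_one_apply, dXi_zero_apply, dXi_one_apply, Derivation.leibniz, pderiv_X,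
         smul_eq_C_mul, pderiv_comm, C_two, pderiv_two, psi, pTable] <;>
       (repeat' apply And.intro) <;> first | ring1 | rfl)

section rep

variable {s₀ s₁ t}

theorem parity_parity : parity * parity = 1 := by
  refine LinearMap.ext fun ⟨φ, φ₀, φ₁, φ₂⟩ => ?_
  simp [parity_apply]

theorem parity_opE (i) : parity * opE s₀ s₁ t i = opE s₀ s₁ t i * parity := by
  refine LinearMap.ext fun ⟨φ, φ₀, φ₁, φ₂⟩ => ?_
  revert i
  refine slot_cases ?_ ?_ ?_ <;>
    simp [opE, degXi, parity_apply, mulX_apply, dX_apply, mulXi_zero_apply,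
      mulXi_one_apply, dXi_zero_apply, dXi_one_apply] <;>
    (repeat' apply And.intro) <;> ring

theorem parity_opF (i) : parity * opF i = opF i * parity := by
  refine LinearMap.ext fun ⟨φ, φ₀, φ₁, φ₂⟩ => ?_
  revert i
  refine slot_cases ?_ ?_ ?_ <;>
    simp [opF, parity_apply, mulX_apply, mulXi_one_apply, dXi_zero_apply]

theorem parity_opH (i) : parity * opH s₀ s₁ t i = opH s₀ s₁ t i * parity := by
  refine LinearMap.ext fun ⟨φ, φ₀, φ₁, φ₂⟩ => ?_
  revert i
  refine slot_cases ?_ ?_ ?_ <;>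
    simp [opH, degXi, parity_apply, mulX_apply, dX_apply, mulXi_zero_apply,
      mulXi_one_apply, dXi_zero_apply, dXi_one_apply, smul_eq_C_mul, C_two] <;>
    (repeat' apply And.intro) <;> ring

theorem parity_opQ (k) : parity * opQ s₀ s₁ t k = -(opQ s₀ s₁ t k * parity) := by
  refine LinearMap.ext fun ⟨φ, φ₀, φ₁, φ₂⟩ => ?_
  revert k
  refine forall_index (bit_cases (bit_cases (bit_cases ?_ ?_) (bit_cases ?_ ?_))
    (bit_cases (bit_cases ?_ ?_) (bit_cases ?_ ?_))) <;>
    simp [opQ, dXiDual, parity_apply, mulX_apply, dX_apply, mulXi_zero_apply,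
      mulXi_one_apply, dXi_zero_apply, dXi_one_apply, smul_eq_C_mul, C_two] <;>
    ring

/-- The one-parameter family of highest weight representations on superpolynomials. -/
noncomputable def rep {σ : Fin 3 → ℂ} (hσ : σ 0 + σ 1 + σ 2 = 0) (t : ℂ) : Rep σ SuperPoly where
  e := opE (σ 0) (σ 1) t
  f := opF
  h := opH (σ 0) (σ 1) t
  q := opQ (σ 0) (σ 1) t
  par := parity
  h_h := op_h_h _ _ _
  e_e := op_e_e _ _ _
  f_f := op_f_f
  h_e := op_h_e _ _ _
  h_f := op_h_f _ _ _
  e_f := op_e_f _ _ _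
  h_q := op_h_q _ _ _
  e_q := op_e_q _ _ _
  f_q := op_f_q _ _ _
  q_q k l := by
    have h : σ = ![σ 0, σ 1, -(σ 0 + σ 1)] :=
      funext (slot_cases rfl rfl (eq_neg_of_add_eq_zero_right hσ))
    rw [op_q_q, ← h]
  par_par := parity_parity
  par_e := parity_opE
  par_f := parity_opF
  par_h := parity_opH
  par_q := parity_opQ

end rep

end SuperPoly
namespace Gens

variable {σ : Fin 3 → ℂ} {A : Type} [Ring A] [Algebra ℂ A] (G : Gens σ A)

/-! ### Relations between particular generators -/

/-- Since `psi` is alternating, the diagonal case of `q_q` reads 2 q_k² = 0. -/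
theorem q_mul_self (k) : G.q k * G.q k = 0 := by
  have h := G.q_q k k
  have hp : ∀ a, psi a a = 0 := bit_cases (by simp [psi]) (by simp [psi])
  simp only [Fin.sum_univ_three, prod_erase_zero, prod_erase_one, prod_erase_two, hp, mul_zero,
    zero_smul, add_zero] at h
  rw [← two_smul ℂ] at h
  exact (smul_eq_zero.1 h).resolve_left two_ne_zero

theorem q011_q000 : G.q ![0, 1, 1] * G.q ![0, 0, 0] + G.q ![0, 0, 0] * G.q ![0, 1, 1] =
    (2 * σ 0) • G.e 0 := by
  rw [G.q_q]
  simp [Fin.sum_univ_three, prod_erase_zero, prod_erase_one, prod_erase_two, psi, pTable]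
  module

theorem q010_q001 : G.q ![0, 1, 0] * G.q ![0, 0, 1] + G.q ![0, 0, 1] * G.q ![0, 1, 0] =
    (-2 * σ 0) • G.e 0 := by
  rw [G.q_q]
  simp [Fin.sum_univ_three, prod_erase_zero, prod_erase_one, prod_erase_two, psi, pTable]
  module

theorem q010_q000 : G.q ![0, 1, 0] * G.q ![0, 0, 0] + G.q ![0, 0, 0] * G.q ![0, 1, 0] = 0 := by
  rw [G.q_q]
  simp [Fin.sum_univ_three, prod_erase_zero, prod_erase_one, prod_erase_two, psi, pTable]

theorem q001_q100 : G.q ![0, 0, 1] * G.q ![1, 0, 0] + G.q ![1, 0, 0] * G.q ![0, 0, 1] =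
    (-2 * σ 1) • G.e 1 := by
  rw [G.q_q]
  simp [Fin.sum_univ_three, prod_erase_zero, prod_erase_one, prod_erase_two, psi, pTable]
  module

theorem q011_q101 : G.q ![0, 1, 1] * G.q ![1, 0, 1] + G.q ![1, 0, 1] * G.q ![0, 1, 1] =
    (2 * σ 2) • G.f 2 := by
  rw [G.q_q]
  simp [Fin.sum_univ_three, prod_erase_zero, prod_erase_one, prod_erase_two, psi, pTable]
  module

theorem q000_q110 : G.q ![0, 0, 0] * G.q ![1, 1, 0] + G.q ![1, 1, 0] * G.q ![0, 0, 0] =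
    (2 * σ 2) • G.e 2 := by
  rw [G.q_q]
  simp [Fin.sum_univ_three, prod_erase_zero, prod_erase_one, prod_erase_two, psi, pTable]
  module

theorem q011_q100 : G.q ![0, 1, 1] * G.q ![1, 0, 0] + G.q ![1, 0, 0] * G.q ![0, 1, 1] =
    -σ 0 • G.h 0 + σ 1 • G.h 1 + σ 2 • G.h 2 := by
  rw [G.q_q]
  simp [Fin.sum_univ_three, prod_erase_zero, prod_erase_one, prod_erase_two, psi, pTable]

theorem q001_q110 : G.q ![0, 0, 1] * G.q ![1, 1, 0] + G.q ![1, 1, 0] * G.q ![0, 0, 1] =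
    σ 0 • G.h 0 + σ 1 • G.h 1 - σ 2 • G.h 2 := by
  rw [G.q_q]
  simp [Fin.sum_univ_three, prod_erase_zero, prod_erase_one, prod_erase_two, psi, pTable]
  abel

theorem e_comm_q {i : Fin 3} {k : Fin 3 → Fin 2} (hk : k i = 0) : G.e i * G.q k = G.q k * G.e i :=
  sub_eq_zero.1 ((G.e_q i k).trans (by simp [hk]))

theorem f_comm_q {i : Fin 3} {k : Fin 3 → Fin 2} (hk : k i = 1) : G.f i * G.q k = G.q k * G.f i :=
  sub_eq_zero.1 ((G.f_q i k).trans (by simp [hk]))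

theorem e_mul_q {i : Fin 3} {k l : Fin 3 → Fin 2} (hk : k i = 1) (hl : Function.update k i 0 = l) :
    G.e i * G.q k = G.q k * G.e i + G.q l := by
  rw [← hl, ← sub_eq_iff_eq_add', G.e_q, if_pos hk]

theorem f_mul_q {i : Fin 3} {k l : Fin 3 → Fin 2} (hk : k i = 0) (hl : Function.update k i 1 = l) :
    G.f i * G.q k = G.q k * G.f i + G.q l := by
  rw [← hl, ← sub_eq_iff_eq_add', G.f_q, if_pos hk]

/-! ### Highest weight vectors and the construction of singular vectors -/

section Module

variable {V : Type} [AddCommGroup V] [Module A V]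

variable {G} in
theorem e_smul_f_pow_of_ne {i j : Fin 3} (hij : i ≠ j) {m : V} (hm : G.e i • m = 0) (N : ℕ) :
    G.e i • G.f j ^ N • m = 0 := by
  have h : Commute (G.e i) (G.f j) := sub_eq_zero.1 ((G.e_f i j).trans (by simp [hij]))
  rw [smul_smul, (h.pow_right N).eq, mul_smul, hm, smul_zero]

variable {G} in
theorem q_smul_f_pow {i : Fin 3} {k : Fin 3 → Fin 2} (hk : k i = 1) {m : V} (hm : G.q k • m = 0)
    (N : ℕ) : G.q k • G.f i ^ N • m = 0 := by
  have h : Commute (G.q k) (G.f i) := (G.f_comm_q hk).symm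
  rw [smul_smul, (h.pow_right N).eq, mul_smul, hm, smul_zero]

theorem q_q_smul (k) (m : V) : G.q k • G.q k • m = 0 := by
  rw [smul_smul, q_mul_self, zero_smul]

variable [Module ℂ V]

/-- `v` is a (possibly zero) highest weight vector of weight `μ`. -/
structure HighestWeight (μ : Weight) (v : V) : Prop where
  h : ∀ i, G.h i • v = μ i • v
  e : ∀ i, G.e i • v = 0
  q : ∀ k, k 0 = 0 → G.q k • v = 0

variable [IsScalarTower ℂ A V] {G}

theorem h_smul_q {i : Fin 3} {a : ℂ} {m : V} (hm : G.h i • m = a • m) (k) :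
    G.h i • G.q k • m = (a + sgn (k i)) • G.q k • m := by
  rw [smul_smul, sub_eq_iff_eq_add.1 (G.h_q i k), add_smul, mul_smul, hm, smul_comm, smul_assoc,
    ← add_smul, add_comm]

theorem h_smul_f_pow {i : Fin 3} {a : ℂ} {m : V} (hm : G.h i • m = a • m) (j : Fin 3) (N : ℕ) :
    G.h i • G.f j ^ N • m = (a - if i = j then 2 * (N : ℂ) else 0) • G.f j ^ N • m := by
  induction N with
  | zero => simp [hm]
  | succ N ih =>
    rw [pow_succ', mul_smul, smul_smul, sub_eq_iff_eq_add.1 (G.h_f i j), add_smul, mul_smul, ih,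
      smul_comm (G.f j) (a - _)]
    split_ifs
    · rw [smul_assoc, ← add_smul]
      congr 1
      push_cast
      ring
    · simp

/-- The coefficient vanishes for N = a, and this zero is the source of all the singular vectors
below. -/
theorem e_smul_f_pow {i : Fin 3} {a : ℂ} {m : V} (he : G.e i • m = 0) (hh : G.h i • m = a • m)
    (N : ℕ) : G.e i • G.f i ^ (N + 1) • m = ((N + 1) * (a - N)) • G.f i ^ N • m := by
  have key : ∀ x : V, G.e i • G.f i • x = G.f i • G.e i • x + G.h i • x := fun x => by
    have h := G.e_f i i
    rw [if_pos rfl, sub_eq_iff_eq_add] at h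
    rw [smul_smul, h, add_smul, mul_smul, add_comm]
  induction N with
  | zero => simp [key, he, hh]
  | succ N ih =>
    rw [pow_succ', mul_smul, key, ih, h_smul_f_pow hh, if_pos rfl, smul_comm, smul_smul (G.f i),
      ← pow_succ', ← add_smul]
    congr 1
    push_cast
    ring

/-- The simple root vectors generate 𝔫₊: q₀₀₁ and q₀₁₀ are commutators of q₀₁₁ with e₁ and e₂, then
q₀₀₀ = [e₂, q₀₀₁], and finally the anticommutator of q₀₁₁ and q₀₀₀ is 2σ₀e₀. The last step needs σ₀
≠ 0. -/
theorem HighestWeight.of_simple (hσ : σ 0 ≠ 0) {μ : Weight} {v : V}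
    (h : ∀ i, G.h i • v = μ i • v) (h0 : G.q ![0, 1, 1] • v = 0) (h1 : G.e 1 • v = 0)
    (h2 : G.e 2 • v = 0) : G.HighestWeight μ v := by
  have h001 : G.q ![0, 0, 1] • v = 0 := by
    have := congrArg (· • v) (G.e_mul_q (i := 1) (k := ![0, 1, 1]) rfl (update_index _ _ _ _).2.1)
    simpa [add_smul, mul_smul, h0, h1] using this.symm
  have h010 : G.q ![0, 1, 0] • v = 0 := by
    have := congrArg (· • v) (G.e_mul_q (i := 2) (k := ![0, 1, 1]) rfl (update_index _ _ _ _).2.2)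
    simpa [add_smul, mul_smul, h0, h2] using this.symm
  have h000 : G.q ![0, 0, 0] • v = 0 := by
    have := congrArg (· • v) (G.e_mul_q (i := 2) (k := ![0, 0, 1]) rfl (update_index _ _ _ _).2.2)
    simpa [add_smul, mul_smul, h001, h2] using this.symm
  have he0 : G.e 0 • v = 0 := by
    have := congrArg (· • v) G.q011_q000
    simp only [add_smul, mul_smul, h0, h000, smul_zero, add_zero, smul_assoc] at this
    have h' := smul_eq_zero.1 this.symm
    have h'' := smul_eq_zero.1 (h'.resolve_left two_ne_zero)
    exact h''.resolve_left hσ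
  refine ⟨h, slot_cases he0 h1 h2, fun k hk => ?_⟩
  have hk' : k = ![0, k 1, k 2] := funext (slot_cases hk rfl rfl)
  rw [hk']
  generalize k 1 = a
  generalize k 2 = b
  revert a b
  exact bit_cases (bit_cases h000 h001) (bit_cases h010 h0)

/-- The product of four odd raising operators, up to sign the one in `singVec`. -/
def raise (G : Gens σ A) : A :=
  G.q ![0, 1, 1] * G.q ![0, 0, 1] * G.q ![0, 0, 0] * G.q ![0, 1, 0]

/-- The power n + 2 is one more than μ 0, so f₀^(n+2) v is killed by e₀. On such a vector the
positive odd operators anticommute, and their full product is a top exterior power: each simple root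
vector creates a repeated odd factor. The four odd operators raise the weight by 4δ and f₀^(n+2)
lowers it by (2n+4)δ, which leaves -2nδ. -/
theorem HighestWeight.raise_f_pow (hσ : σ 0 ≠ 0) {μ : Weight} {v : V} (hv : G.HighestWeight μ v)
    {n : ℕ} (hn : μ 0 = n + 1) :
    G.HighestWeight (μ - (n : ℂ) • evenRoot 0) (G.raise • G.f 0 ^ (n + 2) • v) := by
  have e0 : G.e 0 • G.f 0 ^ (n + 2) • v = 0 := by
    rw [e_smul_f_pow (hv.e 0) (hv.h 0), hn]
    push_cast
    simp
  have e1 : G.e 1 • G.f 0 ^ (n + 2) • v = 0 := e_smul_f_pow_of_ne (by decide) (hv.e 1) _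
  have e2 : G.e 2 • G.f 0 ^ (n + 2) • v = 0 := e_smul_f_pow_of_ne (by decide) (hv.e 2) _
  have hh := fun i => h_smul_f_pow (hv.h i) 0 (n + 2)
  generalize G.f 0 ^ (n + 2) • v = m at e0 e1 e2 hh ⊢
  have hw : G.raise • m =
      G.q ![0, 1, 1] • G.q ![0, 0, 1] • G.q ![0, 0, 0] • G.q ![0, 1, 0] • m := by
    simp only [raise, mul_smul]
  rw [hw]
  have ec : ∀ (i : Fin 3) (k : Fin 3 → Fin 2), k i = 0 → ∀ x : V,
      G.e i • G.q k • x = G.q k • G.e i • x := fun i k hk x => by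
    rw [smul_smul, G.e_comm_q hk, mul_smul]
  have em : ∀ (i : Fin 3) (k l : Fin 3 → Fin 2), k i = 1 → Function.update k i 0 = l → ∀ x : V,
      G.e i • G.q k • x = G.q k • G.e i • x + G.q l • x := fun i k l hk hl x => by
    rw [smul_smul, G.e_mul_q hk hl, add_smul, mul_smul]
  refine .of_simple hσ (fun i => ?_) (G.q_q_smul _ _) ?_ ?_
  · rw [h_smul_q (h_smul_q (h_smul_q (h_smul_q (hh i) _) _) _) _]
    congr 1
    revert i
    refine slot_cases ?_ ?_ ?_ <;> simp [sgn, evenRoot] <;> ring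
  -- e₁ turns q₀₁₁ into q₀₀₁ and q₀₁₀ into q₀₀₀, each time next to an equal factor.
  · rw [em 1 ![0, 1, 1] ![0, 0, 1] rfl (update_index _ _ _ _).2.1, G.q_q_smul, ec 1 ![0, 0, 1] rfl,
      ec 1 ![0, 0, 0] rfl, em 1 ![0, 1, 0] ![0, 0, 0] rfl (update_index _ _ _ _).2.1, e1, smul_zero,
      zero_add, G.q_q_smul]
    simp
  · rw [em 2 ![0, 1, 1] ![0, 1, 0] rfl (update_index _ _ _ _).2.2,
      em 2 ![0, 0, 1] ![0, 0, 0] rfl (update_index _ _ _ _).2.2, ec 2 ![0, 0, 0] rfl,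
      ec 2 ![0, 1, 0] rfl, e2, G.q_q_smul]
    simp only [smul_zero, zero_add]
    -- What is left is q₀₁₀ q₀₀₁ q₀₀₀ q₀₁₀ m. Moving the left q₀₁₀ to the right produces a square,
    -- plus a multiple of e₀, which passes through to `m` and kills it.
    rw [smul_smul, eq_sub_of_add_eq G.q010_q001, sub_smul, smul_assoc, ec 0 ![0, 0, 0] rfl,
      ec 0 ![0, 1, 0] rfl, e0, mul_smul (G.q _) (G.q _), smul_smul (G.q ![0, 1, 0]),
      eq_neg_of_add_eq_zero_left G.q010_q000, neg_smul, mul_smul (G.q ![0, 0, 0]), G.q_q_smul]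
    simp

/-- For i ≠ 0 the simple odd vector q₀₁₁ has the lowest weight in slot `i`, hence commutes with f_i,
so only the sl₂ computation in slot `i` matters. The hypothesis μ i = n - 1 is ⟨λ, h⟩ = n after the
ρ-shift. -/
theorem HighestWeight.f_pow (hσ : σ 0 ≠ 0) {μ : Weight} {v : V} (hv : G.HighestWeight μ v)
    {i : Fin 3} (hi : i ≠ 0) {n : ℕ} (hn : μ i = n - 1) :
    G.HighestWeight (μ - (n : ℂ) • evenRoot i) (G.f i ^ n • v) := by
  have he : ∀ j, G.e j • G.f i ^ n • v = 0 := by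
    intro j
    by_cases hj : j = i
    · subst hj
      obtain _ | n := n
      · simpa using hv.e j
      · rw [e_smul_f_pow (hv.e j) (hv.h j), hn]
        push_cast
        simp
    · exact e_smul_f_pow_of_ne hj (hv.e j) n
  refine .of_simple hσ (fun j => ?_) (q_smul_f_pow ?_ (hv.q _ rfl) n) (he 1) (he 2)
  · rw [h_smul_f_pow (hv.h j) i n]
    congr 1
    by_cases hj : j = i
    · subst hj
      simp [evenRoot, mul_comm]
    · simp [evenRoot, hj]
  · have hk : ∀ j : Fin 3, j ≠ 0 → (![0, 1, 1] : Fin 3 → Fin 2) j = 1 :=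
      slot_cases (fun h => absurd rfl h) (fun _ => rfl) (fun _ => rfl)
    exact hk i hi

end Module

end Gens

/-! ### Highest weight vectors, positive root spaces and the Verma ideal -/

theorem sl2_eq (X : sl2) : X = X.1 0 0 • slH + X.1 0 1 • slE + X.1 1 0 • slF := by
  refine sl2_ext ?_ ?_ ?_ <;> simp [sl2_add, slE, slF, slH]

theorem evenVec_add (i : Fin 3) (X Y : sl2) : evenVec i (X + Y) = evenVec i X + evenVec i Y := by
  simp [evenVec, Pi.single_add]

/-- Both maps agree on the standard basis. As a result, statements about the generators `uGens`
become statements about `ι x` for arbitrary `x`, as `IsSingular` requires. -/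
theorem toLinear_ofLinear {ζ : ℂ} {A : Type} [Ring A] [Algebra ℂ A] (r : Carrier →ₗ[ℂ] A)
    (hr : ∀ {a b : ZMod 2} {x y : Carrier}, x ∈ gradePart a → y ∈ gradePart b →
      r x * r y = koszulSign a b • (r y * r x) + r (br ζ x y)) :
    (Gens.ofLinear r hr).toLinear = r := by
  refine LinearMap.ext fun ⟨X, v⟩ => ?_
  have hv : ((0, v) : Carrier) = ∑ k : Fin 3 → Fin 2, v (k 0) (k 1) (k 2) • oddBasis k := by
    refine Prod.ext (by simp [Prod.fst_sum, oddBasis, oddVec]) ?_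
    rw [Prod.snd_sum, Gens.sum_index]
    funext a b c
    revert a b c
    refine bit_cases (bit_cases (bit_cases ?_ ?_) (bit_cases ?_ ?_))
      (bit_cases (bit_cases ?_ ?_) (bit_cases ?_ ?_)) <;>
      simp [Fin.sum_univ_two, oddBasis, oddVec]
  have hX : ∀ i, r (evenVec i (X i)) = (Gens.ofLinear r hr).even i (X i) := by
    intro i
    have h : evenVec i (X i) = (X i).1 0 0 • evenVec i slH + (X i).1 0 1 • evenVec i slE +
        (X i).1 1 0 • evenVec i slF := by
      simp only [← evenVec_smul, ← evenVec_add]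
      rw [← sl2_eq]
    rw [h, map_add, map_add, map_smul, map_smul, map_smul]
    rfl
  have h : r (X, v) = r (X, 0) + r (0, v) := by rw [← map_add]; simp
  rw [Gens.toLinear_apply, h, evenPart_eq_sum, hv, map_sum, map_sum]
  simp only [hX, map_smul]
  rfl

theorem lift_uGens (ζ : ℂ) (x : Carrier) : (uGens ζ).toLinear x = (D21 ζ).ι x :=
  LinearMap.congr_fun (toLinear_ofLinear _ _) x

theorem cartan_eq (t : Fin 3 → ℂ) : cartan t = ∑ i, t i • evenVec i slH := by
  rw [cartan, evenPart_eq_sum]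
  simp only [evenVec_smul]

theorem Gens.toLinear_cartan {ζ : ℂ} {A : Type} [Ring A] [Algebra ℂ A] (G : Gens (sigma ζ) A)
    (t : Fin 3 → ℂ) : G.toLinear (cartan t) = ∑ i, t i • G.h i := by
  simp [cartan_eq, Gens.toLinear_slH]

/-- The components of `x` along the negative and zero root spaces vanish if `x` lies in a positive
root space. -/
theorem components_of_mem_rootSpace {ζ : ℂ} {α : Weight} (hα : α ∈ posRoots) {x : Carrier}
    (hx : x ∈ rootSpace ζ α) :
    (∀ i, (x.1 i).1 0 0 = 0) ∧ (∀ i, (x.1 i).1 1 0 = 0) ∧ ∀ b c, x.2 1 b c = 0 := by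
  -- The Cartan element with coordinates (3, 1, 1) takes the values 6, 2, 2 and 3 ± 1 ± 1 on the
  -- positive roots, all of them positive. Components along zero or negative roots have eigenvalue
  -- -s ≤ 0 instead, so they must vanish.
  obtain ⟨r, hr, hp⟩ : ∃ r : ℝ, 0 < r ∧ pair α ![3, 1, 1] = r := by
    obtain ⟨i, rfl⟩ | ⟨s, rfl⟩ := hα
    · clear hx
      revert i
      refine slot_cases ⟨6, by norm_num, ?_⟩ ⟨2, by norm_num, ?_⟩ ⟨2, by norm_num, ?_⟩ <;>
        simp [pair_apply, evenRoot] <;> norm_num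
    · refine ⟨3 + ((s.1 : ℤ) : ℝ) + ((s.2 : ℤ) : ℝ), ?_, ?_⟩
      · rcases Int.units_eq_one_or s.1 with h | h <;> rcases Int.units_eq_one_or s.2 with h' | h' <;>
          simp [h, h'] <;> norm_num
      · simp [pair_apply, oddRoot]
  have vanish : ∀ {s : ℝ} {z : ℂ}, 0 ≤ s → -(s : ℂ) * z = r * z → z = 0 := by
    intro s z hs h
    have h0 : ((r + s : ℝ) : ℂ) * z = 0 := by
      push_cast
      linear_combination -h
    exact (mul_eq_zero.1 h0).resolve_left (Complex.ofReal_ne_zero.2 (by positivity))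
  have h := hx ![3, 1, 1]
  rw [hp] at h
  obtain ⟨X, v⟩ := x
  rw [cartan, br_even_left] at h
  have h1 := congrArg Prod.fst h
  have h2 := congrArg Prod.snd h
  refine ⟨fun i => ?_, fun i => ?_, fun b c => ?_⟩
  · have h3 := congrArg (fun Y : sl2 => Y.1 0 0) (congrFun h1 i)
    simp only [lie_mat, Matrix.sub_apply, Matrix.mul_apply, Fin.sum_univ_two, sl2_smul,
      Matrix.smul_apply] at h3
    clear h h1 h2
    revert i
    refine slot_cases (fun h3 => vanish (s := 0) (by norm_num) ?_)
      (fun h3 => vanish (s := 0) (by norm_num) ?_) (fun h3 => vanish (s := 0) (by norm_num) ?_) <;>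
      simp [slH, -mul_eq_mul_left_iff, -zero_eq_mul] at h3 ⊢ <;> linear_combination h3
  · have h3 := congrArg (fun Y : sl2 => Y.1 1 0) (congrFun h1 i)
    simp only [lie_mat, Matrix.sub_apply, Matrix.mul_apply, Fin.sum_univ_two, sl2_smul,
      Matrix.smul_apply] at h3
    clear h h1 h2
    revert i
    refine slot_cases (fun h3 => vanish (s := 6) (by norm_num) ?_)
      (fun h3 => vanish (s := 2) (by norm_num) ?_) (fun h3 => vanish (s := 2) (by norm_num) ?_) <;>
      simp [slH, -mul_eq_mul_left_iff, -zero_eq_mul] at h3 ⊢ <;> linear_combination h3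
  · have h3 := congrFun (congrFun (congrFun h2 1) b) c
    clear h h1 h2
    revert b c
    refine bit_cases (bit_cases (fun h3 => vanish (s := 1) (by norm_num) ?_)
      (fun h3 => vanish (s := 3) (by norm_num) ?_))
      (bit_cases (fun h3 => vanish (s := 3) (by norm_num) ?_)
      (fun h3 => vanish (s := 5) (by norm_num) ?_)) <;>
      simp [act, Fin.sum_univ_two, slH] at h3 ⊢ <;> linear_combination h3

section HighestWeight

variable {ζ : ℂ} {A V : Type} [Ring A] [Algebra ℂ A] [AddCommGroup V] [Module A V] [Module ℂ V]
  [IsScalarTower ℂ A V] {G : Gens (sigma ζ) A} {μ : Weight} {v : V}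

theorem Gens.HighestWeight.cartan_smul (hv : G.HighestWeight μ v) (t : Fin 3 → ℂ) :
    G.toLinear (cartan t) • v = pair μ t • v := by
  rw [Gens.toLinear_cartan, Finset.sum_smul, pair, Finset.sum_smul]
  refine Finset.sum_congr rfl fun i _ => ?_
  rw [smul_assoc, hv.h, smul_smul, mul_comm]

theorem Gens.HighestWeight.rootSpace_smul (hv : G.HighestWeight μ v) {α : Weight}
    (hα : α ∈ posRoots) {x : Carrier} (hx : x ∈ rootSpace ζ α) : G.toLinear x • v = 0 := by
  obtain ⟨h00, h10, hodd⟩ := components_of_mem_rootSpace hα hx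
  rw [Gens.toLinear_apply, add_smul, Finset.sum_smul, Gens.odd, Finset.sum_smul,
    Finset.sum_eq_zero, Finset.sum_eq_zero, add_zero]
  · intro k _
    rcases Fin.exists_fin_two.1 ⟨k 0, rfl⟩ with hk | hk
    · rw [smul_assoc, hv.q k hk, smul_zero]
    · rw [hk, hodd, zero_smul, zero_smul]
  · intro i _
    rw [Gens.even, h00, h10, zero_smul, zero_smul, zero_add, add_zero, smul_assoc, hv.e, smul_zero]

/-- The universal property of the Verma module, phrased through annihilators: generators of the
ideal kill `v`, and the annihilator of `v` is a left ideal. -/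
theorem Gens.HighestWeight.lift_smul_eq_zero {lam : Weight} (hv : G.HighestWeight (lam - rho) v)
    {X : (D21 ζ).U} (hX : X ∈ vermaIdeal ζ lam) : G.lift X • v = 0 := by
  induction hX using Submodule.span_induction with
  | mem X hX =>
    obtain ⟨t, rfl⟩ | ⟨α, hα, x, hx, rfl⟩ := hX
    · rw [map_sub, AlgHom.commutes, Gens.lift_ι, sub_smul, hv.cartan_smul, algebraMap_smul,
        sub_self]
    · rw [Gens.lift_ι, hv.rootSpace_smul hα hx]
  | zero => rw [map_zero, zero_smul]
  | add X Y _ _ hX hY => rw [map_add, add_smul, hX, hY, add_zero]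
  | smul Y X _ hX => rw [smul_eq_mul, map_mul, mul_smul, hX, smul_zero]

/-- Vanishing in the Verma module would force vanishing in every module with a highest weight vector
of the same weight. This substitutes for a PBW basis. -/
theorem Gens.HighestWeight.smul_vermaVec_ne_zero {lam : Weight}
    (hv : G.HighestWeight (lam - rho) v) {X : (D21 ζ).U} (hX : G.lift X • v ≠ 0) :
    X • vermaVec ζ lam ≠ 0 := by
  intro h
  rw [vermaVec, ← map_smul, smul_eq_mul, mul_one] at h
  exact hX (hv.lift_smul_eq_zero ((Submodule.Quotient.mk_eq_zero _).1 h))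

end HighestWeight

/-! ### Highest weight vectors in Verma modules -/

theorem Gens.HighestWeight.isSingular {ζ : ℂ} {lam μ : Weight} {u : Verma ζ lam}
    (hu : (uGens ζ).HighestWeight μ u) : IsSingular ζ μ u := by
  refine ⟨fun t => ?_, fun α hα x hx => ?_⟩
  · rw [← lift_uGens, hu.cartan_smul]
  · rw [← lift_uGens, hu.rootSpace_smul hα hx]

theorem smul_vermaVec (ζ : ℂ) (lam : Weight) (X : (D21 ζ).U) :
    X • vermaVec ζ lam = (vermaIdeal ζ lam).mkQ X := by
  rw [vermaVec, ← map_smul, smul_eq_mul, mul_one]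

theorem smul_eq_smul_of_sub_algebraMap {A V : Type} [Ring A] [Algebra ℂ A] [AddCommGroup V]
    [Module A V] [Module ℂ V] [IsScalarTower ℂ A V] {a : A} {c : ℂ} {v : V}
    (h : (a - algebraMap ℂ A c) • v = 0) : a • v = c • v := by
  rwa [sub_smul, algebraMap_smul, sub_eq_zero] at h

theorem ι_cartan_smul_vermaVec (ζ : ℂ) (lam : Weight) (t : Fin 3 → ℂ) :
    (D21 ζ).ι (cartan t) • vermaVec ζ lam = pair (lam - rho) t • vermaVec ζ lam := by
  refine smul_eq_smul_of_sub_algebraMap (A := (D21 ζ).U) (v := vermaVec ζ lam) ?_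
  rw [smul_vermaVec]
  exact (Submodule.Quotient.mk_eq_zero _).2 (Submodule.subset_span (Or.inl ⟨t, rfl⟩))

theorem ι_smul_vermaVec (ζ : ℂ) (lam : Weight) {α : Weight} (hα : α ∈ posRoots) {x : Carrier}
    (hx : x ∈ rootSpace ζ α) : (D21 ζ).ι x • vermaVec ζ lam = 0 := by
  rw [smul_vermaVec]
  exact (Submodule.Quotient.mk_eq_zero _).2 (Submodule.subset_span (Or.inr ⟨α, hα, x, hx, rfl⟩))

theorem br_cartan (ζ : ℂ) (t : Fin 3 → ℂ) (x : Carrier) :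
    br ζ (cartan t) x = ∑ i, t i • br ζ (evenVec i slH) x := by
  simp [cartan_eq, br]

theorem evenVec_slE_mem_rootSpace (ζ : ℂ) (i : Fin 3) :
    evenVec i slE ∈ rootSpace ζ (evenRoot i) := by
  intro t
  rw [br_cartan, Finset.sum_eq_single i]
  · rw [br_evenVec, if_pos rfl, lie_slH_slE, evenVec_smul, smul_smul]
    simp [pair, evenRoot, Pi.single_apply, mul_comm]
  · intro j _ hj
    rw [br_evenVec, if_neg hj, smul_zero]
  · simp

theorem oddBasis_mem_rootSpace (ζ : ℂ) (k : Fin 3 → Fin 2) :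
    oddBasis k ∈ rootSpace ζ fun i => sgn (k i) := by
  intro t
  rw [br_cartan, pair, Finset.sum_smul]
  refine Finset.sum_congr rfl fun i _ => ?_
  rw [br_slH_oddBasis, smul_smul, mul_comm]

theorem sgn_mem_posRoots {k : Fin 3 → Fin 2} (hk : k 0 = 0) : (fun i => sgn (k i)) ∈ posRoots := by
  have h : ∀ a, ∃ u : ℤˣ, ((u : ℤ) : ℂ) = sgn a :=
    bit_cases ⟨1, by simp [sgn]⟩ ⟨-1, by simp [sgn]⟩
  obtain ⟨u, hu⟩ := h (k 1)
  obtain ⟨w, hw⟩ := h (k 2)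
  refine Or.inr ⟨(u, w), funext (slot_cases ?_ hu hw)⟩
  rw [hk]
  rfl

theorem highestWeight_vermaVec (ζ : ℂ) (lam : Weight) :
    (uGens ζ).HighestWeight (lam - rho) (vermaVec ζ lam) where
  h i := by
    have h := ι_cartan_smul_vermaVec ζ lam (coroot i)
    have h' : cartan (coroot i) = evenVec i slH := by
      refine Prod.ext (funext fun j => ?_) rfl
      simp only [cartan, evenVec, coroot, Pi.single_apply]
      split_ifs with hj
      · subst hj; simp
      · simp
    rw [h'] at h
    refine h.trans ?_
    simp [pair, coroot, Pi.single_apply]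
  e i := ι_smul_vermaVec ζ lam (Or.inl ⟨i, rfl⟩) (evenVec_slE_mem_rootSpace ζ i)
  q k hk := ι_smul_vermaVec ζ lam (sgn_mem_posRoots hk) (oddBasis_mem_rootSpace ζ k)

/-! ### The vector `singVec` in terms of the standard basis -/

theorem br_oddBasis_evenVec (ζ : ℂ) (k : Fin 3 → Fin 2) (i : Fin 3) (X : sl2) :
    br ζ (oddBasis k) (evenVec i X) = -br ζ (evenVec i X) (oddBasis k) := by
  have h := (D21 ζ).skew (x := oddBasis k) (y := evenVec i X) (mem_gradePart_one.2 rfl)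
    (mem_gradePart_zero.2 rfl)
  simpa [koszulSign] using h

theorem br_slE_oddBasis_eq (ζ : ℂ) {i : Fin 3} {k l : Fin 3 → Fin 2} (hk : k i = 1)
    (hl : Function.update k i 0 = l) : br ζ (evenVec i slE) (oddBasis k) = oddBasis l := by
  rw [br_slE_oddBasis, if_pos hk, hl]

theorem br_slF_oddBasis_eq (ζ : ℂ) {i : Fin 3} {k l : Fin 3 → Fin 2} (hk : k i = 0)
    (hl : Function.update k i 1 = l) : br ζ (evenVec i slF) (oddBasis k) = oddBasis l := by
  rw [br_slF_oddBasis, if_pos hk, hl]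

theorem chevF_zero : chevF 0 = oddBasis ![1, 0, 0] := rfl

theorem chevF_one : chevF 1 = evenVec 1 slF := rfl

theorem chevF_two : chevF 2 = evenVec 2 slF := rfl

theorem ePM_eq (ζ : ℂ) : ePM ζ = -oddBasis ![0, 0, 1] := by
  have h : ePM ζ = br ζ (oddBasis ![0, 1, 1]) (evenVec 1 slE) := rfl
  rw [h, br_oddBasis_evenVec, br_slE_oddBasis_eq ζ rfl (Gens.update_index _ _ _ _).2.1]

theorem eMP_eq (ζ : ℂ) : eMP ζ = oddBasis ![0, 1, 0] := by
  have h : eMP ζ = br ζ (evenVec 2 slE) (oddBasis ![0, 1, 1]) := rfl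
  rw [h, br_slE_oddBasis_eq ζ rfl (Gens.update_index _ _ _ _).2.2]

theorem ePP_eq (ζ : ℂ) : ePP ζ = oddBasis ![0, 0, 0] := by
  have h : ePP ζ = br ζ (ePM ζ) (evenVec 2 slE) := rfl
  rw [h, ePM_eq, br, map_neg, LinearMap.neg_apply, ← br, br_oddBasis_evenVec, neg_neg,
    br_slE_oddBasis_eq ζ rfl (Gens.update_index _ _ _ _).2.2]

theorem br_chevF_zero_one (ζ : ℂ) : br ζ (chevF 0) (chevF 1) = -oddBasis ![1, 1, 0] := by
  rw [chevF_zero, chevF_one, br_oddBasis_evenVec,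
    br_slF_oddBasis_eq ζ rfl (Gens.update_index _ _ _ _).2.1]

theorem br_chevF_zero_two (ζ : ℂ) : br ζ (chevF 0) (chevF 2) = -oddBasis ![1, 0, 1] := by
  rw [chevF_zero, chevF_two, br_oddBasis_evenVec,
    br_slF_oddBasis_eq ζ rfl (Gens.update_index _ _ _ _).2.2]

theorem br_oddBasis_110_101 (ζ : ℂ) : br ζ (oddBasis ![1, 1, 0]) (oddBasis ![1, 0, 1]) =
    (2 * sigma ζ 0) • evenVec 0 slF := by
  rw [br_oddBasis]
  simp only [Fin.sum_univ_three, prod_erase_zero, prod_erase_one, prod_erase_two]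
  generalize hf : evenVec 0 slF = F
  simp [psi, pTable]
  module

theorem fTwoDelta_eq (ζ : ℂ) : fTwoDelta ζ = (2 * sigma ζ 0) • evenVec 0 slF := by
  rw [fTwoDelta, br_chevF_zero_one, br_chevF_zero_two, br, map_neg, map_neg, LinearMap.neg_apply,
    neg_neg]
  exact br_oddBasis_110_101 ζ

theorem mul_neg_mul_smul_pow {A : Type} [Ring A] [Algebra ℂ A] (a b c d f : A) (s : ℂ) (N : ℕ) :
    a * -b * c * d * (s • f) ^ N = (-s ^ N) • (a * b * c * d * f ^ N) := by
  simp [smul_pow]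

/-- The sign comes from [e₀, e₁] = -q₀₀₁ and the power from f_{2δ} = 2σ₀f₀. The scalar is nonzero
when σ₀ ≠ 0, so only `raise` needs to be studied. -/
theorem singVec_eq (ζ : ℂ) (lam : Weight) (n : ℕ) : singVec ζ lam n =
    (-(2 * sigma ζ 0) ^ (n + 2)) • (uGens ζ).raise • (uGens ζ).f 0 ^ (n + 2) • vermaVec ζ lam := by
  have h : (D21 ζ).ι (chevE 0) * (D21 ζ).ι (ePM ζ) * (D21 ζ).ι (ePP ζ) * (D21 ζ).ι (eMP ζ) *
      (D21 ζ).ι (fTwoDelta ζ) ^ (n + 2) =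
      (-(2 * sigma ζ 0) ^ (n + 2)) • ((uGens ζ).raise * (uGens ζ).f 0 ^ (n + 2)) := by
    rw [ePM_eq, ePP_eq, eMP_eq, fTwoDelta_eq, map_neg, map_smul]
    exact mul_neg_mul_smul_pow _ _ _ _ _ _ _
  rw [singVec, h, smul_assoc, mul_smul]

/-! ### Homomorphisms and composition factors -/

/-- The homomorphism of Verma modules that is given by a singular vector. -/
noncomputable def IsSingular.hom {ζ : ℂ} {lam nu : Weight} {u : Verma ζ lam}
    (hu : IsSingular ζ (nu - rho) u) : Verma ζ nu →ₗ[(D21 ζ).U] Verma ζ lam :=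
  (vermaIdeal ζ nu).liftQ (LinearMap.toSpanSingleton (D21 ζ).U _ u) <| by
    refine Submodule.span_le.2 ?_
    rintro X (⟨t, rfl⟩ | ⟨α, hα, x, hx, rfl⟩)
    · simp only [SetLike.mem_coe, LinearMap.mem_ker, LinearMap.toSpanSingleton_apply, sub_smul,
        hu.1 t, algebraMap_smul, sub_self]
    · simp only [SetLike.mem_coe, LinearMap.mem_ker, LinearMap.toSpanSingleton_apply,
        hu.2 α hα x hx]

theorem IsSingular.hom_ne_zero {ζ : ℂ} {lam nu : Weight} {u : Verma ζ lam}
    (hu : IsSingular ζ (nu - rho) u) (h0 : u ≠ 0) : hu.hom ≠ 0 := by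
  intro h
  apply h0
  have h1 : hu.hom (vermaVec ζ nu) = u := by
    exact ((vermaIdeal ζ nu).liftQ_apply _ 1).trans (one_smul _ u)
  rw [← h1, h, LinearMap.zero_apply]

end D21

/-- A nonzero homomorphism `M' → M` makes the quotient of `M'` by the sum of its proper submodules a
subquotient of `M`. -/
theorem compMult_pos_of_hom {R M M' : Type} [Ring R] [AddCommGroup M] [Module R M]
    [AddCommGroup M'] [Module R M'] (φ : M' →ₗ[R] M) (hφ : φ ≠ 0) :
    0 < compMult R M (M' ⧸ sSup {N : Submodule R M' | N ≠ ⊤}) := by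
  set K : Submodule R M' := sSup {N : Submodule R M' | N ≠ ⊤}
  -- As φ ≠ 0, its kernel is one of the proper submodules whose sum is `K`.
  have hK : LinearMap.ker φ ≤ K := le_sSup fun h => hφ (LinearMap.ker_eq_top.1 h)
  -- A chain with one step, φ(K) ≤ φ(M'), suffices: its quotient is M'/K because `K` contains the
  -- kernel.
  let F : Fin (1 + 1) →o Submodule R M :=
    ⟨![K.map φ, LinearMap.range φ], Fin.monotone_iff_le_succ.2 fun i => by
      obtain rfl : i = 0 := Subsingleton.elim _ _
      exact LinearMap.map_le_range⟩
  have hF : Nonempty ((F (Fin.succ 0) ⧸ (F (Fin.castSucc 0)).comap (F (Fin.succ 0)).subtype) ≃ₗ[R]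
      (M' ⧸ K)) := by
    let g : M' →ₗ[R] (LinearMap.range φ) ⧸ (K.map φ).comap (LinearMap.range φ).subtype :=
      ((K.map φ).comap (LinearMap.range φ).subtype).mkQ ∘ₗ φ.rangeRestrict
    have hg : Function.Surjective g :=
      (Submodule.mkQ_surjective _).comp φ.surjective_rangeRestrict
    have hker : LinearMap.ker g = K := by
      ext x
      rw [LinearMap.mem_ker, LinearMap.comp_apply, Submodule.mkQ_apply,
        Submodule.Quotient.mk_eq_zero, Submodule.mem_comap]
      refine ⟨?_, fun hx => ⟨x, hx, rfl⟩⟩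
      rintro ⟨y, hy, hxy⟩
      have hxy' : x - y ∈ LinearMap.ker φ := by
        rw [LinearMap.mem_ker, map_sub, sub_eq_zero]
        exact hxy.symm
      simpa using K.add_mem (hK hxy') hy
    exact ⟨((Submodule.quotEquivOfEq _ _ hker.symm).trans (g.quotKerEquivOfSurjective hg)).symm⟩
  refine lt_of_lt_of_le ?_ (le_iSup₂_of_le (f := fun (k : ℕ) (F : Fin (k + 1) →o Submodule R M) =>
    Set.encard {i : Fin k | Nonempty ((F i.succ ⧸ (F i.castSucc).comap (F i.succ).subtype) ≃ₗ[R]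
      (M' ⧸ K))}) 1 F le_rfl)
  exact Set.encard_pos.2 ⟨0, hF⟩

namespace D21

/-! ### Explicit action of odd operators on f₀² v -/

namespace Gens

theorem q_smul_f {σ : Fin 3 → ℂ} {A V : Type} [Ring A] [Algebra ℂ A] [AddCommGroup V] [Module A V]
    (G : Gens σ A) {i : Fin 3} {k l : Fin 3 → Fin 2} (hk : k i = 0)
    (hl : Function.update k i 1 = l) (x : V) :
    G.q k • G.f i • x = G.f i • G.q k • x - G.q l • x := by
  have h := congrArg (· • x) (G.f_mul_q hk hl)
  simp only [add_smul, mul_smul] at h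
  rw [h, add_sub_cancel_right]

/-- Since q_k kills `v`, the product q_k q_l acts on `v` as the anticommutator. -/
theorem HighestWeight.q_q {σ : Fin 3 → ℂ} {A V : Type} [Ring A] [Algebra ℂ A] [AddCommGroup V]
    [Module A V] [Module ℂ V] {G : Gens σ A} {μ : Weight} {v : V} (hv : G.HighestWeight μ v)
    {k : Fin 3 → Fin 2} (hk : k 0 = 0) {l : Fin 3 → Fin 2}
    {a : A} (h : G.q k * G.q l + G.q l * G.q k = a) : G.q k • G.q l • v = a • v := by
  rw [← h, add_smul, mul_smul, mul_smul, hv.q k hk, smul_zero, add_zero]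

namespace HighestWeight

variable {σ : Fin 3 → ℂ} {A V : Type} [Ring A] [Algebra ℂ A] [AddCommGroup V] [Module A V]
  [Module ℂ V] {G : Gens σ A} {μ : Weight} {v : V}

/-- Commuting q_k past each f₀ gives -q_l, which itself commutes with f₀; the term with q_k reaching
`v` is zero. -/
theorem q_f_f (hv : G.HighestWeight μ v) {k l : Fin 3 → Fin 2} (hk : k 0 = 0)
    (hl : Function.update k 0 1 = l) : G.q k • G.f 0 ^ 2 • v = (-2 : ℂ) • G.f 0 • G.q l • v := by
  have h : G.q l • G.f 0 • v = G.f 0 • G.q l • v := by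
    rw [smul_smul, smul_smul, G.f_comm_q (by rw [← hl]; simp)]
  rw [pow_two, mul_smul, G.q_smul_f hk hl, G.q_smul_f hk hl, h, hv.q k hk, smul_zero, zero_sub,
    smul_neg]
  generalize G.f 0 • G.q l • v = y
  module

variable [IsScalarTower ℂ A V]

theorem q001_q000_f_f (hv : G.HighestWeight μ v) :
    G.q ![0, 0, 1] • G.q ![0, 0, 0] • G.f 0 ^ 2 • v =
      (2 : ℂ) • G.q ![1, 0, 1] • G.q ![1, 0, 0] • v := by
  rw [hv.q_f_f rfl (update_index _ _ _ _).1, smul_comm, G.q_smul_f rfl (update_index _ _ _ _).1,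
    hv.q_q rfl G.q001_q100, smul_assoc, hv.e, smul_zero, smul_zero, zero_sub, smul_neg, neg_smul,
    neg_neg]

theorem q011_q100_smul (hv : G.HighestWeight μ v) : G.q ![0, 1, 1] • G.q ![1, 0, 0] • v =
    (-σ 0 * μ 0 + σ 1 * μ 1 + σ 2 * μ 2) • v := by
  rw [hv.q_q rfl G.q011_q100]
  simp only [add_smul, smul_assoc, hv.h, mul_smul]

/-- Needed when the fourth odd operator is absorbed by another tensor factor. The term with f₂ is
the useful one, since f₂ can be detected as multiplication by a variable. -/
theorem q011_q001_q000_f_f (hv : G.HighestWeight μ v) :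
    G.q ![0, 1, 1] • G.q ![0, 0, 1] • G.q ![0, 0, 0] • G.f 0 ^ 2 • v =
      (4 * σ 2) • G.f 2 • G.q ![1, 0, 0] • v -
        (2 * (-σ 0 * μ 0 + σ 1 * μ 1 + σ 2 * μ 2)) • G.q ![1, 0, 1] • v := by
  have h : ∀ x : V, G.q ![0, 1, 1] • G.q ![1, 0, 1] • x =
      (2 * σ 2) • G.f 2 • x - G.q ![1, 0, 1] • G.q ![0, 1, 1] • x := fun x => by
    rw [smul_smul, eq_sub_of_add_eq G.q011_q101, sub_smul, smul_assoc, mul_smul (G.q _) (G.q _)]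
  rw [hv.q001_q000_f_f, smul_comm, h, hv.q011_q100_smul, smul_comm (G.q ![1, 0, 1])]
  generalize G.f 2 • G.q ![1, 0, 0] • v = y
  generalize G.q ![1, 0, 1] • v = z
  module

/-- The case n = 0: the weight of the vector returns to that of `v`, and the vector is a multiple of
`v`. After the ρ-shift, with λ 0 = 0 and σ of sum zero, the two linear factors are σ₁λ₁ ∓ σ₂λ₂, that
is, the pairings with odd roots up to scalars. -/
theorem raise_f_f (hv : G.HighestWeight μ v) :
    G.raise • G.f 0 ^ 2 • v = (-2 * ((2 * σ 1 + σ 0 * μ 0 + σ 1 * μ 1 - σ 2 * μ 2) *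
      (-σ 0 * μ 0 + σ 1 * μ 1 + σ 2 * μ 2))) • v := by
  have h2 : G.q ![0, 0, 0] • G.q ![0, 1, 0] • G.f 0 ^ 2 • v =
      (2 : ℂ) • G.q ![1, 0, 0] • G.q ![1, 1, 0] • v := by
    rw [hv.q_f_f rfl (update_index _ _ _ _).1, smul_comm, G.q_smul_f rfl (update_index _ _ _ _).1,
      hv.q_q rfl G.q000_q110, smul_assoc, hv.e, smul_zero, smul_zero, zero_sub, smul_neg, neg_smul,
      neg_neg]
  have h3 : ∀ x : V, G.q ![0, 0, 1] • G.q ![1, 0, 0] • x =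
      (-2 * σ 1) • G.e 1 • x - G.q ![1, 0, 0] • G.q ![0, 0, 1] • x := fun x => by
    rw [smul_smul, eq_sub_of_add_eq G.q001_q100, sub_smul, smul_assoc, mul_smul (G.q _) (G.q _)]
  have h4 : G.e 1 • G.q ![1, 1, 0] • v = G.q ![1, 0, 0] • v := by
    rw [smul_smul, G.e_mul_q rfl (update_index _ _ _ _).2.1, add_smul, mul_smul, hv.e, smul_zero,
      zero_add]
  have h5 : G.q ![0, 0, 1] • G.q ![1, 1, 0] • v = (σ 0 * μ 0 + σ 1 * μ 1 - σ 2 * μ 2) • v := by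
    rw [hv.q_q rfl G.q001_q110]
    simp only [add_smul, sub_smul, smul_assoc, hv.h, mul_smul]
  have hr : ∀ x : V, G.raise • x =
      G.q ![0, 1, 1] • G.q ![0, 0, 1] • G.q ![0, 0, 0] • G.q ![0, 1, 0] • x := fun x => by
    simp only [raise, mul_smul]
  rw [hr, h2, smul_comm (G.q ![0, 0, 1]) (2 : ℂ), h3, h4, h5, smul_comm (G.q ![1, 0, 0]), ← sub_smul,
    smul_comm (G.q ![0, 1, 1]) (2 : ℂ), smul_comm (G.q ![0, 1, 1]), hv.q011_q100_smul]
  simp only [smul_smul]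
  congr 1
  ring

end HighestWeight

end Gens

/-! ### Testing vectors in tensor products -/

open TensorProduct

namespace Rep

variable {σ : Fin 3 → ℂ} {V W : Type} [AddCommGroup V] [Module ℂ V] [AddCommGroup W] [Module ℂ W]
  (R : Rep σ V) (S : Rep σ W)

theorem tensor_e (i : Fin 3) (v : V) (w : W) :
    (R.tensor S).e i (v ⊗ₜ w) = R.e i v ⊗ₜ w + v ⊗ₜ S.e i w := rfl

theorem tensor_f (i : Fin 3) (v : V) (w : W) :
    (R.tensor S).f i (v ⊗ₜ w) = R.f i v ⊗ₜ w + v ⊗ₜ S.f i w := rfl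

theorem tensor_h (i : Fin 3) (v : V) (w : W) :
    (R.tensor S).h i (v ⊗ₜ w) = R.h i v ⊗ₜ w + v ⊗ₜ S.h i w := rfl

theorem tensor_q (k : Fin 3 → Fin 2) (v : V) (w : W) :
    (R.tensor S).q k (v ⊗ₜ w) = R.q k v ⊗ₜ w + R.par v ⊗ₜ S.q k w := rfl

variable {R S} in
theorem highestWeight_tensor {μ ν : Weight} {v : V} {w : W} (hv : R.HighestWeight μ v)
    (hw : S.HighestWeight ν w) : (R.tensor S).HighestWeight (μ + ν) (v ⊗ₜ[ℂ] w) where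
  h i := by
    have h1 : R.h i v = μ i • v := hv.h i
    have h2 : S.h i w = ν i • w := hw.h i
    rw [Module.End.smul_def, tensor_h, h1, h2, ← smul_tmul', tmul_smul, ← add_smul, Pi.add_apply]
  e i := by
    have h1 : R.e i v = 0 := hv.e i
    have h2 : S.e i w = 0 := hw.e i
    rw [Module.End.smul_def, tensor_e, h1, h2, zero_tmul, tmul_zero, add_zero]
  q k hk := by
    have h1 : R.q k v = 0 := hv.q k hk
    have h2 : S.q k w = 0 := hw.q k hk
    rw [Module.End.smul_def, tensor_q, h1, h2, zero_tmul, tmul_zero, add_zero]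

theorem tensor_f_pow (i : Fin 3) (N : ℕ) (v : V) (w : W) :
    ((R.tensor S).f i ^ N) (v ⊗ₜ w) = ∑ j ∈ Finset.range (N + 1),
      (N.choose j : ℂ) • ((R.f i ^ j) v ⊗ₜ[ℂ] (S.f i ^ (N - j)) w) := by
  have hc : Commute (LinearMap.rTensor W (R.f i)) (LinearMap.lTensor V (S.f i)) := by
    refine TensorProduct.ext' fun v w => ?_
    simp
  change ((LinearMap.rTensor W (R.f i) + LinearMap.lTensor V (S.f i)) ^ N) (v ⊗ₜ w) = _
  rw [hc.add_pow, LinearMap.sum_apply]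
  refine Finset.sum_congr rfl fun j _ => ?_
  rw [LinearMap.rTensor_pow, LinearMap.lTensor_pow, ← Nat.cast_comm, Module.End.mul_apply,
    Module.End.mul_apply, LinearMap.lTensor_tmul, LinearMap.rTensor_tmul, Nat.cast_smul_eq_nsmul]
  simp

/-- Applying a linear form to the first tensor factor. -/
noncomputable def contract (φ : V →ₗ[ℂ] ℂ) : V ⊗[ℂ] W →ₗ[ℂ] W :=
  (TensorProduct.lid ℂ W).toLinearMap ∘ₗ LinearMap.rTensor W φ

theorem contract_tmul (φ : V →ₗ[ℂ] ℂ) (v : V) (w : W) : contract φ (v ⊗ₜ[ℂ] w) = φ v • w := by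
  simp [contract]

/-- A linear form that sees exactly one power of f_i on the first factor isolates a single term of
the binomial expansion. -/
theorem contract_f_pow {φ : V →ₗ[ℂ] ℂ} {i : Fin 3} {v : V} {a : ℕ}
    (h : ∀ j, φ ((R.f i ^ j) v) = if j = a then 1 else 0) {N : ℕ} (ha : a ≤ N) (w : W) :
    contract φ (((R.tensor S).f i ^ N) (v ⊗ₜ w)) = (N.choose a : ℂ) • (S.f i ^ (N - a)) w := by
  rw [tensor_f_pow, map_sum, Finset.sum_eq_single a]
  · rw [map_smul, contract_tmul, h, if_pos rfl, one_smul]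
  · intro j _ hj
    rw [map_smul, contract_tmul, h, if_neg hj, zero_smul, smul_zero]
  · intro ha'
    exact absurd (Finset.mem_range.2 (Nat.lt_succ_of_le ha)) ha'

end Rep

/-! ### The test module -/

namespace SuperPoly

open MvPolynomial

/-- The coefficient of `(X i) ^ n`. -/
noncomputable def coefX (i : Fin 2) (n : ℕ) : SuperPoly →ₗ[ℂ] ℂ :=
  lcoeff ℂ (Finsupp.single i n) ∘ₗ LinearMap.fst ℂ _ _

/-- The coefficient of `(X i) ^ n ξ₀`. -/
noncomputable def coefXXi (i : Fin 2) (n : ℕ) : SuperPoly →ₗ[ℂ] ℂ :=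
  lcoeff ℂ (Finsupp.single i n) ∘ₗ LinearMap.fst ℂ _ _ ∘ₗ LinearMap.snd ℂ _ _

theorem coefX_apply (i : Fin 2) (n : ℕ) (φ φ₀ φ₁ φ₂ : Poly) :
    coefX i n (φ, φ₀, φ₁, φ₂) = coeff (Finsupp.single i n) φ := rfl

theorem coefXXi_apply (i : Fin 2) (n : ℕ) (φ φ₀ φ₁ φ₂ : Poly) :
    coefXXi i n (φ, φ₀, φ₁, φ₂) = coeff (Finsupp.single i n) φ₀ := rfl

theorem mulX_pow_one (i : Fin 2) (j : ℕ) :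
    (mulX i ^ j) (1, 0, 0, 0) = ((X i ^ j, 0, 0, 0) : SuperPoly) := by
  induction j with
  | zero => rfl
  | succ j ih => simp [pow_succ', ih, mulX_apply]

theorem coefX_mulX_pow (i : Fin 2) (n j : ℕ) :
    coefX i n ((mulX i ^ j) (1, 0, 0, 0)) = if j = n then 1 else 0 := by
  rw [mulX_pow_one, coefX_apply, coeff_X_pow]
  refine if_congr (Finsupp.single_injective i).eq_iff rfl rfl

variable {σ : Fin 3 → ℂ} (hσ : σ 0 + σ 1 + σ 2 = 0) (t : ℂ)

theorem rep_e (i) : (rep hσ t).e i = opE (σ 0) (σ 1) t i := rfl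

theorem rep_h (i) : (rep hσ t).h i = opH (σ 0) (σ 1) t i := rfl

theorem rep_q (k) : (rep hσ t).q k = opQ (σ 0) (σ 1) t k := rfl

theorem rep_par : (rep hσ t).par = parity := rfl

theorem opQ_zero_zero_zero_apply (s₀ s₁ t : ℂ) (φ φ₀ : Poly) :
    opQ s₀ s₁ t ![0, 0, 0] (φ, φ₀, 0, 0) = (0, pderiv 0 (pderiv 1 φ), 0, 0) := by
  simp [opQ, dXiDual, mulX_apply, dX_apply, mulXi_zero_apply, dXi_zero_apply, dXi_one_apply]

/-- The even component may stay unspecified: it is never read by the forms `coefXXi`, and applying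
q₀₁₁ afterwards sends it only to the coefficient of ξ₁. -/
theorem opQ_zero_zero_one_apply (s₀ s₁ t : ℂ) (φ φ₀ : Poly) :
    ∃ a, opQ s₀ s₁ t ![0, 0, 1] (φ, φ₀, 0, 0) =
      (a, 0, pderiv 0 (pderiv 1 φ), -pderiv 0 (pderiv 1 φ₀)) :=
  ⟨_, by
    simp [opQ, dXiDual, mulX_apply, dX_apply, mulXi_one_apply, dXi_zero_apply, dXi_one_apply]
    rfl⟩

theorem opQ_zero_one_zero_apply (s₀ s₁ t : ℂ) (φ φ₀ : Poly) :
    opQ s₀ s₁ t ![0, 1, 0] (φ, φ₀, 0, 0) = (0, -pderiv 0 φ, 0, 0) := by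
  simp [opQ, dXiDual, mulX_apply, dX_apply, mulXi_zero_apply, dXi_one_apply, Prod.zero_eq_mk]

theorem opQ_zero_one_one_apply (s₀ s₁ t : ℂ) (φ φ₀ : Poly) :
    opQ s₀ s₁ t ![0, 1, 1] (φ, φ₀, 0, 0) =
      (C (2 * s₁) * (X 1 * φ₀), 0, -pderiv 0 φ, pderiv 0 φ₀) := by
  simp [opQ, dXiDual, mulX_apply, dX_apply, mulXi_one_apply, dXi_zero_apply, smul_eq_C_mul]

theorem highestWeight_one :
    (rep hσ t).HighestWeight ![σ 1 * t, σ 0 * t, 0] ((1, 0, 0, 0) : SuperPoly) where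
  h := by
    refine slot_cases ?_ ?_ ?_ <;>
      simp [rep_h, opH, degXi, mulX_apply, dX_apply, mulXi_zero_apply, mulXi_one_apply,
        dXi_zero_apply, dXi_one_apply]
  e := by
    refine slot_cases ?_ ?_ ?_ <;>
      simp [rep_e, opE, degXi, mulX_apply, dX_apply, mulXi_zero_apply, mulXi_one_apply,
        dXi_zero_apply, dXi_one_apply]
  q := by
    refine forall_index (bit_cases (bit_cases (bit_cases ?_ ?_) (bit_cases ?_ ?_))
      (fun b c h => absurd h (by simp))) <;>
      simp [rep_q, opQ, dXiDual, mulX_apply, dX_apply, mulXi_zero_apply, mulXi_one_apply,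
        dXi_zero_apply, dXi_one_apply]

/-- After the swap, the first copy of sl₂ rotates the odd variables, and multiplication by ξ₀
becomes a positive odd operator. So 1 is no longer a highest weight vector, but ξ₀ is. -/
theorem highestWeight_xi_perm {σ : Fin 3 → ℂ}
    (hσ : (σ ∘ Equiv.swap 0 2) 0 + (σ ∘ Equiv.swap 0 2) 1 + (σ ∘ Equiv.swap 0 2) 2 = 0) (t : ℂ) :
    ((rep hσ t).perm (Equiv.swap 0 2)).HighestWeight ![1, σ 2 * t - 1, σ 1 * t - 1]
      ((0, 1, 0, 0) : SuperPoly) where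
  h := by
    refine slot_cases ?_ ?_ ?_ <;>
      simp [Rep.perm, rep_h, opH, degXi, mulX_apply, dX_apply, mulXi_zero_apply, mulXi_one_apply,
        dXi_zero_apply, dXi_one_apply, Equiv.swap_apply_of_ne_of_ne, smul_eq_C_mul, Prod.zero_eq_mk]
  e := by
    refine slot_cases ?_ ?_ ?_ <;>
      simp [Rep.perm, rep_e, opE, degXi, mulX_apply, dX_apply, mulXi_zero_apply, mulXi_one_apply,
        dXi_zero_apply, dXi_one_apply, Equiv.swap_apply_of_ne_of_ne]
  q := by
    refine forall_index (bit_cases (bit_cases (bit_cases ?_ ?_) (bit_cases ?_ ?_))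
      (fun b c h => absurd h (by simp))) <;>
      simp [Rep.perm, rep_q, opQ, dXiDual, mulX_apply, dX_apply, mulXi_zero_apply,
        dXi_zero_apply, dXi_one_apply, Equiv.swap_apply_of_ne_of_ne]

theorem highestWeight_one_perm {σ : Fin 3 → ℂ}
    (hσ : (σ ∘ Equiv.swap 1 2) 0 + (σ ∘ Equiv.swap 1 2) 1 + (σ ∘ Equiv.swap 1 2) 2 = 0) (t : ℂ) :
    ((rep hσ t).perm (Equiv.swap 1 2)).HighestWeight ![σ 2 * t, 0, σ 0 * t]
      ((1, 0, 0, 0) : SuperPoly) where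
  h := by
    have h := (highestWeight_one hσ t).h
    exact slot_cases (h 0) (h 2) (h 1)
  e i := (highestWeight_one hσ t).e _
  q k hk := (highestWeight_one hσ t).q _ hk

end SuperPoly

theorem highestWeight_adRep (ζ : ℂ) : (adRep ζ).HighestWeight ![2, 0, 0] (evenVec 0 slE) where
  h i := by
    change br ζ (evenVec i slH) (evenVec 0 slE) = _
    rw [br_evenVec]
    revert i
    refine slot_cases ?_ ?_ ?_ <;> simp [lie_slH_slE, evenVec_smul]
  e i := by
    change br ζ (evenVec i slE) (evenVec 0 slE) = _
    rw [br_evenVec, lie_self, evenVec_zero, ite_self]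
  q k hk := by
    change br ζ (oddBasis k) (evenVec 0 slE) = 0
    rw [br_oddBasis_evenVec, br_slE_oddBasis, if_neg (by simp [hk]), neg_zero]

theorem oddBasis_ne_zero (k) : oddBasis k ≠ 0 := fun h => by
  have h' := congrFun (congrFun (congrFun (congrArg Prod.snd h) (k 0)) (k 1)) (k 2)
  simp [oddBasis, oddVec] at h'

theorem adRep_q_ne_zero (ζ : ℂ) : (adRep ζ).q ![1, 0, 0] (evenVec 0 slE) ≠ 0 := by
  change br ζ (oddBasis ![1, 0, 0]) (evenVec 0 slE) ≠ 0
  rw [br_oddBasis_evenVec, br_slE_oddBasis_eq ζ rfl (Gens.update_index _ _ _ _).1]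
  exact neg_ne_zero.2 (oddBasis_ne_zero _)

theorem evenVec_slE_ne_zero : evenVec 0 slE ≠ 0 := fun h => by
  have h' := congrArg (fun X : sl2 => X.1 0 1) (congrFun (congrArg Prod.fst h) 0)
  simp [evenVec, slE] at h'

open TensorProduct

namespace Rep

variable {σ : Fin 3 → ℂ} {V W : Type} [AddCommGroup V] [Module ℂ V] [AddCommGroup W] [Module ℂ W]

theorem tmul_ne_zero_of_apply_eq_one {φ : V →ₗ[ℂ] ℂ} {v : V} (h : φ v = 1) {w : W} (hw : w ≠ 0) :
    v ⊗ₜ[ℂ] w ≠ 0 := fun h0 => hw <| by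
  rw [← one_smul ℂ w, ← h, ← contract_tmul, h0, map_zero]

open MvPolynomial SuperPoly

/-- On powers of x in the first factor, the coefficient of ξ₀ can only arise from q₀₁₀, which acts
as -∂ₓ followed by multiplication by ξ₀; q₀₀₀ contributes nothing because there is no y. The other
three odd operators must act on the second factor, and their three parity signs cancel the minus
sign. Reading off x^n selects f₀^(n+1) on the first factor. -/
theorem contract_raise_f_pow (hσ : σ 0 + σ 1 + σ 2 = 0) (t : ℂ) (S : Rep σ W) {n N : ℕ}
    (hn : n + 1 ≤ N) (w : W) :
    contract (coefXXi 0 n) (((rep hσ t).tensor S).raise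
      ((((rep hσ t).tensor S).f 0 ^ N) ((1, 0, 0, 0) ⊗ₜ w))) =
      ((N.choose (n + 1) : ℂ) * (n + 1)) •
        S.q ![0, 1, 1] (S.q ![0, 0, 1] (S.q ![0, 0, 0] ((S.f 0 ^ (N - (n + 1))) w))) := by
  have key : ∀ (j : ℕ) (w : W), contract (coefXXi 0 n) (((rep hσ t).tensor S).raise
      (((rep hσ t).f 0 ^ j) (1, 0, 0, 0) ⊗ₜ w)) =
      (if j = n + 1 then (n + 1 : ℂ) else 0) •
        S.q ![0, 1, 1] (S.q ![0, 0, 1] (S.q ![0, 0, 0] w)) := by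
    intro j w
    have hv : ((rep hσ t).f 0 ^ j) (1, 0, 0, 0) = (X 0 ^ j, 0, 0, 0) := mulX_pow_one 0 j
    have hc : coeff (Finsupp.single (0 : Fin 2) n) (pderiv 0 (X 0 ^ j : Poly)) =
        if j = n + 1 then (n + 1 : ℂ) else 0 := by
      obtain _ | j := j
      · simp
      · rw [pderiv_pow, pderiv_X_self, mul_one, Nat.add_sub_cancel, ← map_natCast (C : ℂ →+* Poly),
          coeff_C_mul, coeff_X_pow]
        have h : (if Finsupp.single (0 : Fin 2) j = Finsupp.single 0 n then (1 : ℂ) else 0) =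
            if j = n then 1 else 0 := if_congr (Finsupp.single_injective 0).eq_iff rfl rfl
        rw [h]
        by_cases hj : j = n
        · subst hj; simp
        · simp [hj]
    rw [hv]
    simp only [Gens.raise, Module.End.mul_apply, tensor_q, map_add, rep_q, rep_par, contract_tmul]
    have h1 : pderiv 1 (X 0 ^ j : Poly) = 0 := by simp [pderiv_X]
    have h01 : pderiv 1 (pderiv 0 (X 0 ^ j : Poly)) = 0 := by rw [pderiv_comm, h1, map_zero]
    obtain ⟨a, ha⟩ := opQ_zero_zero_one_apply (σ 0) (σ 1) t (X 0 ^ j) 0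
    obtain ⟨b, hb⟩ := opQ_zero_zero_one_apply (σ 0) (σ 1) t 0 (pderiv 0 (X 0 ^ j))
    have hz : ((0, 0, 0, 0) : SuperPoly) = 0 := rfl
    simp only [h1, h01, map_zero, neg_zero] at ha hb
    simp only [opQ_zero_one_zero_apply, opQ_zero_zero_zero_apply, ha, hb, opQ_zero_one_one_apply,
      parity_apply, h1, map_zero, neg_zero, neg_neg, coefXXi_apply, hz, hc, coeff_zero, zero_smul,
      add_zero, zero_add]
  rw [tensor_f_pow, map_sum, map_sum, Finset.sum_eq_single (n + 1)]
  · rw [map_smul, map_smul, key, if_pos rfl, smul_smul]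
  · intro j _ hj
    rw [map_smul, map_smul, key, if_neg hj, zero_smul, smul_zero]
  · intro h
    exact absurd (Finset.mem_range.2 (Nat.lt_succ_of_le hn)) h

end Rep

/-! ### Three parameter families and the test vector -/

open TensorProduct

theorem sigma_sum (ζ : ℂ) : sigma ζ 0 + sigma ζ 1 + sigma ζ 2 = 0 := by
  simp [sigma]
  ring

theorem sigma_swap_one_two (ζ : ℂ) : (sigma ζ ∘ Equiv.swap 1 2) 0 + (sigma ζ ∘ Equiv.swap 1 2) 1 +
    (sigma ζ ∘ Equiv.swap 1 2) 2 = 0 := by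
  have h : sigma ζ 0 + sigma ζ 2 + sigma ζ 1 = 0 := by linear_combination sigma_sum ζ
  exact h

theorem sigma_swap_zero_two (ζ : ℂ) : (sigma ζ ∘ Equiv.swap 0 2) 0 +
    (sigma ζ ∘ Equiv.swap 0 2) 1 + (sigma ζ ∘ Equiv.swap 0 2) 2 = 0 := by
  have h : sigma ζ 2 + sigma ζ 1 + sigma ζ 0 = 0 := by linear_combination sigma_sum ζ
  exact h

open SuperPoly

/-- The family of representations whose highest weight vanishes on the third copy of `sl₂`. -/
noncomputable def rep01 (ζ t : ℂ) : Rep (sigma ζ) SuperPoly := rep (sigma_sum ζ) t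

/-- The family of representations whose highest weight vanishes on the second copy of `sl₂`. -/
noncomputable def rep02 (ζ t : ℂ) : Rep (sigma ζ) SuperPoly :=
  (rep (sigma_swap_one_two ζ) t).perm (Equiv.swap 1 2)

/-- The family of representations with highest weight vector `ξ₀`, of weight `1` on the first copy
of `sl₂`. -/
noncomputable def rep12 (ζ t : ℂ) : Rep (sigma ζ) SuperPoly :=
  (rep (sigma_swap_zero_two ζ) t).perm (Equiv.swap 0 2)

theorem rep02_q (ζ t : ℂ) (b c : Fin 2) : (rep02 ζ t).q ![1, b, c] (1, 0, 0, 0) =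
    opQ (sigma ζ 0) (sigma ζ 2) t ![1, c, b] (1, 0, 0, 0) := by
  have h : (![1, b, c] : Fin 3 → Fin 2) ∘ Equiv.swap 1 2 = ![1, c, b] :=
    funext (slot_cases rfl rfl rfl)
  rw [← h]
  rfl

theorem rep02_q_one_zero_zero (ζ t : ℂ) : (rep02 ζ t).q ![1, 0, 0] (1, 0, 0, 0) = 0 := by
  rw [rep02_q]
  simp [opQ, dXiDual, mulX_apply, dX_apply, mulXi_zero_apply, dXi_one_apply]

theorem rep02_q_one_zero_one (ζ t : ℂ) :
    (rep02 ζ t).q ![1, 0, 1] (1, 0, 0, 0) = (0, 1, 0, 0) := by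
  rw [rep02_q]
  simp [opQ, mulXi_zero_apply]

theorem rep12_q_one_zero_zero (ζ t : ℂ) :
    coefXXi 0 0 ((rep12 ζ t).q ![1, 0, 0] (0, 1, 0, 0)) = 0 := by
  have h : (rep12 ζ t).q ![1, 0, 0] = opQ (sigma ζ 2) (sigma ζ 1) t ![0, 0, 1] := by
    have h : (![1, 0, 0] : Fin 3 → Fin 2) ∘ Equiv.swap 0 2 = ![0, 0, 1] :=
      funext (slot_cases rfl rfl rfl)
    rw [← h]
    rfl
  obtain ⟨a, ha⟩ := opQ_zero_zero_one_apply (sigma ζ 2) (sigma ζ 1) t 0 1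
  rw [h, ha, coefXXi_apply, MvPolynomial.coeff_zero]

variable {W : Type} [AddCommGroup W] [Module ℂ W] {ζ : ℂ} (S : Rep (sigma ζ) W)

/-- In the first factor q₁₀₀ moves ξ₀ away from the coefficient being read, so only its action on
`w` remains; the sign is the parity of ξ₀. -/
theorem contract_rep12_tensor (t : ℂ) (w : W) :
    Rep.contract (coefXXi 0 0) (((rep12 ζ t).tensor S).q ![1, 0, 0] ((0, 1, 0, 0) ⊗ₜ w)) =
      -S.q ![1, 0, 0] w := by
  have h : (rep12 ζ t).par (0, 1, 0, 0) = ((0, -1, 0, 0) : SuperPoly) := by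
    change parity _ = _
    rw [parity_apply, neg_zero]
  have h' : coefXXi 0 0 (0, -1, 0, 0) = -1 := by simp [coefXXi_apply]
  rw [Rep.tensor_q, map_add, Rep.contract_tmul, Rep.contract_tmul, rep12_q_one_zero_zero, h, h',
    zero_smul, zero_add, neg_one_smul]

-- By `q011_q001_q000_f_f` the vector is a combination of f₂ q₁₀₀ and q₁₀₁ applied to the highest
-- weight vector. In `rep02`, q₁₀₀ kills 1, q₁₀₁ sends it to ξ₀, and f₂ multiplies by the second
-- even variable; the coefficient of that variable retains just the term with f₂ on the first factor
-- and q₁₀₀ on the second.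
variable {S} in
theorem contract_rep02_tensor (t : ℂ) {μ : Weight} {w : W} (hw : S.HighestWeight μ w) :
    Rep.contract (coefX 1 1) (((rep02 ζ t).tensor S).q ![0, 1, 1]
      (((rep02 ζ t).tensor S).q ![0, 0, 1] (((rep02 ζ t).tensor S).q ![0, 0, 0]
        ((((rep02 ζ t).tensor S).f 0 ^ 2) ((1, 0, 0, 0) ⊗ₜ w))))) =
      (4 * sigma ζ 2) • S.q ![1, 0, 0] w := by
  have h := (Rep.highestWeight_tensor (highestWeight_one_perm (sigma_swap_one_two ζ) t)
    hw).q011_q001_q000_f_f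
  have hp : (rep02 ζ t).par (1, 0, 0, 0) = ((1, 0, 0, 0) : SuperPoly) := by
    change parity _ = _
    rw [parity_apply, neg_zero]
  have hf : (rep02 ζ t).f 2 (1, 0, 0, 0) = ((MvPolynomial.X 1, 0, 0, 0) : SuperPoly) := by
    change mulX 1 _ = _
    rw [mulX_apply, mul_one, mul_zero]
  have h1 : coefX 1 1 ((1, 0, 0, 0) : SuperPoly) = 0 := by
    rw [coefX_apply, MvPolynomial.coeff_one, if_neg (Finsupp.single_ne_zero.2 one_ne_zero).symm]
  have h2 : coefX 1 1 (MvPolynomial.X 1, 0, 0, 0) = 1 := by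
    simp [coefX_apply]
  have h3 : coefX 1 1 (0, 1, 0, 0) = 0 := by
    simp [coefX_apply]
  refine (congrArg (Rep.contract (coefX 1 1)) h).trans ?_
  change Rep.contract (coefX 1 1) (_ • ((rep02 ζ t).tensor S).f 2
    (((rep02 ζ t).tensor S).q ![1, 0, 0] _) - _ • ((rep02 ζ t).tensor S).q ![1, 0, 1] _) = _
  rw [Rep.tensor_q, Rep.tensor_q, rep02_q_one_zero_zero, rep02_q_one_zero_one, hp, zero_tmul,
    zero_add, Rep.tensor_f, hf, map_sub, map_smul, map_smul, map_add, map_add]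
  simp only [Rep.contract_tmul, h1, h2, h3]
  simp

/-- The space of the test module. -/
abbrev TestSpace : Type := SuperPoly ⊗[ℂ] (SuperPoly ⊗[ℂ] (SuperPoly ⊗[ℂ] Carrier))

/-- A module in which highest weight vectors of arbitrary weights exist. -/
noncomputable def testRep (ζ a b c : ℂ) : Rep (sigma ζ) TestSpace :=
  (rep01 ζ a).tensor ((rep02 ζ b).tensor ((rep12 ζ c).tensor (adRep ζ)))

/-- The highest weight vector of `rep12 ⊗ adRep`. -/
noncomputable def testVecTail : SuperPoly ⊗[ℂ] Carrier := (0, 1, 0, 0) ⊗ₜ evenVec 0 slE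

/-- The highest weight vector of `testRep`. -/
noncomputable def testVec : TestSpace := (1, 0, 0, 0) ⊗ₜ ((1, 0, 0, 0) ⊗ₜ testVecTail)

theorem coefX_one (i : Fin 2) : coefX i 0 ((1, 0, 0, 0) : SuperPoly) = 1 := by
  simp [coefX_apply]

theorem testVecTail_ne_zero : testVecTail ≠ 0 :=
  Rep.tmul_ne_zero_of_apply_eq_one (φ := coefXXi 0 0) (by simp [coefXXi_apply])
    evenVec_slE_ne_zero

theorem one_tmul_testVecTail_ne_zero : ((1, 0, 0, 0) : SuperPoly) ⊗ₜ[ℂ] testVecTail ≠ 0 :=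
  Rep.tmul_ne_zero_of_apply_eq_one (coefX_one 0) testVecTail_ne_zero

theorem testRep_f_one_ne_zero (ζ a b c : ℂ) (n : ℕ) :
    ((testRep ζ a b c).f 1 ^ n) testVec ≠ 0 := by
  intro h
  have h' := Rep.contract_f_pow (R := rep01 ζ a)
    (S := (rep02 ζ b).tensor ((rep12 ζ c).tensor (adRep ζ))) (φ := coefX 1 n) (i := 1)
    (coefX_mulX_pow 1 n) le_rfl (((1, 0, 0, 0) : SuperPoly) ⊗ₜ testVecTail)
  refine one_tmul_testVecTail_ne_zero ?_
  rw [Nat.choose_self, Nat.sub_self, pow_zero, Nat.cast_one, one_smul] at h'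
  exact h'.symm.trans ((congrArg _ h).trans (map_zero _))

theorem rep01_f_two (ζ a : ℂ) (j : ℕ) :
    coefX 0 0 (((rep01 ζ a).f 2 ^ j) (1, 0, 0, 0)) = if j = 0 then 1 else 0 := by
  have h : (rep01 ζ a).f 2 (1, 0, 0, 0) = (0 : SuperPoly) := by
    change (mulXi 1 * dXi 0) _ = _
    rw [Module.End.mul_apply, dXi_zero_apply]
    exact map_zero _
  obtain _ | j := j
  · exact coefX_one 0
  · rw [pow_succ, Module.End.mul_apply, h, map_zero, map_zero, if_neg (Nat.succ_ne_zero j)]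

/-- In `rep01` the operator f₂ kills 1, so all of its powers pass to `rep02`, where f₂ is
multiplication by a variable. -/
theorem testRep_f_two_ne_zero (ζ a b c : ℂ) (n : ℕ) :
    ((testRep ζ a b c).f 2 ^ n) testVec ≠ 0 := by
  intro h
  have h' := Rep.contract_f_pow (R := rep01 ζ a)
    (S := (rep02 ζ b).tensor ((rep12 ζ c).tensor (adRep ζ))) (φ := coefX 0 0) (i := 2)
    (rep01_f_two ζ a) (Nat.zero_le n) (((1, 0, 0, 0) : SuperPoly) ⊗ₜ testVecTail)
  have h'' := Rep.contract_f_pow (R := rep02 ζ b)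
    (S := (rep12 ζ c).tensor (adRep ζ)) (φ := coefX 1 n) (i := 2)
    (coefX_mulX_pow 1 n) le_rfl testVecTail
  refine testVecTail_ne_zero ?_
  rw [Nat.choose_zero_right, Nat.sub_zero, Nat.cast_one, one_smul] at h'
  rw [Nat.choose_self, Nat.sub_self, pow_zero, Nat.cast_one, one_smul] at h''
  have h0 := h'.symm.trans ((congrArg _ h).trans (map_zero _))
  exact h''.symm.trans ((congrArg _ h0).trans (map_zero _))

theorem testVecTail_highestWeight (ζ c : ℂ) : ((rep12 ζ c).tensor (adRep ζ)).HighestWeight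
    (![1, sigma ζ 2 * c - 1, sigma ζ 1 * c - 1] + ![2, 0, 0]) testVecTail :=
  Rep.highestWeight_tensor (highestWeight_xi_perm (sigma_swap_zero_two ζ) c)
    (highestWeight_adRep ζ)

theorem testVec_highestWeight (ζ a b c : ℂ) : (testRep ζ a b c).HighestWeight
    ![sigma ζ 1 * a + sigma ζ 2 * b + 3, sigma ζ 0 * a + sigma ζ 2 * c - 1,
      sigma ζ 0 * b + sigma ζ 1 * c - 1] testVec := by
  have h := Rep.highestWeight_tensor (highestWeight_one (sigma_sum ζ) a)
    (Rep.highestWeight_tensor (highestWeight_one_perm (sigma_swap_one_two ζ) b)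
      (testVecTail_highestWeight ζ c))
  refine cast (congrArg (fun μ => (testRep ζ a b c).HighestWeight μ testVec) ?_) h
  refine funext (slot_cases ?_ ?_ ?_) <;> simp <;> ring

/-- The factors are peeled off in turn: `rep01` takes f₀^(n+1) and q₀₁₀, `rep02` reduces the
remaining three odd operators and f₀² to 4σ₂q₁₀₀, and `rep12` passes q₁₀₀ on to the adjoint
representation. There q₁₀₀ acts nontrivially on the highest root vector whatever the parameters are,
which is why that factor is present. -/
theorem testRep_raise_ne_zero (h2 : sigma ζ 2 ≠ 0) (a b c : ℂ) (n : ℕ) :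
    (testRep ζ a b c).raise (((testRep ζ a b c).f 0 ^ (n + 1 + 2)) testVec) ≠ 0 := by
  intro h
  have h1 := Rep.contract_raise_f_pow (sigma_sum ζ) a
    ((rep02 ζ b).tensor ((rep12 ζ c).tensor (adRep ζ))) (n := n) (N := n + 1 + 2) (by omega)
    (((1, 0, 0, 0) : SuperPoly) ⊗ₜ testVecTail)
  have h0 := h1.symm.trans ((congrArg _ h).trans (map_zero _))
  rw [Nat.add_sub_cancel_left, smul_eq_zero, or_iff_right] at h0
  · have h3 := contract_rep02_tensor b (testVecTail_highestWeight ζ c)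
    have h4 := h3.symm.trans ((congrArg _ h0).trans (map_zero _))
    rw [smul_eq_zero, or_iff_right (mul_ne_zero (OfNat.ofNat_ne_zero 4) h2)] at h4
    have h5 := contract_rep12_tensor (adRep ζ) c (evenVec 0 slE)
    have h6 := h5.symm.trans ((congrArg _ h4).trans (map_zero _))
    exact adRep_q_ne_zero ζ (neg_eq_zero.1 h6)
  · refine mul_ne_zero (Nat.cast_ne_zero.2 (Nat.choose_pos (by omega)).ne') ?_
    exact_mod_cast Nat.succ_ne_zero n

theorem exists_testVec_highestWeight (h : ∀ i, sigma ζ i ≠ 0) (μ : Weight) :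
    ∃ a b c, (testRep ζ a b c).HighestWeight μ testVec := by
  have h0 := h 0
  have h1 := h 1
  have h2 := h 2
  -- Multiplying the i-th weight equation by σᵢ leaves the pairwise sums of σ₀σ₁a, σ₀σ₂b and σ₁σ₂c
  -- on one side and `A`, `B`, `C` on the other. Such a system is solved by half-differences.
  let A := sigma ζ 0 * (μ 0 - 3)
  let B := sigma ζ 1 * (μ 1 + 1)
  let C := sigma ζ 2 * (μ 2 + 1)
  refine ⟨(A + B - C) / (2 * (sigma ζ 0 * sigma ζ 1)), (A + C - B) / (2 * (sigma ζ 0 * sigma ζ 2)),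
    (B + C - A) / (2 * (sigma ζ 1 * sigma ζ 2)), ?_⟩
  refine cast (congrArg (fun μ => (testRep ζ _ _ _).HighestWeight μ testVec) ?_)
    (testVec_highestWeight ζ _ _ _)
  refine funext (slot_cases ?_ ?_ ?_) <;>
    simp only [Matrix.cons_val_zero, Matrix.cons_val_one, Matrix.cons_val, A, B, C] <;>
    field_simp <;> ring

/-! ### Nonvanishing in Verma modules and the conclusion -/

theorem sigma_ne_zero {ζ : ℂ} (hζ0 : ζ ≠ 0) (hζ1 : ζ ≠ -1) : ∀ i, sigma ζ i ≠ 0 := by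
  have h : 1 + ζ ≠ 0 := fun h => hζ1 (by linear_combination h)
  refine slot_cases ?_ ?_ ?_ <;> simp only [sigma, Matrix.cons_val] <;>
    refine div_ne_zero ?_ two_ne_zero
  exacts [neg_ne_zero.2 h, one_ne_zero, hζ0]

theorem pair_coroot (lam : Weight) (i : Fin 3) : pair lam (coroot i) = lam i := by
  simp [pair, coroot, Pi.single_apply]

theorem form_oddRoot (ζ : ℂ) (lam : Weight) (s : ℤˣ × ℤˣ) : form ζ lam (oddRoot s) =
    2 * (sigma ζ 0 * lam 0 + ((s.1 : ℤ) : ℂ) * (sigma ζ 1 * lam 1) +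
      ((s.2 : ℤ) : ℂ) * (sigma ζ 2 * lam 2)) := by
  simp [form, oddRoot, sigma]
  ring

section

variable {ζ : ℂ}

theorem f_pow_smul_vermaVec_ne_zero (hσ : ∀ i, sigma ζ i ≠ 0) (lam : Weight) {i : Fin 3}
    (hi : i ≠ 0) (n : ℕ) : (uGens ζ).f i ^ n • vermaVec ζ lam ≠ 0 := by
  obtain ⟨a, b, c, hv⟩ := exists_testVec_highestWeight hσ (lam - rho)
  refine hv.smul_vermaVec_ne_zero ?_
  rw [map_pow, Gens.lift_f]
  have h : ∀ j : Fin 3, j ≠ 0 → (testRep ζ a b c).f j ^ n • testVec ≠ 0 :=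
    slot_cases (fun h => absurd rfl h) (fun _ => testRep_f_one_ne_zero ζ a b c n)
      (fun _ => testRep_f_two_ne_zero ζ a b c n)
  exact h i hi

theorem vermaVec_ne_zero (hσ : ∀ i, sigma ζ i ≠ 0) (lam : Weight) : vermaVec ζ lam ≠ 0 := by
  simpa using f_pow_smul_vermaVec_ne_zero hσ lam (i := 1) one_ne_zero 0

theorem raise_f_pow_smul_vermaVec_ne_zero (hσ : ∀ i, sigma ζ i ≠ 0) (lam : Weight) {n : ℕ}
    (hn : n ≠ 0) : (uGens ζ).raise • (uGens ζ).f 0 ^ (n + 2) • vermaVec ζ lam ≠ 0 := by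
  obtain ⟨n, rfl⟩ := Nat.exists_eq_succ_of_ne_zero hn
  obtain ⟨a, b, c, hv⟩ := exists_testVec_highestWeight hσ (lam - rho)
  rw [← mul_smul]
  refine hv.smul_vermaVec_ne_zero ?_
  simp only [Gens.raise, map_mul, map_pow, Gens.lift_q, Gens.lift_f]
  exact testRep_raise_ne_zero (hσ 2) a b c n

/-- With λ 0 = 0 the odd roots δ + ε₁ - ε₂ and δ + ε₁ + ε₂ give, up to the factor 2, the two linear
factors of the scalar in `raise_f_f`; the ρ-shift is absorbed by the sum-zero condition on σ. -/
theorem raise_f_sq_smul_vermaVec_ne_zero (hσ : ∀ i, sigma ζ i ≠ 0) {lam : Weight}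
    (h0 : lam 0 = 0) (hlam : Typical ζ lam) :
    (uGens ζ).raise • (uGens ζ).f 0 ^ 2 • vermaVec ζ lam ≠ 0 := by
  have h1 := hlam (1, -1)
  have h2 := hlam (1, 1)
  rw [form_oddRoot, h0] at h1 h2
  rw [(highestWeight_vermaVec ζ lam).raise_f_f]
  refine smul_ne_zero (mul_ne_zero (by norm_num) (mul_ne_zero (fun h => h1 ?_) (fun h => h2 ?_)))
    (vermaVec_ne_zero hσ lam)
  · simp [rho_eq, h0] at h ⊢
    linear_combination h - sigma_sum ζ
  · simp [rho_eq, h0] at h ⊢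
    linear_combination h + sigma_sum ζ

theorem isSingular_singVec (hσ : ∀ i, sigma ζ i ≠ 0) {lam : Weight} {n : ℕ} (hn : lam 0 = n) :
    IsSingular ζ (lam - rho - (n : ℂ) • evenRoot 0) (singVec ζ lam n) := by
  have h := ((highestWeight_vermaVec ζ lam).raise_f_pow (hσ 0) (n := n)
    (by simp [rho_eq, hn])).isSingular
  rw [singVec_eq]
  refine ⟨fun t => ?_, fun α hα x hx => ?_⟩
  · rw [smul_comm, h.1 t, smul_comm]
  · rw [smul_comm, h.2 α hα x hx]
    exact smul_zero (M := ℂ) (A := Verma ζ lam) _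

theorem singVec_ne_zero (hσ : ∀ i, sigma ζ i ≠ 0) {lam : Weight} {n : ℕ} (hn : lam 0 = n)
    (h : n ≠ 0 ∨ Typical ζ lam) : singVec ζ lam n ≠ 0 := by
  rw [singVec_eq]
  have hc : -(2 * sigma ζ 0) ^ (n + 2) ≠ 0 :=
    neg_ne_zero.2 (pow_ne_zero _ (mul_ne_zero two_ne_zero (hσ 0)))
  refine smul_ne_zero (M := Verma ζ lam) hc ?_
  by_cases h0 : n = 0
  · subst h0
    exact raise_f_sq_smul_vermaVec_ne_zero hσ (by simpa using hn)
      (h.resolve_left fun h => h rfl)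
  · exact raise_f_pow_smul_vermaVec_ne_zero hσ lam h0

theorem exists_isSingular (hσ : ∀ i, sigma ζ i ≠ 0) {lam : Weight} {i : Fin 3} {n : ℕ}
    (hn : lam i = n) : ∃ u : Verma ζ lam, u ≠ 0 ∧
      IsSingular ζ (lam - rho - (n : ℂ) • evenRoot i) u := by
  by_cases hi : i = 0
  · subst hi
    by_cases h0 : n = 0
    -- For n = 0 the highest weight vector itself has the required weight; `singVec` is avoided
    -- since it may vanish in the atypical case.
    · subst h0
      refine ⟨_, vermaVec_ne_zero hσ lam, ?_⟩
      simpa using (highestWeight_vermaVec ζ lam).isSingular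
    · exact ⟨_, singVec_ne_zero hσ hn (Or.inl h0), isSingular_singVec hσ hn⟩
  · refine ⟨_, f_pow_smul_vermaVec_ne_zero hσ lam hi n,
      ((highestWeight_vermaVec ζ lam).f_pow (hσ 0) hi ?_).isSingular⟩
    have h : ∀ j : Fin 3, j ≠ 0 → rho j = 1 := by
      rw [rho_eq]
      exact slot_cases (fun h => absurd rfl h) (fun _ => rfl) (fun _ => rfl)
    rw [Pi.sub_apply, hn, h i hi]

end

end D21

theorem mainTheorem8 (ζ : ℂ) (hζ0 : ζ ≠ 0) (hζ1 : ζ ≠ -1) (γ : Fin 3) (lam : D21.Weight) (n : ℕ)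
    (hn : D21.pair lam (D21.coroot γ) = n) :
    (∃ u : D21.Verma ζ lam, u ≠ 0 ∧
      D21.IsSingular ζ (lam - D21.rho - (n : ℂ) • D21.evenRoot γ) u) ∧
    (∃ φ : D21.Verma ζ (D21.reflection γ lam) →ₗ[(D21 ζ).U] D21.Verma ζ lam, φ ≠ 0) ∧
    0 < compMult (D21 ζ).U (D21.Verma ζ lam) (D21.Irr ζ (D21.reflection γ lam)) ∧
    (γ = 0 →
      D21.IsSingular ζ (lam - D21.rho - (n : ℂ) • D21.evenRoot γ) (D21.singVec ζ lam n) ∧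
      (n ≠ 0 ∨ D21.Typical ζ lam → D21.singVec ζ lam n ≠ 0)) := by
  rw [D21.pair_coroot] at hn
  have hσ := D21.sigma_ne_zero hζ0 hζ1
  obtain ⟨u, hu0, hu⟩ := D21.exists_isSingular hσ hn
  -- The singular vector has exactly the highest weight of the Verma module of the reflected weight,
  -- so it defines the homomorphism.
  have hr : D21.reflection γ lam - D21.rho = lam - D21.rho - (n : ℂ) • D21.evenRoot γ := by
    rw [D21.reflection, D21.pair_coroot, hn, sub_right_comm]
  have hu' := hu
  rw [← hr] at hu'
  have hφ := hu'.hom_ne_zero hu0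
  refine ⟨⟨u, hu0, hu⟩, ⟨hu'.hom, hφ⟩, compMult_pos_of_hom _ hφ, fun hγ => ?_⟩
  subst hγ
  exact ⟨D21.isSingular_singVec hσ hn, D21.singVec_ne_zero hσ hn⟩
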